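/- **Setting.** Consider a limit order book on the price levels $1,\dots,N$ with initial best bid $p_B\ge 1$ and best ask $p_A\le N$, spread $s_0=p_A-p_B\ge 1$ and initial best queues of sizes $q_0^A,q_0^B\ge 1$. All orders have unit size. The best ask (bid) is the lowest (highest) level with outstanding sell (buy) orders, the mid-price is their average, and $\tau$ is the time of the first change of the mid-price. In a queue of size $k$ at level $l$, limit orders, market orders and cancellations have rates $\lambda_k(X_l)$, $\mu_k(X_l)$, $\phi_k(X_l)\ge 0$, where the state variables $X_l$ keep their initial values until the mid-price moves. (The rate $\lambda_k(X_l)$ may differ for buy and sell limit orders.) Assume that the total arrival rate inside the spread is the same for sell and for buy limit orders, $$\Lambda=\sum_{m=1}^{s_0-1}\lambda_0(X_{p_A-m})=\sum_{m=1}^{s_0-1}\lambda_0(X_{p_B+m}),$$ where the first sum refers to sell orders and the second to buy orders. At time $0$ a limit order that is never cancelled is the last order of the best queue of side $i\in\{A,B\}$; let $j\ne i$ be the other side. Up to and including the time $\tau$, the order flow is given by independent processes: the queue position of the order, a pure-death process started at $q_0^i$ with death rates $\mu_k(X_{p_i})+\phi_k(X_{p_i})$ (assumed positive for $1\le k\le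 q_0^i$); the opposite best queue, a non-explosive birth-death process started at $q_0^j$ with birth rates $\lambda_k(X_{p_j})$ and death rates $\mu_k(X_{p_j})+\phi_k(X_{p_j})$; and, for each side and each level $l$ inside the spread, arrivals of limit orders at rate $\lambda_0(X_l)$. Let $\epsilon_i$ and $\sigma_j\in(0,\infty]$ be the first-passage times to $0$ of the first two processes. The order is filled before the mid-price moves if $\epsilon_i<\infty$ and the mid-price does not change during $[0,\epsilon_i)$, i.e. $\epsilon_i\le\tau$ (the execution of the order may itself move the mid-price). **Proposition.** The times $\epsilon_i$ and $\sigma_j$ have densities $g$ and $f$ on $(0,\infty)$ (that of $\sigma_j$ being defective if $P(\sigma_j=\infty)>0$), with Laplace transforms $\hat g_{\epsilon_i}$ and $\hat f_{\sigma_j}$, and the following hold. 1. For all $s\in\mathbb C$ with $\operatorname{Re}s>-\min_{1\le k\le q_0^i}(\mu_k(X_{p_i})+\phi_k(X_{p_i}))$, the integral defining $\hat g_{\epsilon_i}(s)$ converges absolutely and $$\hat g_{\epsilon_i}(s)=\prod_{k=1}^{q_0^i}\frac{\mu_k(X_{p_i})+\phi_k(X_{p_i})}{\mu_k(X_{p_i})+\phi_k(X_{p_i})+s}.$$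 In what follows $\hat g_{\epsilon_i}$ denotes this rational function. 2. If $\lambda_k(X_{p_j})>0$ for $k\ge 0$ and $\mu_k(X_{p_j})+\phi_k(X_{p_j})>0$ for $k\ge1$, then, for every $s\in\mathbb C$ at which the integral defining $\hat f_{\sigma_j}(s)$ converges absolutely, the following continued fractions converge and $$\hat f_{\sigma_j}(s)=\prod_{m=1}^{q_0^j}\left(-\frac1{\lambda_{m-1}(X_{p_j})}\;\mathop{\mathrm K}_{k=m}^{\infty}\frac{-\lambda_{k-1}(X_{p_j})\,(\mu_k(X_{p_j})+\phi_k(X_{p_j}))}{\lambda_k(X_{p_j})+\mu_k(X_{p_j})+\phi_k(X_{p_j})+s}\right).$$ 3. Put $$\hat F(s)=\frac1s\,\hat g_{\epsilon_i}(s)\left(\hat f_{\sigma_j}(2\Lambda-s)+\frac{2\Lambda}{2\Lambda-s}\bigl(1-\hat f_{\sigma_j}(2\Lambda-s)\bigr)\right).$$ The probability that the order is filled before the mid-price moves is the value at $0$ of the inverse (two-sided) Laplace transform of $\hat F$: $$P\bigl(\epsilon_i<\infty,\ \epsilon_i\le\tau\bigr)=\frac1{2\pi \mathrm i}\int_{\gamma-\mathrm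 i\infty}^{\gamma+\mathrm i\infty}\hat F(s)\,ds ,$$ the integral being absolutely convergent, for every $\gamma>0$ such that either $\gamma<2\Lambda$, or $\gamma>2\Lambda$, $\sigma_j<\infty$ almost surely and $E[e^{(\gamma-2\Lambda)\sigma_j}]<\infty$. 4. If $s_0=1$, then $\Lambda=0$ and $\hat F(s)=\frac1s\,\hat g_{\epsilon_i}(s)\,\hat f_{\sigma_j}(-s)$. -/

import Mathlib

open MeasureTheory ProbabilityTheory Filter Topology
open scoped NNReal ENNReal

noncomputable section

/-! ### Birth-death processes -/

/-- The total jump rate in state `k` of the birth-death process on `ℕ` with birth rates `birth` and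
death rates `death`; no death occurs in state `0`. -/
def bdRate (birth death : ℕ → ℝ≥0) (k : ℕ) : ℝ :=
  birth k + if k = 0 then 0 else (death k : ℝ)

/-- The transition probabilities of the jump chain; a state of rate `0` is absorbing. -/
def bdJump (birth death : ℕ → ℝ≥0) (k l : ℕ) : ℝ :=
  if bdRate birth death k = 0 then (if l = k then 1 else 0)
  else if l = k + 1 then birth k / bdRate birth death k
  else if l + 1 = k then death k / bdRate birth death k
  else 0

/-- `X` is, under `P`, a (non-explosive, right-continuous) birth-death process with the given rates,
started in `x₀`: there are a jump chain `Y` and holding times `H` such that `Y` is a Markov chain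
with transition probabilities `bdJump`, given `Y` the holding times are independent and `H k` is
exponential with rate `bdRate (Y k)` (infinite if this rate is `0`), and `X` sits in `Y n` between
the time `H 0 + ⋯ + H (n-1)` of the `n`-th jump and that of the next one. -/
structure IsBirthDeath {Ω : Type*} [MeasurableSpace Ω] (P : Measure Ω) (X : ℝ≥0 → Ω → ℕ)
    (x₀ : ℕ) (birth death : ℕ → ℝ≥0) : Prop where
  measurable : ∀ t, Measurable (X t)
  jumpHold : ∃ (Y : ℕ → Ω → ℕ) (H : ℕ → Ω → ℝ≥0∞),
    (∀ n, Measurable (Y n)) ∧ (∀ n, Measurable (H n)) ∧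
    (∀ (n : ℕ) (y : ℕ → ℕ) (t : ℕ → ℝ≥0),
      P.real {ω | ∀ k ≤ n, Y k ω = y k ∧ (t k : ℝ≥0∞) < H k ω} =
        (if y 0 = x₀ then 1 else 0) *
          (∏ k ∈ Finset.range (n + 1), Real.exp (-(bdRate birth death (y k) * t k))) *
          ∏ k ∈ Finset.range n, bdJump birth death (y k) (y (k + 1))) ∧
    ∀ᵐ ω ∂P, ∀ t : ℝ≥0, ∃ n : ℕ,
      ∑ k ∈ Finset.range n, H k ω ≤ t ∧ (t : ℝ≥0∞) < ∑ k ∈ Finset.range (n + 1), H k ω ∧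
        X t ω = Y n ω

/-- The first-passage time to `0` (infinite if `0` is never reached). -/
def firstPassage {Ω : Type*} (X : ℝ≥0 → Ω → ℕ) (ω : Ω) : ℝ≥0∞ :=
  ⨅ (t : ℝ≥0) (_ : X t ω = 0), (t : ℝ≥0∞)

/-! ### The order book -/

/-- The two sides of the book. -/
inductive Side
  | ask
  | bid

/-- The opposite side. -/
def Side.opp : Side → Side
  | .ask => .bid
  | .bid => .ask

/-- Ask queues are counted positively, bid queues negatively. -/
def Side.sgn : Side → ℤ
  | .ask => 1
  | .bid => -1

/-- Best ask of a book `q` on the price levels `1, …, N`. -/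
def bestAsk (N : ℕ) (q : ℕ → ℤ) : ℕ :=
  sInf ({l | 1 ≤ l ∧ l ≤ N ∧ 0 < q l} ∪ {N + 1})

/-- Best bid of a book `q` on the price levels `1, …, N`. -/
def bestBid (N : ℕ) (q : ℕ → ℤ) : ℕ :=
  sSup ({l | 1 ≤ l ∧ l ≤ N ∧ q l < 0} ∪ {0})

/-- Mid-price. -/
def midPrice (N : ℕ) (q : ℕ → ℤ) : ℝ := ((bestBid N q : ℝ) + bestAsk N q) / 2

/-- Time of the first change of the mid-price (infinite if it never changes). -/
def midMoveTime {Ω : Type*} (N : ℕ) (Q : ℝ≥0 → Ω → ℕ → ℤ) (ω : Ω) : ℝ≥0∞ :=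
  ⨅ (t : ℝ≥0) (_ : midPrice N (Q t ω) ≠ midPrice N (Q 0 ω)), (t : ℝ≥0∞)

/-- The queues that decide about the first mid-price move of a book with best quotes `p`: the sell
queues at the levels in `(p bid, p ask]` and the buy queues at the levels in `[p bid, p ask)`. -/
def activeQueues (p : Side → ℕ) : Set (Side × ℕ) :=
  {x | p .bid ≤ x.2 ∧ x.2 ≤ p .ask ∧ x ≠ (.ask, p .bid) ∧ x ≠ (.bid, p .ask)}

/-- A limit order book `Q` on the levels `1, …, N` (`Q t ω l` is the signed queue at level `l`) into
which a limit order, never cancelled, has been put at time `0` at the best quote of side `i`, as the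
last order of its queue.

`p s` is the initial best quote and `q₀ s` the initial size of the best queue of side `s`. `X l` is
the value at time `0` of the state variables of level `l`; in a queue of size `k` at a level with
state variables `x`, limit orders of side `s` arrive at rate `lam s k x`, market orders at rate
`mu k x`, and cancellations at rate `phi k x`.

The state variables keep their values until the mid-price moves. Accordingly the order flow up to
this time is described by independent processes `Z s l`:
* `Z i (p i)`, the queue position of the order, which is a pure-death process (orders that arrive
  later join the queue behind it);
* `Z i.opp (p i.opp)`, the opposite best queue, which is a birth-death process;
* for `l` inside the spread, `Z s l`, the number of limit orders of side `s` that have been posted at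
  the empty level `l`, which is a Poisson process.
The book follows them up to and including the time of the first move (`follow`); it is not
restricted thereafter, nor at the levels outside the spread, except that it is right-continuous and
never crossed. -/
structure IsTaggedBook {Ω 𝒳 : Type*} [MeasurableSpace Ω] (P : Measure Ω) (X : ℕ → 𝒳)
    (lam : Side → ℕ → 𝒳 → ℝ≥0) (mu phi : ℕ → 𝒳 → ℝ≥0) (N : ℕ) (p q₀ : Side → ℕ) (i : Side)
    (Z : Side → ℕ → ℝ≥0 → Ω → ℕ) (Q : ℝ≥0 → Ω → ℕ → ℤ) : Prop where
  position : IsBirthDeath P (Z i (p i)) (q₀ i) (fun _ => 0)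
    (fun k => mu k (X (p i)) + phi k (X (p i)))
  opposite : IsBirthDeath P (Z i.opp (p i.opp)) (q₀ i.opp) (fun k => lam i.opp k (X (p i.opp)))
    (fun k => mu k (X (p i.opp)) + phi k (X (p i.opp)))
  inside : ∀ s l, p .bid < l → l < p .ask →
    IsBirthDeath P (Z s l) 0 (fun _ => lam s 0 (X l)) (fun _ => 0)
  indep : iIndepFun (fun (x : activeQueues p) (ω : Ω) (t : ℝ≥0) => Z x.1.1 x.1.2 t ω) P
  init : ∀ᵐ ω ∂P, bestAsk N (Q 0 ω) = p .ask ∧ bestBid N (Q 0 ω) = p .bid ∧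
    ∀ s, Q 0 ω (p s) = s.sgn * q₀ s
  rightCont : ∀ᵐ ω ∂P, ∀ l t, ∀ᶠ u in 𝓝[>] t, Q u ω l = Q t ω l
  uncrossed : ∀ᵐ ω ∂P, ∀ t, bestBid N (Q t ω) < bestAsk N (Q t ω)
  follow : ∀ᵐ ω ∂P, ∀ t, (∀ u < t, midPrice N (Q u ω) = midPrice N (Q 0 ω)) →
    (Z i (p i) t ω : ℤ) ≤ i.sgn * Q t ω (p i) ∧
    Q t ω (p i.opp) = i.opp.sgn * Z i.opp (p i.opp) t ω ∧
    ∀ l, p .bid < l → l < p .ask → Q t ω l = (Z .ask l t ω : ℤ) - Z .bid l t ω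

/-- The order is filled, and the mid-price does not move before it is. (If the order is the last one
in its queue when it is filled, then its execution itself moves the mid-price.) -/
def fillEvent {Ω : Type*} (N : ℕ) (p : Side → ℕ) (i : Side) (Z : Side → ℕ → ℝ≥0 → Ω → ℕ)
    (Q : ℝ≥0 → Ω → ℕ → ℤ) : Set Ω :=
  {ω | firstPassage (Z i (p i)) ω ≠ ⊤ ∧ firstPassage (Z i (p i)) ω ≤ midMoveTime N Q ω}

/-! ### Densities, Laplace transforms and continued fractions -/

/-- `f` is the density of the (possibly defective) law on `(0, ∞)` of the random time `T`. -/
structure IsDensity {Ω : Type*} [MeasurableSpace Ω] (P : Measure Ω) (T : Ω → ℝ≥0∞) (f : ℝ → ℝ) :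
    Prop where
  measurable : Measurable f
  nonneg : ∀ x, 0 ≤ f x
  eq : ∀ B : Set ℝ, MeasurableSet B →
    P {ω | T ω ≠ ⊤ ∧ (T ω).toReal ∈ B} = ∫⁻ x in B ∩ Set.Ioi 0, ENNReal.ofReal (f x)

/-- The integral defining the Laplace transform of `f` at `s` converges absolutely. -/
def LaplaceConverges (f : ℝ → ℝ) (s : ℂ) : Prop :=
  IntegrableOn (fun t : ℝ => Complex.exp (-s * t) * f t) (Set.Ioi 0)

/-- Laplace transform. -/
def laplace (f : ℝ → ℝ) (s : ℂ) : ℂ :=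
  ∫ t in Set.Ioi (0 : ℝ), Complex.exp (-s * t) * f t

/-- The inverse (two-sided) Laplace transform of `F` at `t`: the Bromwich integral
`(2πi)⁻¹ ∫ e^{st} F(s) ds` along the line `Re s = γ`, `s = γ + iu`. -/
def inverseLaplace (F : ℂ → ℂ) (γ t : ℝ) : ℂ :=
  (2 * Real.pi * Complex.I)⁻¹ *
    ∫ u : ℝ, Complex.exp ((γ + u * Complex.I) * t) * F (γ + u * Complex.I) * Complex.I

/-- The finite continued fraction `a_k / (b_k + a_{k+1} / (b_{k+1} + ⋯))` with `n` levels. -/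
def contFrac (a b : ℕ → ℂ) : ℕ → ℕ → ℂ
  | 0, _ => 0
  | n + 1, k => a k / (b k + contFrac a b n (k + 1))

/-- The transform `∏_{k=1}^{q} ν_k / (ν_k + s)`. -/
def deathTransform (ν : ℕ → ℝ≥0) (q : ℕ) (s : ℂ) : ℂ :=
  ∏ k ∈ Finset.Icc 1 q, ((ν k : ℝ) : ℂ) / (((ν k : ℝ) : ℂ) + s)

/-- The transform `s⁻¹ ĝ(s) (f̂(2Λ-s) + 2Λ/(2Λ-s) (1 - f̂(2Λ-s)))`. -/
def fillTransform (gHat fHat : ℂ → ℂ) (Λ : ℝ) (s : ℂ) : ℂ :=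
  1 / s * gHat s *
    (fHat (2 * Λ - s) + 2 * Λ / (2 * Λ - s) * (1 - fHat (2 * Λ - s)))

end

/-! Several independent clocks run up to the first mid-price move: the execution of the order, the
depletion of the opposite best queue, and the first arrival on each side at each level inside the
spread. Almost surely no two of the events other than the execution occur at the same finite time,
because of any two of them at least one has an exponential clock (`ae_noTie`). So the first of them
moves the mid-price if it comes before the execution, and before all the clocks nothing moves it.
Hence the fill event says that the execution clock is finite and does not exceed the minimum
`rivalTime` of the others (`BookPath.fill_iff`, `fillEvent_ae_eq`). Call this minimum T, with law ν.
By independence P(T > t) = P(σ > t) exp(-2Λt) (`rivalTime_tail`), and if T is almost surely finite,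
the fill probability is the ν-integral of the distribution function of ε (`fill_probability`).

The distribution function of ε has transform ĝ(s)/s for Re s > 0. The product ĝ decays at least like
1/|s|, so the Bromwich inversion of ĝ(s)/s converges absolutely on every such line. Integrating the
inversion formula against ν and applying Fubini gives the Bromwich integral of ĝ(s)/s · E[exp(sT)]
(`integral_real_Iic_eq`). The last factor follows from two expressions for the transform of the tail
of T: it is (E[exp(sT)] - 1)/s by Fubini, and (1 - f̂(2Λ-s))/(2Λ-s) by the product form of the tail
(`transform_of_tail`). Solving for E[exp(sT)] gives the bracket in F̂.

The laws of ε and σ are split according to the number n of jumps before 0 is reached. The Markov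
property turns the law on n jumps into a recursion of convolutions with exponential densities
(`passageLaw`, `lintegral_passage`); this yields absolute continuity, and a three-term recursion for
the transforms. Without births exactly one n contributes, and the recursion collapses to the product
ĝ (`transform_death`).

With births, killing the process at a level M makes the summed transforms solve a second-order
recursion that vanishes at M, so their successive ratios are finite continued fractions
(`IsPassageBound.tsum_killedTransform`). Letting M tend to infinity gives the product of infinite
fractions. These converge wherever the Laplace integral converges absolutely, also for Re s < 0: the
real transforms at Re s then form a positive supersolution, which bounds the real approximants, and
the increments of the real approximants dominate those of the complex ones
(`IsSupersolution.norm_cladder_sub_le`). -/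

noncomputable section

/-! ### Exponential measures -/

/-- The measure on `(0, ∞)` with density `e^{-r x}`. -/
def expDens (r : ℝ) : Measure ℝ :=
  (volume.restrict (Set.Ioi 0)).withDensity fun x => ENNReal.ofReal (Real.exp (-(r * x)))

instance (r : ℝ) : SFinite (expDens r) := by unfold expDens; infer_instance

lemma lintegral_expDens (r : ℝ) {F : ℝ → ℝ≥0∞} (hF : Measurable F) :
    ∫⁻ x, F x ∂expDens r
      = ∫⁻ x in Set.Ioi 0, ENNReal.ofReal (Real.exp (-(r * x))) * F x := by
  unfold expDens
  rw [lintegral_withDensity_eq_lintegral_mul _ (by fun_prop) hF]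
  rfl

lemma lintegral_exp_Ioi {r : ℝ} (hr : 0 < r) (c : ℝ) :
    ∫⁻ x in Set.Ioi c, ENNReal.ofReal (Real.exp (-(r * x)))
      = ENNReal.ofReal (Real.exp (-(r * c)) / r) := by
  have h1 : -r < 0 := by linarith
  have h := integral_exp_mul_Ioi h1 c
  have hi := integrableOn_exp_mul_Ioi h1 c
  simp only [neg_mul] at h hi
  rw [← ofReal_integral_eq_lintegral_ofReal hi (ae_of_all _ fun x => (Real.exp_pos _).le), h]
  congr 1
  rw [neg_div_neg_eq]

/-- The law on `[0, ∞]` of an exponential variable of rate `r` (infinite if `r = 0`). -/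
def expLaw (r : ℝ) : Measure ℝ≥0∞ :=
  if r = 0 then Measure.dirac ⊤ else ENNReal.ofReal r • (expDens r).map ENNReal.ofReal

lemma expLaw_zero : expLaw 0 = Measure.dirac ⊤ := by simp [expLaw]

lemma expLaw_of_ne {r : ℝ} (hr : r ≠ 0) :
    expLaw r = ENNReal.ofReal r • (expDens r).map ENNReal.ofReal := by simp [expLaw, hr]

lemma expLaw_Ioi {r : ℝ} (hr : 0 ≤ r) (t : ℝ≥0) :
    expLaw r (Set.Ioi (t : ℝ≥0∞)) = ENNReal.ofReal (Real.exp (-(r * t))) := by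
  rcases hr.eq_or_lt with rfl | hr
  · simp [expLaw_zero]
  · have hpre : ENNReal.ofReal ⁻¹' Set.Ioi (t : ℝ≥0∞) = Set.Ioi (t : ℝ) := by
      ext x
      simp only [Set.mem_preimage, Set.mem_Ioi]
      rw [← ENNReal.ofReal_coe_nnreal]
      constructor
      · intro h
        exact (ENNReal.ofReal_lt_ofReal_iff_of_nonneg t.2).1 h
      · intro h
        exact (ENNReal.ofReal_lt_ofReal_iff_of_nonneg t.2).2 h
    rw [expLaw_of_ne hr.ne', Measure.smul_apply,
      Measure.map_apply ENNReal.measurable_ofReal measurableSet_Ioi, hpre, expDens,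
      withDensity_apply _ measurableSet_Ioi, Measure.restrict_restrict measurableSet_Ioi]
    have : Set.Ioi (t : ℝ) ∩ Set.Ioi 0 = Set.Ioi (t : ℝ) := by
      rw [Set.inter_eq_left]; exact Set.Ioi_subset_Ioi t.2
    rw [this, lintegral_exp_Ioi hr, smul_eq_mul, ← ENNReal.ofReal_mul hr.le]
    congr 1
    field_simp

lemma expLaw_compl_Ioi_zero {r : ℝ} (hr : 0 ≤ r) : expLaw r {0} = 0 := by
  rcases hr.eq_or_lt with rfl | hr
  · simp [expLaw_zero]
  · have hpre : ENNReal.ofReal ⁻¹' {0} = Set.Iic (0 : ℝ) := by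
      ext x; simp
    rw [expLaw_of_ne hr.ne', Measure.smul_apply,
      Measure.map_apply ENNReal.measurable_ofReal (measurableSet_singleton _), hpre, expDens,
      withDensity_apply _ measurableSet_Iic, Measure.restrict_restrict measurableSet_Iic,
      Set.Iic_inter_Ioi, Set.Ioc_self]
    simp

lemma isProbabilityMeasure_expLaw {r : ℝ} (hr : 0 ≤ r) : IsProbabilityMeasure (expLaw r) := by
  constructor
  have h := expLaw_Ioi hr 0
  simp only [NNReal.coe_zero, mul_zero, neg_zero, Real.exp_zero, ENNReal.ofReal_one,
    ENNReal.coe_zero] at h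
  have hu : (Set.univ : Set ℝ≥0∞) = {0} ∪ Set.Ioi 0 := by
    ext x; simp
  apply le_antisymm
  · rw [hu]
    refine (measure_union_le _ _).trans ?_
    rw [expLaw_compl_Ioi_zero hr, h, zero_add]
  · rw [← h]; exact measure_mono (Set.subset_univ _)

/-! ### The jump chain and the holding times -/

lemma bdRate_nonneg (birth death : ℕ → ℝ≥0) (k : ℕ) : 0 ≤ bdRate birth death k := by
  unfold bdRate; split_ifs <;> positivity

instance (birth death : ℕ → ℝ≥0) (k : ℕ) :
    IsProbabilityMeasure (expLaw (bdRate birth death k)) :=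
  isProbabilityMeasure_expLaw (bdRate_nonneg birth death k)

lemma bdJump_nonneg (birth death : ℕ → ℝ≥0) (k l : ℕ) : 0 ≤ bdJump birth death k l := by
  have := bdRate_nonneg birth death k
  unfold bdJump
  split_ifs <;> positivity

/-- Averaging over one jump of the chain. -/
lemma tsum_bdJump_mul (birth death : ℕ → ℝ≥0) (k : ℕ) (G : ℕ → ℝ≥0∞) :
    ∑' l, ENNReal.ofReal (bdJump birth death k l) * G l =
      if bdRate birth death k = 0 then G k
      else ENNReal.ofReal (birth k / bdRate birth death k) * G (k + 1) +
        if k = 0 then 0 else ENNReal.ofReal (death k / bdRate birth death k) * G (k - 1) := by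
  by_cases hr : bdRate birth death k = 0
  · rw [tsum_eq_single k]
    · simp [bdJump, hr]
    · intro l hl; simp [bdJump, hr, hl]
  · simp only [hr, if_false]
    rcases k with _ | k
    · rw [tsum_eq_single 1]
      · simp [bdJump, hr]
      · intro l hl; simp [bdJump, hr, hl]
    · rw [tsum_eq_sum (s := {k + 1 + 1, k})]
      · rw [Finset.sum_pair (by omega)]
        simp [bdJump, hr, show k ≠ k + 1 + 1 by omega]
      · intro l hl
        simp only [Finset.mem_insert, Finset.mem_singleton, not_or] at hl
        simp [bdJump, hr, hl.1, hl.2]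

lemma tsum_bdJump (birth death : ℕ → ℝ≥0) (k : ℕ) :
    ∑' l, ENNReal.ofReal (bdJump birth death k l) = 1 := by
  have h := tsum_bdJump_mul birth death k (fun _ => 1)
  simp only [mul_one] at h
  rw [h]
  split_ifs with h1 h2
  · rfl
  · subst h2
    simp only [bdRate, if_true, add_zero] at h1 ⊢
    simp [div_self h1]
  · have := bdRate_nonneg birth death k
    rw [← ENNReal.ofReal_add (by positivity) (by positivity), ← add_div]
    simp only [bdRate, h2, if_false] at h1 ⊢
    simp [div_self h1]

variable {Ω : Type*} [MeasurableSpace Ω] {P : Measure Ω} {Y : ℕ → Ω → ℕ}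
  {H : ℕ → Ω → ℝ≥0∞} {x₀ : ℕ} {birth death : ℕ → ℝ≥0}

/-- `Y` and `H` are the jump chain and the holding times of a birth-death process. -/
structure IsJumpHold (P : Measure Ω) (Y : ℕ → Ω → ℕ) (H : ℕ → Ω → ℝ≥0∞) (x₀ : ℕ)
    (birth death : ℕ → ℝ≥0) : Prop where
  chain : ∀ n, Measurable (Y n)
  hold : ∀ n, Measurable (H n)
  law : ∀ (n : ℕ) (y : ℕ → ℕ) (t : ℕ → ℝ≥0),
      P.real {ω | ∀ k ≤ n, Y k ω = y k ∧ (t k : ℝ≥0∞) < H k ω} =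
        (if y 0 = x₀ then 1 else 0) *
          (∏ k ∈ Finset.range (n + 1), Real.exp (-(bdRate birth death (y k) * t k))) *
          ∏ k ∈ Finset.range n, bdJump birth death (y k) (y (k + 1))

/-- The probability that the first `n` jumps of the chain follow `y`. -/
def pathWeight (birth death : ℕ → ℝ≥0) (x₀ n : ℕ) (y : ℕ → ℕ) : ℝ≥0∞ :=
  (if y 0 = x₀ then 1 else 0) *
    ∏ k ∈ Finset.range n, ENNReal.ofReal (bdJump birth death (y k) (y (k + 1)))

lemma pathWeight_ne_top (n : ℕ) (y : ℕ → ℕ) : pathWeight birth death x₀ n y ≠ ⊤ := by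
  unfold pathWeight
  refine ENNReal.mul_ne_top (by split_ifs <;> simp) ?_
  exact ENNReal.prod_ne_top fun k _ => ENNReal.ofReal_ne_top

lemma pathWeight_succ (n : ℕ) (y : ℕ → ℕ) : pathWeight birth death x₀ (n + 1) y =
    ENNReal.ofReal (bdJump birth death (y n) (y (n + 1))) * pathWeight birth death x₀ n y := by
  unfold pathWeight
  rw [Finset.prod_range_succ]; ring

lemma pathWeight_update (n l : ℕ) (y : ℕ → ℕ) :
    pathWeight birth death x₀ n (Function.update y (n + 1) l)
      = pathWeight birth death x₀ n y := by
  unfold pathWeight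
  congr 1
  refine Finset.prod_congr rfl fun k hk => ?_
  have := Finset.mem_range.1 hk
  rw [Function.update_of_ne (by omega), Function.update_of_ne (by omega)]

namespace IsJumpHold

lemma measure_path [IsFiniteMeasure P] (h : IsJumpHold P Y H x₀ birth death) (n : ℕ) (y : ℕ → ℕ)
    (t : ℕ → ℝ≥0) : P {ω | ∀ k ≤ n, Y k ω = y k ∧ (t k : ℝ≥0∞) < H k ω} =
      pathWeight birth death x₀ n y *
        ∏ k ∈ Finset.range (n + 1), expLaw (bdRate birth death (y k)) (Set.Ioi (t k)) := by
  rw [← ENNReal.ofReal_toReal (measure_ne_top P _), ← Measure.real, h.law n y t]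
  unfold pathWeight
  simp_rw [expLaw_Ioi (bdRate_nonneg birth death _)]
  rw [← ENNReal.ofReal_prod_of_nonneg fun k _ => bdJump_nonneg _ _ _ _,
    ← ENNReal.ofReal_prod_of_nonneg fun k _ => (Real.exp_pos _).le]
  have hp : 0 ≤ ∏ k ∈ Finset.range n, bdJump birth death (y k) (y (k + 1)) :=
    Finset.prod_nonneg fun k _ => bdJump_nonneg _ _ _ _
  split_ifs
  · rw [one_mul, one_mul, mul_comm, ENNReal.ofReal_mul hp]
  · simp

/-- The case of zero thresholds. The prescribed law only controls events of the form `t < H`, so at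
this point a vanishing holding time is not yet excluded. -/
lemma measure_path_pos [IsFiniteMeasure P] (h : IsJumpHold P Y H x₀ birth death) (n : ℕ)
    (y : ℕ → ℕ) :
    P {ω | ∀ k ≤ n, Y k ω = y k ∧ 0 < H k ω} = pathWeight birth death x₀ n y := by
  have := h.measure_path n y (fun _ => 0)
  simp only [ENNReal.coe_zero] at this
  rw [this, Finset.prod_eq_one, mul_one]
  intro k _
  have := expLaw_Ioi (bdRate_nonneg birth death (y k)) 0
  simpa using this

lemma measurableSet_path (h : IsJumpHold P Y H x₀ birth death) (n : ℕ) (y : ℕ → ℕ) :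
    MeasurableSet {ω | ∀ k ≤ n, Y k ω = y k} := by
  have : {ω | ∀ k ≤ n, Y k ω = y k} = ⋂ k, ⋂ (_ : k ≤ n), Y k ⁻¹' {y k} := by ext; simp
  rw [this]
  exact MeasurableSet.iInter fun k => MeasurableSet.iInter fun _ =>
    h.chain k (measurableSet_singleton _)

lemma measurableSet_path_pos (h : IsJumpHold P Y H x₀ birth death) (n : ℕ) (y : ℕ → ℕ) :
    MeasurableSet {ω | ∀ k ≤ n, Y k ω = y k ∧ 0 < H k ω} := by
  have : {ω | ∀ k ≤ n, Y k ω = y k ∧ 0 < H k ω}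
      = ⋂ k, ⋂ (_ : k ≤ n), (Y k ⁻¹' {y k} ∩ H k ⁻¹' Set.Ioi 0) := by ext; simp
  rw [this]
  exact MeasurableSet.iInter fun k => MeasurableSet.iInter fun _ =>
    (h.chain k (measurableSet_singleton _)).inter (h.hold k measurableSet_Ioi)

/-- A finite history, extended by `0`. -/
def extend {m : ℕ} (y : Fin m → ℕ) (k : ℕ) : ℕ := if hk : k < m then y ⟨k, hk⟩ else 0

lemma extend_eq {m : ℕ} (Y : ℕ → ℕ) {k : ℕ} (hk : k < m) :
    extend (fun j : Fin m => Y j) k = Y k := by simp [extend, hk]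

/-- The holding times are almost surely positive. -/
lemma ae_pos [IsProbabilityMeasure P] (h : IsJumpHold P Y H x₀ birth death) :
    ∀ᵐ ω ∂P, ∀ k, 0 < H k ω := by
  have hstep : ∀ n, ∀ᵐ ω ∂P, (∀ k ≤ n, 0 < H k ω) → 0 < H (n + 1) ω := by
    intro n
    have key : ∀ y : ℕ → ℕ, ∀ᵐ ω ∂P,
        (∀ k ≤ n, Y k ω = y k ∧ 0 < H k ω) → 0 < H (n + 1) ω := by
      intro y
      set B := {ω | ∀ k ≤ n, Y k ω = y k ∧ 0 < H k ω}
      set D : ℕ → Set Ω := fun l => {ω | ∀ k ≤ n + 1, Y k ω = Function.update y (n + 1) l k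
        ∧ 0 < H k ω}
      have hDB : ∀ l, D l ⊆ B := by
        intro l ω hω k hk
        have := hω k (by omega)
        rwa [Function.update_of_ne (by omega)] at this
      have hDm : ∀ l, MeasurableSet (D l) := fun l => h.measurableSet_path_pos _ _
      have hdisj : Pairwise (Function.onFun Disjoint D) := by
        intro l l' hll'
        refine Set.disjoint_left.2 fun ω hω hω' => hll' ?_
        have h1 := (hω (n + 1) le_rfl).1
        have h2 := (hω' (n + 1) le_rfl).1
        simp only [Function.update_self] at h1 h2
        exact h1.symm.trans h2
      -- The sets `D l` require a positive holding time at `n + 1` as well. Since the jump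
      -- probabilities out of `y n` sum to 1, they already exhaust the mass of `B`, which leaves no
      -- mass for a zero holding time.
      have hP : P (⋃ l, D l) = P B := by
        rw [measure_iUnion hdisj hDm, h.measure_path_pos n y]
        have : ∀ l, P (D l) = ENNReal.ofReal (bdJump birth death (y n) l)
            * pathWeight birth death x₀ n y := by
          intro l
          rw [h.measure_path_pos, pathWeight_succ, pathWeight_update]
          simp
        simp_rw [this]
        rw [ENNReal.tsum_mul_right, tsum_bdJump, one_mul]
      have hnull : P (B \ ⋃ l, D l) = 0 := by
        rw [measure_sdiff (Set.iUnion_subset hDB) (MeasurableSet.iUnion hDm).nullMeasurableSet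
          (measure_ne_top _ _), hP, tsub_self]
      rw [ae_iff]
      refine measure_mono_null ?_ hnull
      intro ω hω
      simp only [Set.mem_ofPred_eq, Classical.not_imp] at hω
      refine ⟨hω.1, fun hmem => ?_⟩
      obtain ⟨l, hl⟩ := Set.mem_iUnion.1 hmem
      exact hω.2 (hl (n + 1) le_rfl).2
    -- Infinite paths are uncountable; finite histories are countable and suffice, so the
    -- exceptional null sets may be united.
    have hall : ∀ᵐ ω ∂P, ∀ y : Fin (n + 1) → ℕ,
        (∀ k ≤ n, Y k ω = extend y k ∧ 0 < H k ω) → 0 < H (n + 1) ω :=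
      ae_all_iff.2 fun y => key (extend y)
    filter_upwards [hall] with ω hω hpos
    exact hω (fun j => Y j ω) fun k hk =>
      ⟨(extend_eq (fun j => Y j ω) (by omega)).symm, hpos k hk⟩
  have hzero : ∀ᵐ ω ∂P, 0 < H 0 ω := by
    have h0 := h.measure_path_pos 0 (fun _ => x₀)
    have : P {ω | ∀ k ≤ 0, Y k ω = x₀ ∧ 0 < H k ω} = 1 := by
      rw [h0]; simp [pathWeight]
    have h1 := (prob_compl_eq_zero_iff (h.measurableSet_path_pos 0 (fun _ => x₀))).2 this
    rw [ae_iff]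
    refine measure_mono_null ?_ h1
    intro ω hω hmem
    exact hω (hmem 0 le_rfl).2
  filter_upwards [hzero, ae_all_iff.2 hstep] with ω h0 hs
  have : ∀ n, ∀ k ≤ n, 0 < H k ω := by
    intro n
    induction n with
    | zero => intro k hk; rw [Nat.le_zero.1 hk]; exact h0
    | succ n ih =>
      intro k hk
      rcases Nat.le_succ_iff.1 hk with hk | rfl
      · exact ih k hk
      · exact hs n ih
  exact fun k => this k k le_rfl

lemma measure_chain_path [IsProbabilityMeasure P] (h : IsJumpHold P Y H x₀ birth death) (n : ℕ)
    (y : ℕ → ℕ) : P {ω | ∀ k ≤ n, Y k ω = y k} = pathWeight birth death x₀ n y := by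
  rw [← h.measure_path_pos n y]
  refine measure_congr ?_
  filter_upwards [h.ae_pos] with ω hω
  refine propext ⟨fun hk k hkn => ⟨hk k hkn, hω k⟩, fun hk k hkn => (hk k hkn).1⟩

end IsJumpHold

/-- The rays with finite endpoint are the sets whose probabilities the jump-hold law prescribes. The
whole space is adjoined to supply the finite spanning family needed for uniqueness of product
measures. -/
lemma generateFrom_Ioi_coe_union_univ :
    MeasurableSpace.generateFrom
      ((Set.range fun t : ℝ≥0 => Set.Ioi (t : ℝ≥0∞)) ∪ {Set.univ}) = ENNReal.measurableSpace := by
  rw [BorelSpace.measurable_eq (α := ℝ≥0∞)]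
  apply le_antisymm
  · refine MeasurableSpace.generateFrom_le ?_
    rintro s (⟨t, rfl⟩ | rfl)
    · exact isOpen_Ioi.measurableSet
    · exact MeasurableSet.univ
  · rw [borel_eq_generateFrom_Ioi]
    refine MeasurableSpace.generateFrom_le ?_
    rintro s ⟨t, rfl⟩
    rcases eq_or_ne t ⊤ with rfl | ht
    · simp
    · lift t to ℝ≥0 using ht
      exact MeasurableSpace.measurableSet_generateFrom (Or.inl ⟨t, rfl⟩)

lemma isPiSystem_Ioi_coe_union_univ :
    IsPiSystem ((Set.range fun t : ℝ≥0 => Set.Ioi (t : ℝ≥0∞)) ∪ {Set.univ}) := by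
  rintro s (⟨t, rfl⟩ | rfl) u (⟨t', rfl⟩ | rfl) _
  · refine Or.inl ⟨max t t', ?_⟩
    simp [Set.Ioi_inter_Ioi]
  · exact Or.inl ⟨t, by simp⟩
  · exact Or.inl ⟨t', by simp⟩
  · exact Or.inr (by simp)

namespace IsJumpHold

/-- Along a given path of the chain the holding times are independent and exponential. -/
lemma map_hold [IsProbabilityMeasure P] (h : IsJumpHold P Y H x₀ birth death) (n : ℕ)
    (y : ℕ → ℕ) :
    (P.restrict {ω | ∀ k ≤ n, Y k ω = y k}).map (fun ω (k : Fin n) => H k ω) =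
      pathWeight birth death x₀ n y •
        Measure.pi (fun k : Fin n => expLaw (bdRate birth death (y k))) := by
  have hmeas : Measurable (fun ω (k : Fin n) => H k ω) := measurable_pi_iff.2 fun k => h.hold k
  by_cases hc : pathWeight birth death x₀ n y = 0
  · have : P.restrict {ω | ∀ k ≤ n, Y k ω = y k} = 0 := by
      rw [Measure.restrict_eq_zero, h.measure_chain_path, hc]
    rw [this, hc]; simp
  have hct := pathWeight_ne_top (birth := birth) (death := death) (x₀ := x₀) n y
  have key : Measure.pi (fun k : Fin n => expLaw (bdRate birth death (y k))) =
      (pathWeight birth death x₀ n y)⁻¹ •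
        (P.restrict {ω | ∀ k ≤ n, Y k ω = y k}).map (fun ω (k : Fin n) => H k ω) := by
    refine Measure.pi_eq_generateFrom (fun _ => generateFrom_Ioi_coe_union_univ)
      (fun _ => isPiSystem_Ioi_coe_union_univ)
      (fun k => ⟨fun _ => Set.univ, fun _ => Or.inr rfl, fun _ => measure_lt_top _ _,
        Set.iUnion_const _⟩) ?_
    intro s hs
    -- An unconstrained coordinate is encoded by the threshold 0, which costs nothing because
    -- holding times are almost surely positive.
    have hs' : ∀ k : Fin n, ∃ t : ℝ≥0, s k = Set.Ioi (t : ℝ≥0∞) ∨ (s k = Set.univ ∧ t = 0) := by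
      intro k
      rcases hs k with ⟨t, ht⟩ | hk
      · exact ⟨t, Or.inl ht.symm⟩
      · exact ⟨0, Or.inr ⟨hk, rfl⟩⟩
    choose t ht using hs'
    have hsm : ∀ k, MeasurableSet (s k) := by
      intro k
      rcases ht k with hk | hk
      · rw [hk]; exact measurableSet_Ioi
      · rw [hk.1]; exact MeasurableSet.univ
    have hE : ∀ k : Fin n, expLaw (bdRate birth death (y k)) (s k)
        = expLaw (bdRate birth death (y k)) (Set.Ioi (t k)) := by
      intro k
      rcases ht k with hk | hk
      · rw [hk]
      · rw [hk.1, hk.2, expLaw_Ioi (bdRate_nonneg _ _ _)]; simp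
    rw [Measure.smul_apply, Measure.map_apply hmeas (MeasurableSet.univ_pi hsm),
      Measure.restrict_apply (hmeas (MeasurableSet.univ_pi hsm)), smul_eq_mul]
    set t' : ℕ → ℝ≥0 := fun k => if hk : k < n then t ⟨k, hk⟩ else 0
    have hP : P ((fun ω (k : Fin n) => H k ω) ⁻¹' (Set.univ.pi s) ∩ {ω | ∀ k ≤ n, Y k ω = y k})
        = P {ω | ∀ k ≤ n, Y k ω = y k ∧ (t' k : ℝ≥0∞) < H k ω} := by
      refine measure_congr ?_
      filter_upwards [h.ae_pos] with ω hω
      refine propext ⟨?_, ?_⟩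
      · rintro ⟨h1, h2⟩ k hk
        refine ⟨h2 k hk, ?_⟩
        by_cases hkn : k < n
        · have h3 := h1 ⟨k, hkn⟩ trivial
          simp only [t', hkn, dif_pos]
          rcases ht ⟨k, hkn⟩ with h4 | h4
          · rw [h4] at h3; exact h3
          · rw [h4.2]; exact hω k
        · simp only [t', hkn, dif_neg, not_false_iff]; exact hω k
      · intro h1
        refine ⟨fun k _ => ?_, fun k hk => (h1 k hk).1⟩
        have h2 := (h1 k k.2.le).2
        simp only [t', k.2, dif_pos] at h2
        rcases ht k with h4 | h4
        · rw [h4]; exact h2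
        · rw [h4.1]; trivial
    rw [hP, h.measure_path n y t', ← mul_assoc, ENNReal.inv_mul_cancel hc hct, one_mul,
      Finset.prod_range_succ, Finset.prod_range]
    -- The path of length `n` fixes `n + 1` states but only the first `n` holding times are wanted;
    -- the last one gets threshold 0, hence a factor 1.
    have hlast : expLaw (bdRate birth death (y n)) (Set.Ioi (t' n : ℝ≥0∞)) = 1 := by
      rw [expLaw_Ioi (bdRate_nonneg _ _ _)]; simp [t']
    rw [hlast, mul_one]
    refine Finset.prod_congr rfl fun k _ => ?_
    rw [hE k]; simp [t']
  rw [key, smul_smul, ENNReal.mul_inv_cancel hc hct, one_smul]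

lemma lintegral_path [IsProbabilityMeasure P] (h : IsJumpHold P Y H x₀ birth death) (n : ℕ)
    (y : ℕ → ℕ) {F : ℝ≥0∞ → ℝ≥0∞} (hF : Measurable F) :
    ∫⁻ ω in {ω | ∀ k ≤ n, Y k ω = y k}, F (∑ k ∈ Finset.range n, H k ω) ∂P =
      pathWeight birth death x₀ n y *
        ∫⁻ x, F (∑ k, x k) ∂Measure.pi (fun k : Fin n => expLaw (bdRate birth death (y k))) := by
  have hmeas : Measurable (fun ω (k : Fin n) => H k ω) := measurable_pi_iff.2 fun k => h.hold k
  have hsum : Measurable fun x : Fin n → ℝ≥0∞ => F (∑ k, x k) :=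
    hF.comp (Finset.measurable_fun_sum _ fun k _ => measurable_pi_apply k)
  rw [← smul_eq_mul, ← lintegral_smul_measure, ← h.map_hold n y, lintegral_map hsum hmeas]
  simp_rw [Finset.sum_range]

/-- Along a fixed path the holding times are independent, so the last one can be integrated out by
Tonelli, while the weight of the path gains one jump probability. This is the Markov property on a
single path. -/
lemma lintegral_path_succ [IsProbabilityMeasure P] (h : IsJumpHold P Y H x₀ birth death) (n : ℕ)
    (y : ℕ → ℕ) {F : ℝ≥0∞ → ℝ≥0∞} (hF : Measurable F) :
    ∫⁻ ω in {ω | ∀ k ≤ n + 1, Y k ω = y k}, F (∑ k ∈ Finset.range (n + 1), H k ω) ∂P =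
      ENNReal.ofReal (bdJump birth death (y n) (y (n + 1))) *
        ∫⁻ ω in {ω | ∀ k ≤ n, Y k ω = y k},
          (∫⁻ x, F (∑ k ∈ Finset.range n, H k ω + x) ∂expLaw (bdRate birth death (y n))) ∂P := by
  have hG : Measurable fun t : ℝ≥0∞ => ∫⁻ x, F (t + x) ∂expLaw (bdRate birth death (y n)) :=
    Measurable.lintegral_prod_right' (f := fun z : ℝ≥0∞ × ℝ≥0∞ => F (z.1 + z.2)) (by fun_prop)
  rw [h.lintegral_path (n + 1) y hF, h.lintegral_path n y hG, pathWeight_succ, mul_assoc]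
  congr 2
  set μ : Fin (n + 1) → Measure ℝ≥0∞ := fun k => expLaw (bdRate birth death (y k))
  have hmp := measurePreserving_piFinSuccAbove μ (Fin.last n)
  have hF2 : Measurable fun z : ℝ≥0∞ × (Fin n → ℝ≥0∞) => F (∑ k, z.2 k + z.1) := by
    refine hF.comp (Measurable.add ?_ measurable_fst)
    exact Finset.measurable_fun_sum _ fun k _ => (measurable_pi_apply k).comp measurable_snd
  have h1 := hmp.lintegral_comp hF2
  have h2 : ∀ x : Fin (n + 1) → ℝ≥0∞,
      (∑ k, ((MeasurableEquiv.piFinSuccAbove (fun _ => ℝ≥0∞) (Fin.last n)) x).2 k +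
        ((MeasurableEquiv.piFinSuccAbove (fun _ => ℝ≥0∞) (Fin.last n)) x).1) = ∑ k, x k := by
    intro x
    rw [Fin.sum_univ_castSucc]
    simp [MeasurableEquiv.piFinSuccAbove, Fin.insertNthEquiv, Fin.init]
  simp_rw [h2] at h1
  rw [h1, lintegral_prod_symm _ hF2.aemeasurable]
  simp [μ]

end IsJumpHold

end

noncomputable section

/-! ### The law of the first-passage time -/

lemma lintegral_eq_tsum_fiber {Ω α : Type*} [MeasurableSpace Ω] [Countable α] [MeasurableSpace α]
    [MeasurableSingletonClass α] {μ : Measure Ω} {Z : Ω → α} (hZ : Measurable Z) (f : Ω → ℝ≥0∞) :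
    ∫⁻ ω, f ω ∂μ = ∑' a, ∫⁻ ω in Z ⁻¹' {a}, f ω ∂μ := by
  rw [← lintegral_iUnion (fun a => hZ (measurableSet_singleton a))]
  · have : (⋃ a, Z ⁻¹' {a}) = Set.univ := by ext ω; simp
    rw [this, Measure.restrict_univ]
  · intro a b hab
    refine Set.disjoint_left.2 fun ω ha hb => hab ?_
    simp only [Set.mem_preimage, Set.mem_singleton_iff] at ha hb
    exact ha.symm.trans hb

/-- One step of the chain `(jump chain, time)`, killed at `0`, acting on functions. -/
def bdStep (birth death : ℕ → ℝ≥0) (u : ℕ → ℝ≥0∞ → ℝ≥0∞) (k : ℕ) (t : ℝ≥0∞) : ℝ≥0∞ :=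
  if k = 0 then 0 else ∑' l, ENNReal.ofReal (bdJump birth death k l) *
    ∫⁻ x, u l (t + x) ∂expLaw (bdRate birth death k)

variable {Ω : Type*} [MeasurableSpace Ω] {P : Measure Ω} {Y : ℕ → Ω → ℕ}
  {H : ℕ → Ω → ℝ≥0∞} {x₀ : ℕ} {birth death : ℕ → ℝ≥0}

namespace IsJumpHold

/-- The event is split by the value of the next state, and `lintegral_path_succ` is applied to each
prolonged path; `bdStep` is exactly the resulting sum. -/
lemma lintegral_path_bdStep [IsProbabilityMeasure P] (h : IsJumpHold P Y H x₀ birth death) (m : ℕ)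
    (y : ℕ → ℕ) (hy : y m ≠ 0) {u : ℕ → ℝ≥0∞ → ℝ≥0∞} (hu : ∀ k, Measurable (u k)) :
    ∫⁻ ω in {ω | ∀ k ≤ m, Y k ω = y k}, u (Y (m + 1) ω) (∑ k ∈ Finset.range (m + 1), H k ω) ∂P =
      ∫⁻ ω in {ω | ∀ k ≤ m, Y k ω = y k},
        bdStep birth death u (Y m ω) (∑ k ∈ Finset.range m, H k ω) ∂P := by
  have hSm : Measurable fun ω => ∑ k ∈ Finset.range m, H k ω :=
    Finset.measurable_fun_sum _ fun k _ => h.hold k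
  have hGm : ∀ l, Measurable fun t : ℝ≥0∞ =>
      ∫⁻ x, u l (t + x) ∂expLaw (bdRate birth death (y m)) := fun l =>
    Measurable.lintegral_prod_right' (f := fun z : ℝ≥0∞ × ℝ≥0∞ => u l (z.1 + z.2))
      ((hu l).comp (measurable_fst.add measurable_snd))
  have hR : ∫⁻ ω in {ω | ∀ k ≤ m, Y k ω = y k},
        bdStep birth death u (Y m ω) (∑ k ∈ Finset.range m, H k ω) ∂P =
      ∫⁻ ω in {ω | ∀ k ≤ m, Y k ω = y k}, ∑' l, ENNReal.ofReal (bdJump birth death (y m) l) *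
        ∫⁻ x, u l (∑ k ∈ Finset.range m, H k ω + x) ∂expLaw (bdRate birth death (y m)) ∂P := by
    refine setLIntegral_congr_fun (h.measurableSet_path m y) fun ω hω => ?_
    have : Y m ω = y m := hω m le_rfl
    simp [bdStep, this, hy]
  have hGS : ∀ l, Measurable fun ω =>
      ∫⁻ x, u l (∑ k ∈ Finset.range m, H k ω + x) ∂expLaw (bdRate birth death (y m)) :=
    fun l => (hGm l).comp hSm
  rw [hR, lintegral_tsum fun l => ((hGS l).const_mul _).aemeasurable,
    lintegral_eq_tsum_fiber (h.chain (m + 1))]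
  refine tsum_congr fun l => ?_
  rw [lintegral_const_mul _ (hGS l), Measure.restrict_restrict
    (h.chain (m + 1) (measurableSet_singleton l))]
  have hset : Y (m + 1) ⁻¹' {l} ∩ {ω | ∀ k ≤ m, Y k ω = y k} =
      {ω | ∀ k ≤ m + 1, Y k ω = Function.update y (m + 1) l k} := by
    ext ω
    constructor
    · rintro ⟨h1, h2⟩ k hk
      rcases Nat.le_succ_iff.1 hk with hk | rfl
      · rw [Function.update_of_ne (by omega)]; exact h2 k hk
      · rw [Function.update_self]; exact h1
    · intro h1
      refine ⟨?_, fun k hk => ?_⟩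
      · have := h1 (m + 1) le_rfl
        rwa [Function.update_self] at this
      · have := h1 k (by omega)
        rwa [Function.update_of_ne (by omega)] at this
  have h2 := h.lintegral_path_succ m (Function.update y (m + 1) l) (hu l)
  have hset' : {ω | ∀ k ≤ m, Y k ω = Function.update y (m + 1) l k} =
      {ω | ∀ k ≤ m, Y k ω = y k} := by
    ext ω
    refine forall_congr' fun k => forall_congr' fun hk => ?_
    rw [Function.update_of_ne (by omega)]
  rw [hset', Function.update_self, Function.update_of_ne (by omega)] at h2
  rw [← h2, hset]
  refine setLIntegral_congr_fun (h.measurableSet_path _ _) fun ω hω => ?_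
  have := hω (m + 1) le_rfl
  rw [Function.update_self] at this
  simp only [this]

lemma lintegral_survive_succ [IsProbabilityMeasure P] (h : IsJumpHold P Y H x₀ birth death)
    (m : ℕ) {u : ℕ → ℝ≥0∞ → ℝ≥0∞} (hu : ∀ k, Measurable (u k)) :
    ∫⁻ ω in {ω | ∀ j < m + 1, Y j ω ≠ 0},
        u (Y (m + 1) ω) (∑ k ∈ Finset.range (m + 1), H k ω) ∂P =
      ∫⁻ ω in {ω | ∀ j < m, Y j ω ≠ 0},
        bdStep birth death u (Y m ω) (∑ k ∈ Finset.range m, H k ω) ∂P := by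
  have hZ : Measurable fun ω (k : Fin (m + 1)) => Y k ω := measurable_pi_iff.2 fun k => h.chain k
  rw [lintegral_eq_tsum_fiber hZ, lintegral_eq_tsum_fiber hZ]
  refine tsum_congr fun y => ?_
  rw [Measure.restrict_restrict (hZ (measurableSet_singleton y)),
    Measure.restrict_restrict (hZ (measurableSet_singleton y))]
  have hA : (fun ω (k : Fin (m + 1)) => Y k ω) ⁻¹' {y} = {ω | ∀ k ≤ m, Y k ω = extend y k} := by
    ext ω
    simp only [Set.mem_preimage, Set.mem_singleton_iff, Set.mem_ofPred_eq]
    constructor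
    · rintro rfl k hk
      rw [extend_eq (fun j => Y j ω) (by omega)]
    · intro h1
      ext k
      rw [h1 k (by omega)]
      simp only [extend, k.2, dif_pos]
  rw [hA]
  by_cases hy : ∀ j < m + 1, extend y j ≠ 0
  · have e1 : {ω | ∀ k ≤ m, Y k ω = extend y k} ∩ {ω | ∀ j < m + 1, Y j ω ≠ 0} =
        {ω | ∀ k ≤ m, Y k ω = extend y k} := by
      refine Set.inter_eq_left.2 fun ω hω j hj => ?_
      rw [hω j (by omega)]; exact hy j hj
    have e2 : {ω | ∀ k ≤ m, Y k ω = extend y k} ∩ {ω | ∀ j < m, Y j ω ≠ 0} =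
        {ω | ∀ k ≤ m, Y k ω = extend y k} := by
      refine Set.inter_eq_left.2 fun ω hω j hj => ?_
      rw [hω j (by omega)]; exact hy j (by omega)
    rw [e1, e2]
    exact h.lintegral_path_bdStep m (extend y) (hy m (by omega)) hu
  -- A history through 0 contributes nothing on either side: on the left it is excluded, and on the
  -- right either it is excluded or its last state is 0, where `bdStep` vanishes.
  · push Not at hy
    obtain ⟨j, hj, hy⟩ := hy
    have e1 : {ω | ∀ k ≤ m, Y k ω = extend y k} ∩ {ω | ∀ j < m + 1, Y j ω ≠ 0} = ∅ := by
      refine Set.eq_empty_of_forall_notMem fun ω hω => ?_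
      exact hω.2 j hj ((hω.1 j (by omega)).trans hy)
    rw [e1, Measure.restrict_empty, lintegral_zero_measure]
    symm
    rw [lintegral_eq_zero_of_ae_eq_zero]
    rw [Filter.EventuallyEq]
    have hms : MeasurableSet ({ω | ∀ k ≤ m, Y k ω = extend y k} ∩ {ω | ∀ j < m, Y j ω ≠ 0}) := by
      refine (h.measurableSet_path m _).inter ?_
      have : {ω | ∀ j < m, Y j ω ≠ 0} = ⋂ j, ⋂ (_ : j < m), Y j ⁻¹' {0}ᶜ := by ext; simp
      rw [this]
      exact MeasurableSet.iInter fun k => MeasurableSet.iInter fun _ =>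
        h.chain k (measurableSet_singleton _).compl
    rw [ae_restrict_iff' hms]
    refine ae_of_all _ fun ω hω => ?_
    rcases Nat.lt_succ_iff_lt_or_eq.1 hj with hj' | rfl
    · exact absurd ((hω.1 j (by omega)).trans hy) (hω.2 j hj')
    · have : Y j ω = 0 := (hω.1 j le_rfl).trans hy
      simp [bdStep, this]

end IsJumpHold

/-- The law of the first-passage time to `0` of the birth-death process started in `k`, on the event
that the passage takes `n` jumps. -/
def passageLaw (birth death : ℕ → ℝ≥0) : ℕ → ℕ → Measure ℝ
  | 0, k => if k = 0 then Measure.dirac 0 else 0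
  | n + 1, k => if k = 0 then 0 else
      (birth k : ℝ≥0∞) • (passageLaw birth death n (k + 1)).conv (expDens (bdRate birth death k)) +
      (death k : ℝ≥0∞) • (passageLaw birth death n (k - 1)).conv (expDens (bdRate birth death k))

instance sFinite_passageLaw (birth death : ℕ → ℝ≥0) (n k : ℕ) :
    SFinite (passageLaw birth death n k) := by
  induction n generalizing k with
  | zero => simp only [passageLaw]; split_ifs <;> infer_instance
  | succ n ih =>
    simp only [passageLaw]
    split_ifs
    · infer_instance
    · have := ih (k + 1)
      have := ih (k - 1)
      infer_instance

lemma lintegral_passageLaw_succ (birth death : ℕ → ℝ≥0) (n : ℕ) {k : ℕ} (hk : k ≠ 0)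
    {F : ℝ → ℝ≥0∞} (hF : Measurable F) :
    ∫⁻ x, F x ∂passageLaw birth death (n + 1) k =
      birth k * ∫⁻ x, ∫⁻ y, F (x + y) ∂expDens (bdRate birth death k)
        ∂passageLaw birth death n (k + 1) +
      death k * ∫⁻ x, ∫⁻ y, F (x + y) ∂expDens (bdRate birth death k)
        ∂passageLaw birth death n (k - 1) := by
  rw [passageLaw, if_neg hk, lintegral_add_measure, lintegral_smul_measure, lintegral_smul_measure,
    Measure.lintegral_conv hF, Measure.lintegral_conv hF, smul_eq_mul, smul_eq_mul]

/-- The expectation of `F` of the first-passage time, started in `k` at time `t`. -/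
def passageFun (birth death : ℕ → ℝ≥0) (F : ℝ → ℝ≥0∞) (n k : ℕ) (t : ℝ≥0∞) : ℝ≥0∞ :=
  if t = ⊤ then 0 else ∫⁻ x, F (t.toReal + x) ∂passageLaw birth death n k

lemma measurable_passageFun (birth death : ℕ → ℝ≥0) {F : ℝ → ℝ≥0∞} (hF : Measurable F) (n k : ℕ) :
    Measurable (passageFun birth death F n k) := by
  refine Measurable.ite (measurableSet_singleton _) measurable_const ?_
  exact Measurable.lintegral_prod_right' (f := fun z : ℝ≥0∞ × ℝ => F (z.1.toReal + z.2))
    (by fun_prop)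

lemma lintegral_expLaw {r : ℝ} (hr : r ≠ 0) {F : ℝ≥0∞ → ℝ≥0∞} (hF : Measurable F) :
    ∫⁻ x, F x ∂expLaw r = ENNReal.ofReal r * ∫⁻ x, F (ENNReal.ofReal x) ∂expDens r := by
  rw [expLaw_of_ne hr, lintegral_smul_measure, lintegral_map hF ENNReal.measurable_ofReal,
    smul_eq_mul]

lemma ae_expDens_pos (r : ℝ) : ∀ᵐ x ∂expDens r, 0 < x :=
  (withDensity_absolutelyContinuous _ _).ae_le (ae_restrict_mem measurableSet_Ioi)

lemma lintegral_passageFun_add (birth death : ℕ → ℝ≥0) {F : ℝ → ℝ≥0∞} (hF : Measurable F)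
    (n l : ℕ) (r : ℝ) {t : ℝ≥0∞} (ht : t ≠ ⊤) :
    ∫⁻ x, passageFun birth death F n l (t + ENNReal.ofReal x) ∂expDens r =
      ∫⁻ x, ∫⁻ y, F (t.toReal + (x + y)) ∂expDens r ∂passageLaw birth death n l := by
  have hm : Measurable (Function.uncurry fun y x : ℝ => F (t.toReal + (x + y))) := by
    have : (Function.uncurry fun y x : ℝ => F (t.toReal + (x + y)))
      = fun z : ℝ × ℝ => F (t.toReal + (z.2 + z.1)) := rfl
    rw [this]; fun_prop
  rw [← lintegral_lintegral_swap hm.aemeasurable]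
  refine lintegral_congr_ae ?_
  filter_upwards [ae_expDens_pos r] with x hx
  rw [passageFun, if_neg (by simp [ht]), ENNReal.toReal_add ht ENNReal.ofReal_ne_top,
    ENNReal.toReal_ofReal hx.le]
  refine lintegral_congr fun y => ?_
  congr 1; ring

/-- The jump probability `birth k / r` times the exponential density `r * exp (-r x)` is `birth k *
exp (-r x)`, and likewise for deaths: the total rate `r` cancels, which is why `expDens` is left
unnormalised. If the rate is 0, the holding time is infinite and both sides vanish, by the
convention that `passageFun` is 0 at time `⊤`. -/
lemma bdStep_passageFun (birth death : ℕ → ℝ≥0) {F : ℝ → ℝ≥0∞} (hF : Measurable F) (n : ℕ) :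
    bdStep birth death (passageFun birth death F n) = passageFun birth death F (n + 1) := by
  ext k t
  unfold bdStep
  split_ifs with hk
  · subst hk
    simp [passageFun, passageLaw]
  by_cases ht : t = ⊤
  · subst ht
    simp [passageFun]
  rw [tsum_bdJump_mul]
  split_ifs with hr
  · have hG : Measurable fun x => passageFun birth death F n k (t + x) :=
      (measurable_passageFun birth death hF n k).comp (measurable_const.add measurable_id)
    rw [hr, expLaw_zero, lintegral_dirac' _ hG]
    have h0 : (birth k : ℝ) = 0 ∧ (death k : ℝ) = 0 := by
      simp only [bdRate, hk, if_false] at hr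
      have := (birth k).2
      have := (death k).2
      constructor <;> linarith
    have h1 : birth k = 0 := by exact_mod_cast h0.1
    have h2 : death k = 0 := by exact_mod_cast h0.2
    rw [passageFun, passageFun, if_neg ht, lintegral_passageLaw_succ _ _ _ hk (by fun_prop)]
    simp [h1, h2]
  · have hr0 := bdRate_nonneg birth death k
    have hrpos : 0 < bdRate birth death k := lt_of_le_of_ne hr0 (Ne.symm hr)
    have hG : ∀ l, Measurable fun x => passageFun birth death F n l (t + x) := fun l =>
      (measurable_passageFun birth death hF n l).comp (measurable_const.add measurable_id)
    rw [lintegral_expLaw hr (hG _), lintegral_expLaw hr (hG _),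
      lintegral_passageFun_add _ _ hF _ _ _ ht, lintegral_passageFun_add _ _ hF _ _ _ ht,
      ← mul_assoc, ← mul_assoc, ← ENNReal.ofReal_mul (by positivity),
      ← ENNReal.ofReal_mul (by positivity), div_mul_cancel₀ _ hr, div_mul_cancel₀ _ hr,
      ENNReal.ofReal_coe_nnreal, ENNReal.ofReal_coe_nnreal, passageFun, if_neg ht,
      lintegral_passageLaw_succ _ _ _ hk (by fun_prop)]

namespace IsJumpHold

lemma ae_start [IsProbabilityMeasure P] (h : IsJumpHold P Y H x₀ birth death) :
    ∀ᵐ ω ∂P, Y 0 ω = x₀ := by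
  have h0 := h.measure_chain_path 0 (fun _ => x₀)
  have h1 : P {ω | ∀ k ≤ 0, Y k ω = x₀} = 1 := by rw [h0]; simp [pathWeight]
  have h2 := (prob_compl_eq_zero_iff (h.measurableSet_path 0 (fun _ => x₀))).2 h1
  rw [ae_iff]
  refine measure_mono_null ?_ h2
  intro ω hω hmem
  exact hω (hmem 0 le_rfl)

lemma lintegral_passage [IsProbabilityMeasure P] (h : IsJumpHold P Y H x₀ birth death)
    {F : ℝ → ℝ≥0∞} (hF : Measurable F) (n : ℕ) :
    ∫⁻ ω in {ω | ∀ j < n, Y j ω ≠ 0},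
        passageFun birth death F 0 (Y n ω) (∑ k ∈ Finset.range n, H k ω) ∂P =
      ∫⁻ x, F x ∂passageLaw birth death n x₀ := by
  -- The induction trades one step of the chain for one more jump inside `passageFun`, keeping `n +
  -- m` fixed; at `m = 0` only the starting state is left.
  have key : ∀ m n, ∫⁻ ω in {ω | ∀ j < m, Y j ω ≠ 0},
        passageFun birth death F n (Y m ω) (∑ k ∈ Finset.range m, H k ω) ∂P =
      ∫⁻ x, F x ∂passageLaw birth death (n + m) x₀ := by
    intro m
    induction m with
    | zero =>
      intro n
      have : {ω | ∀ j < 0, Y j ω ≠ 0} = Set.univ := by ext; simp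
      rw [this, Measure.restrict_univ]
      have : ∀ᵐ ω ∂P, passageFun birth death F n (Y 0 ω) (∑ k ∈ Finset.range 0, H k ω) =
          ∫⁻ x, F x ∂passageLaw birth death n x₀ := by
        filter_upwards [h.ae_start] with ω hω
        simp [hω, passageFun]
      rw [lintegral_congr_ae this]
      simp
    | succ m ih =>
      intro n
      rw [h.lintegral_survive_succ m (measurable_passageFun birth death hF n),
        bdStep_passageFun _ _ hF, ih (n + 1)]
      congr 2
      omega
  simpa using key n 0

end IsJumpHold

lemma passageLaw_Iio (birth death : ℕ → ℝ≥0) (n k : ℕ) :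
    passageLaw birth death n k (Set.Iio 0) = 0 := by
  induction n generalizing k with
  | zero => simp only [passageLaw]; split_ifs <;> simp
  | succ n ih =>
    by_cases hk : k = 0
    · simp [passageLaw, hk]
    have key : ∀ l, ∫⁻ x, ∫⁻ y, (Set.Iio (0 : ℝ)).indicator (fun _ => (1 : ℝ≥0∞)) (x + y)
        ∂expDens (bdRate birth death k) ∂passageLaw birth death n l = 0 := by
      intro l
      rw [lintegral_eq_zero_of_ae_eq_zero]
      have : ∀ᵐ x ∂passageLaw birth death n l, x ∉ Set.Iio 0 :=
        measure_eq_zero_iff_ae_notMem.1 (ih l)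
      filter_upwards [this] with x hx
      refine lintegral_eq_zero_of_ae_eq_zero ?_
      filter_upwards [ae_expDens_pos (bdRate birth death k)] with y hy
      simp only [Set.mem_Iio, not_lt] at hx
      simp only [Pi.zero_apply, Set.indicator_apply_eq_zero, Set.mem_Iio]
      intro h; linarith
    have := lintegral_passageLaw_succ birth death n hk
      (F := (Set.Iio (0 : ℝ)).indicator (fun _ => (1 : ℝ≥0∞)))
      (measurable_const.indicator measurableSet_Iio)
    rw [key, key, lintegral_indicator_const measurableSet_Iio] at this
    simpa using this

/-- Every passage with at least one jump contains an exponential holding time, and convolution with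
an absolutely continuous measure is absolutely continuous. -/
lemma passageLaw_succ_absolutelyContinuous (birth death : ℕ → ℝ≥0) (n k : ℕ) :
    passageLaw birth death (n + 1) k ≪ volume := by
  rw [passageLaw]
  split_ifs
  · exact Measure.AbsolutelyContinuous.zero _
  · have : expDens (bdRate birth death k) ≪ volume :=
      (withDensity_absolutelyContinuous _ _).trans Measure.restrict_le_self.absolutelyContinuous
    refine Measure.AbsolutelyContinuous.add_left ?_ ?_
    · exact Measure.AbsolutelyContinuous.smul_left (Measure.conv_absolutelyContinuous this) _
    · exact Measure.AbsolutelyContinuous.smul_left (Measure.conv_absolutelyContinuous this) _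

/-- The (possibly defective) law of the first-passage time to `0` from `k`. -/
def firstPassageLaw (birth death : ℕ → ℝ≥0) (k : ℕ) : Measure ℝ :=
  Measure.sum fun n => passageLaw birth death n k

lemma firstPassageLaw_absolutelyContinuous (birth death : ℕ → ℝ≥0) {k : ℕ} (hk : k ≠ 0) :
    firstPassageLaw birth death k ≪ volume.restrict (Set.Ioi 0) := by
  refine Measure.absolutelyContinuous_sum_left fun n => ?_
  rcases n with _ | n
  · simp [passageLaw, hk, Measure.AbsolutelyContinuous.zero]
  · refine Measure.AbsolutelyContinuous.mk fun s hs h0 => ?_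
    rw [Measure.restrict_apply hs] at h0
    have h1 := passageLaw_succ_absolutelyContinuous birth death n k
    have hsub : s ⊆ (s ∩ Set.Ioi 0) ∪ (Set.Iio 0 ∪ {0}) := by
      intro x hx
      rcases lt_trichotomy x 0 with h | h | h
      · exact Or.inr (Or.inl h)
      · exact Or.inr (Or.inr h)
      · exact Or.inl ⟨hx, h⟩
    refine measure_mono_null hsub ?_
    rw [measure_union_null_iff, measure_union_null_iff]
    exact ⟨h1 h0, passageLaw_Iio _ _ _ _, h1 (by simp)⟩

end

noncomputable section

/-! ### Hitting times of right-continuous paths -/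

/-- The hitting time of `A` by the path `x`. -/
def hitTime (A : Set ℕ) (x : ℝ≥0 → ℕ) : ℝ≥0∞ := ⨅ (t : ℝ≥0) (_ : x t ∈ A), (t : ℝ≥0∞)

/-- The hitting time of `A` along rational times. -/
def hitTimeRat (A : Set ℕ) (x : ℝ≥0 → ℕ) : ℝ≥0∞ :=
  ⨅ (t : ℚ≥0) (_ : x (t : ℝ≥0) ∈ A), ((t : ℝ≥0) : ℝ≥0∞)

/-- The path `x` is constant immediately to the right of every time. -/
def RightConst (x : ℝ≥0 → ℕ) : Prop := ∀ t, ∃ δ > t, ∀ u, t ≤ u → u < δ → x u = x t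

lemma firstPassage_eq_hitTime {Ω : Type*} (X : ℝ≥0 → Ω → ℕ) (ω : Ω) :
    firstPassage X ω = hitTime {0} (fun t => X t ω) := rfl

lemma hitTime_le {A : Set ℕ} {x : ℝ≥0 → ℕ} {t : ℝ≥0} (h : x t ∈ A) : hitTime A x ≤ t :=
  iInf₂_le t h

lemma notMem_of_lt_hitTime {A : Set ℕ} {x : ℝ≥0 → ℕ} {t : ℝ≥0} (h : (t : ℝ≥0∞) < hitTime A x) :
    x t ∉ A := fun hA => absurd (hitTime_le hA) (not_le.2 h)

/-- The infimum is attained: if the path were outside `A` at time `t`, it would stay outside for a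
while after `t`, and the hitting time would be larger. -/
lemma RightConst.hitTime_mem {A : Set ℕ} {x : ℝ≥0 → ℕ} (hx : RightConst x) {t : ℝ≥0}
    (ht : hitTime A x = t) : x t ∈ A := by
  by_contra hA
  obtain ⟨δ, hδ, hc⟩ := hx t
  have : (δ : ℝ≥0∞) ≤ hitTime A x := by
    refine le_iInf₂ fun u hu => ?_
    rw [ENNReal.coe_le_coe]
    by_contra hlt
    push Not at hlt
    have htu : t ≤ u := by
      have := hitTime_le hu
      rw [ht] at this
      exact_mod_cast this
    exact hA (hc u htu hlt ▸ hu)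
  rw [ht, ENNReal.coe_le_coe] at this
  exact absurd hδ (not_lt.2 this)

/-- A value taken at `t` persists up to nearby later rationals. The rational version depends on
countably many coordinates, hence is a measurable function of the path for the product σ-algebra;
this lets independence of the processes pass to their hitting times. -/
lemma RightConst.hitTimeRat_eq {x : ℝ≥0 → ℕ} (hx : RightConst x) (A : Set ℕ) :
    hitTimeRat A x = hitTime A x := by
  refine le_antisymm (le_iInf₂ fun t ht => ?_) (le_iInf₂ fun q hq => hitTime_le hq)
  obtain ⟨δ, hδ, hc⟩ := hx t
  refine le_of_forall_gt_imp_ge_of_dense fun c hc' => ?_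
  obtain ⟨d, hd1, hd2⟩ := ENNReal.lt_iff_exists_nnreal_btwn.1 hc'
  rw [ENNReal.coe_lt_coe] at hd1
  obtain ⟨q, hq1, hq2⟩ := exists_rat_btwn (show (t : ℝ) < min d δ from by
    exact_mod_cast lt_min hd1 hδ)
  have hq0 : 0 ≤ q := by
    have : (0 : ℝ) ≤ q := t.2.trans hq1.le
    exact_mod_cast this
  lift q to ℚ≥0 using hq0
  have h1 : t < (q : ℝ≥0) := by
    rw [← NNReal.coe_lt_coe]; exact_mod_cast hq1
  have h2 : (q : ℝ≥0) < min d δ := by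
    rw [← NNReal.coe_lt_coe]; exact_mod_cast hq2
  refine (iInf₂_le q ?_).trans ?_
  · rw [hc _ h1.le (h2.trans_le (min_le_right _ _))]; exact ht
  · exact le_trans (by exact_mod_cast (h2.trans_le (min_le_left _ _)).le) hd2.le

lemma measurable_hitTimeRat (A : Set ℕ) : Measurable (hitTimeRat A) := by
  refine Measurable.iInf fun q => ?_
  have : (fun x : ℝ≥0 → ℕ => ⨅ (_ : x (q : ℝ≥0) ∈ A), ((q : ℝ≥0) : ℝ≥0∞)) =
      fun x => (fun n : ℕ => ⨅ (_ : n ∈ A), ((q : ℝ≥0) : ℝ≥0∞)) (x q) := rfl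
  rw [this]
  exact (measurable_of_countable fun n : ℕ => ⨅ (_ : n ∈ A), ((q : ℝ≥0) : ℝ≥0∞)).comp
    (measurable_pi_apply _)

/-- The path `x` sits in `y n` during the `n`-th of the holding times `h`. -/
structure FollowsJumps (x : ℝ≥0 → ℕ) (y : ℕ → ℕ) (h : ℕ → ℝ≥0∞) : Prop where
  pos : ∀ k, 0 < h k
  eq : ∀ t : ℝ≥0, ∃ n : ℕ, ∑ k ∈ Finset.range n, h k ≤ t ∧
    (t : ℝ≥0∞) < ∑ k ∈ Finset.range (n + 1), h k ∧ x t = y n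

namespace FollowsJumps

variable {x : ℝ≥0 → ℕ} {y : ℕ → ℕ} {h : ℕ → ℝ≥0∞}

lemma monotone_jumpTime (h : ℕ → ℝ≥0∞) : Monotone fun n => ∑ k ∈ Finset.range n, h k :=
  fun _ _ hmn => Finset.sum_le_sum_of_subset (Finset.range_mono hmn)

lemma eq_of_mem (hx : FollowsJumps x y h) {t : ℝ≥0} {n : ℕ}
    (h1 : ∑ k ∈ Finset.range n, h k ≤ t) (h2 : (t : ℝ≥0∞) < ∑ k ∈ Finset.range (n + 1), h k) :
    x t = y n := by
  obtain ⟨m, hm1, hm2, hm⟩ := hx.eq t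
  have a : n < m + 1 := (monotone_jumpTime h).reflect_lt (h1.trans_lt hm2)
  have b : m < n + 1 := (monotone_jumpTime h).reflect_lt (hm1.trans_lt h2)
  rw [hm, show m = n by omega]

lemma rightConst (hx : FollowsJumps x y h) : RightConst x := by
  intro t
  obtain ⟨n, h1, h2, h3⟩ := hx.eq t
  obtain ⟨δ, hδ1, hδ2⟩ := ENNReal.lt_iff_exists_nnreal_btwn.1 h2
  refine ⟨δ, by exact_mod_cast hδ1, fun u hu hu' => ?_⟩
  rw [h3, hx.eq_of_mem (h1.trans (by exact_mod_cast hu))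
    (lt_trans (by exact_mod_cast hu') hδ2)]

lemma hitTime_eq (hx : FollowsJumps x y h) (A : Set ℕ) :
    hitTime A x = ⨅ (n : ℕ) (_ : y n ∈ A), ∑ k ∈ Finset.range n, h k := by
  refine le_antisymm (le_iInf₂ fun n hn => ?_) (le_iInf₂ fun t ht => ?_)
  · by_cases htop : ∑ k ∈ Finset.range n, h k = ⊤
    · rw [htop]; exact le_top
    · lift ∑ k ∈ Finset.range n, h k to ℝ≥0 using htop with t ht
      refine hitTime_le ?_
      rw [hx.eq_of_mem (n := n) ht.symm.le]
      · exact hn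
      · rw [Finset.sum_range_succ, ← ht]
        exact ENNReal.lt_add_right ENNReal.coe_ne_top (hx.pos n).ne'
  · obtain ⟨n, h1, h2, h3⟩ := hx.eq t
    exact (iInf₂_le n (h3 ▸ ht)).trans h1

lemma hitTime_eq_jumpTime (hx : FollowsJumps x y h) {A : Set ℕ} {n : ℕ} (hn : y n ∈ A)
    (hlt : ∀ j < n, y j ∉ A) : hitTime A x = ∑ k ∈ Finset.range n, h k := by
  rw [hx.hitTime_eq]
  refine le_antisymm (iInf₂_le n hn) (le_iInf₂ fun m hm => monotone_jumpTime h ?_)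
  by_contra hmn
  exact hlt m (not_le.1 hmn) hm

end FollowsJumps

/-! ### First-passage times of birth-death processes -/

variable {Ω : Type*} [MeasurableSpace Ω] {P : Measure Ω} {X : ℝ≥0 → Ω → ℕ}
  {x₀ : ℕ} {birth death : ℕ → ℝ≥0}

namespace IsBirthDeath

lemma exists_jumpHold [IsProbabilityMeasure P] (h : IsBirthDeath P X x₀ birth death) :
    ∃ (Y : ℕ → Ω → ℕ) (H : ℕ → Ω → ℝ≥0∞), IsJumpHold P Y H x₀ birth death ∧
      ∀ᵐ ω ∂P, FollowsJumps (fun t => X t ω) (fun n => Y n ω) (fun n => H n ω) := by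
  obtain ⟨Y, H, hY, hH, hlaw, hX⟩ := h.jumpHold
  have hJ : IsJumpHold P Y H x₀ birth death := ⟨hY, hH, hlaw⟩
  refine ⟨Y, H, hJ, ?_⟩
  filter_upwards [hJ.ae_pos, hX] with ω h1 h2
  exact ⟨h1, h2⟩

lemma ae_rightConst [IsProbabilityMeasure P] (h : IsBirthDeath P X x₀ birth death) :
    ∀ᵐ ω ∂P, RightConst (fun t => X t ω) := by
  obtain ⟨Y, H, -, hX⟩ := h.exists_jumpHold
  filter_upwards [hX] with ω hω using hω.rightConst

/-- The event is split by the index of the first zero of the jump chain. On each piece the passage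
time is a partial sum of holding times, whose law is `passageLaw`. -/
lemma measure_firstPassage [IsProbabilityMeasure P] (h : IsBirthDeath P X x₀ birth death)
    {B : Set ℝ} (hB : MeasurableSet B) :
    P {ω | firstPassage X ω ≠ ⊤ ∧ (firstPassage X ω).toReal ∈ B} =
      firstPassageLaw birth death x₀ B := by
  obtain ⟨Y, H, hJ, hX⟩ := h.exists_jumpHold
  set S : ℕ → Ω → ℝ≥0∞ := fun n ω => ∑ k ∈ Finset.range n, H k ω
  have hS : ∀ n, Measurable (S n) := fun n => Finset.measurable_fun_sum _ fun k _ => hJ.hold k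
  have hsurv : ∀ n, MeasurableSet {ω | ∀ j < n, Y j ω ≠ 0} := by
    intro n
    have : {ω | ∀ j < n, Y j ω ≠ 0} = ⋂ j, ⋂ (_ : j < n), Y j ⁻¹' {0}ᶜ := by ext; simp
    rw [this]
    exact MeasurableSet.iInter fun k => MeasurableSet.iInter fun _ =>
      hJ.chain k (measurableSet_singleton _).compl
  set E : ℕ → Set Ω := fun n => {ω | Y n ω = 0 ∧ S n ω ≠ ⊤ ∧ (S n ω).toReal ∈ B}
  have hE : ∀ n, MeasurableSet (E n) := fun n =>
    (hJ.chain n (measurableSet_singleton 0)).inter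
      ((hS n (measurableSet_singleton ⊤).compl).inter ((hS n).ennreal_toReal hB))
  set D : ℕ → Set Ω := fun n => E n ∩ {ω | ∀ j < n, Y j ω ≠ 0}
  have hD : ∀ n, MeasurableSet (D n) := fun n => (hE n).inter (hsurv n)
  have hdisj : Pairwise (Function.onFun Disjoint D) := by
    intro n m hnm
    refine Set.disjoint_left.2 fun ω hn hm => ?_
    rcases lt_or_gt_of_ne hnm with hlt | hlt
    · exact hm.2 n hlt hn.1.1
    · exact hn.2 m hlt hm.1.1
  have hPD : ∀ n, P (D n) = passageLaw birth death n x₀ B := by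
    intro n
    have h1 := hJ.lintegral_passage (F := B.indicator 1) (measurable_one.indicator hB) n
    rw [lintegral_indicator_one hB] at h1
    rw [← h1]
    have h2 : ∀ ω, passageFun birth death (B.indicator 1) 0 (Y n ω)
        (∑ k ∈ Finset.range n, H k ω) = (E n).indicator 1 ω := by
      intro ω
      change passageFun birth death (B.indicator 1) 0 (Y n ω) (S n ω) = _
      simp only [passageFun, passageLaw, E]
      have hm : Measurable fun x : ℝ =>
          B.indicator (1 : ℝ → ℝ≥0∞) ((S n ω).toReal + x) :=
        (measurable_one.indicator hB).comp (measurable_const_add _)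
      by_cases hY0 : Y n ω = 0
      · by_cases ht : S n ω = ⊤
        · simp [ht]
        · simp only [ht, if_false, hY0, if_true]
          rw [lintegral_dirac' _ hm, add_zero]
          by_cases hb : (S n ω).toReal ∈ B
          · have hE' : ω ∈ E n := ⟨hY0, ht, hb⟩
            rw [Set.indicator_of_mem hb, Set.indicator_of_mem hE']; rfl
          · have hE' : ω ∉ E n := fun hh => hb hh.2.2
            rw [Set.indicator_of_notMem hb, Set.indicator_of_notMem hE']
      · simp [hY0]
    simp_rw [h2]
    rw [lintegral_indicator_one (hE n), Measure.restrict_apply (hE n)]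
  have hev : {ω | firstPassage X ω ≠ ⊤ ∧ (firstPassage X ω).toReal ∈ B} =ᵐ[P] ⋃ n, D n := by
    filter_upwards [hX] with ω hω
    refine propext ?_
    change (firstPassage X ω ≠ ⊤ ∧ (firstPassage X ω).toReal ∈ B) ↔ ω ∈ ⋃ n, D n
    rw [Set.mem_iUnion, firstPassage_eq_hitTime]
    constructor
    · rintro ⟨h1, h2⟩
      have hex : ∃ n, Y n ω = 0 := by
        by_contra hne
        push Not at hne
        apply h1
        rw [hω.hitTime_eq]
        simp [hne]
      classical
      have heq := hω.hitTime_eq_jumpTime (A := {0}) (n := Nat.find hex) (Nat.find_spec hex)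
        fun j hj => Nat.find_min hex hj
      rw [heq] at h1 h2
      exact ⟨Nat.find hex, ⟨Nat.find_spec hex, h1, h2⟩, fun j hj => Nat.find_min hex hj⟩
    · rintro ⟨n, ⟨hn, h1, h2⟩, hlt⟩
      have heq := hω.hitTime_eq_jumpTime (A := {0}) hn hlt
      rw [heq]
      exact ⟨h1, h2⟩
  rw [measure_congr hev, measure_iUnion hdisj hD, firstPassageLaw, Measure.sum_apply _ hB]
  exact tsum_congr hPD

lemma isFiniteMeasure_firstPassageLaw [IsProbabilityMeasure P]
    (h : IsBirthDeath P X x₀ birth death) :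
    IsFiniteMeasure (firstPassageLaw birth death x₀) := by
  constructor
  rw [← h.measure_firstPassage MeasurableSet.univ]
  exact measure_lt_top _ _

lemma exists_isDensity [IsProbabilityMeasure P] (h : IsBirthDeath P X x₀ birth death)
    (hx : x₀ ≠ 0) : ∃ f, IsDensity P (firstPassage X) f := by
  have := h.isFiniteMeasure_firstPassageLaw
  set ρ := firstPassageLaw birth death x₀
  set f := ρ.rnDeriv (volume.restrict (Set.Ioi 0))
  refine ⟨fun x => (f x).toReal, (Measure.measurable_rnDeriv _ _).ennreal_toReal,
    fun x => ENNReal.toReal_nonneg, fun B hB => ?_⟩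
  rw [h.measure_firstPassage hB, ← Measure.restrict_restrict hB]
  have h1 : ∫⁻ x in B, ENNReal.ofReal (f x).toReal ∂volume.restrict (Set.Ioi 0) =
      ∫⁻ x in B, f x ∂volume.restrict (Set.Ioi 0) := by
    refine lintegral_congr_ae (ae_restrict_of_ae ?_)
    filter_upwards [Measure.rnDeriv_lt_top ρ (volume.restrict (Set.Ioi 0))] with x hx
    rw [ENNReal.ofReal_toReal hx.ne]
  rw [h1, Measure.setLIntegral_rnDeriv (firstPassageLaw_absolutelyContinuous _ _ hx)]

lemma withDensity_eq [IsProbabilityMeasure P] (h : IsBirthDeath P X x₀ birth death) {f : ℝ → ℝ}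
    (hf : IsDensity P (firstPassage X) f) :
    (volume.restrict (Set.Ioi 0)).withDensity (fun x => ENNReal.ofReal (f x)) =
      firstPassageLaw birth death x₀ := by
  ext B hB
  rw [withDensity_apply _ hB, Measure.restrict_restrict hB, ← hf.eq B hB,
    h.measure_firstPassage hB]

/-- The first arrival time of a Poisson process is exponential. -/
lemma measure_lt_hitTime [IsProbabilityMeasure P] {a : ℝ≥0}
    (h : IsBirthDeath P X 0 (fun _ => a) (fun _ => 0)) (t : ℝ≥0) :
    P {ω | (t : ℝ≥0∞) < hitTime {0}ᶜ (fun u => X u ω)} =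
      ENNReal.ofReal (Real.exp (-(a * t))) := by
  obtain ⟨Y, H, hJ, hX⟩ := h.exists_jumpHold
  have hrate : ∀ k, bdRate (fun _ => a) (fun _ => 0) k = a := by
    intro k; simp [bdRate]
  have hpath := hJ.measure_path 0 (fun _ => 0) (fun _ => t)
  simp only [pathWeight, if_true, Finset.range_zero, Finset.prod_empty, one_mul, zero_add,
    Finset.prod_range_one, hrate, expLaw_Ioi a.coe_nonneg] at hpath
  rw [← hpath]
  have hjump : ∀ᵐ ω ∂P, Y 0 ω = 0 ∧ (a ≠ 0 → Y 1 ω = 1) := by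
    rcases eq_or_ne a 0 with ha | ha
    · filter_upwards [hJ.ae_start] with ω hω using ⟨hω, fun h => absurd ha h⟩
    have h1 := hJ.measure_chain_path 1 (fun k => k)
    have hr := hrate 0
    have h2 : P {ω | ∀ k ≤ 1, Y k ω = k} = 1 := by
      rw [h1]; simp [pathWeight, bdJump, hr, ha]
    have h3 := (prob_compl_eq_zero_iff (hJ.measurableSet_path 1 (fun k => k))).2 h2
    rw [ae_iff]
    refine measure_mono_null ?_ h3
    intro ω hω hmem
    exact hω ⟨hmem 0 (by simp), fun _ => hmem 1 le_rfl⟩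
  -- With rate 0 the law of the holding time gives probability 1 to exceeding every integer, so the
  -- arrival never comes.
  have htop : ∀ᵐ ω ∂P, a = 0 → H 0 ω = ⊤ := by
    by_cases ha : a = 0
    · have h1 : ∀ n : ℕ, ∀ᵐ ω ∂P, (n : ℝ≥0∞) < H 0 ω := by
        intro n
        have h1 := hJ.measure_path 0 (fun _ => 0) (fun _ => n)
        simp only [pathWeight, if_true, Finset.range_zero, Finset.prod_empty, one_mul, zero_add,
          Finset.prod_range_one, hrate, expLaw_Ioi a.coe_nonneg] at h1
        have hms : MeasurableSet {ω | ∀ k ≤ 0, Y k ω = 0 ∧ (((n : ℝ≥0) : ℝ≥0∞)) < H k ω} := by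
          have : {ω | ∀ k ≤ 0, Y k ω = 0 ∧ (((n : ℝ≥0) : ℝ≥0∞)) < H k ω} =
              Y 0 ⁻¹' {0} ∩ H 0 ⁻¹' Set.Ioi ((n : ℝ≥0) : ℝ≥0∞) := by
            ext ω; simp
          rw [this]
          exact (hJ.chain 0 (measurableSet_singleton _)).inter (hJ.hold 0 measurableSet_Ioi)
        have h3 := (prob_compl_eq_zero_iff hms).2 (by rw [h1]; simp [ha])
        rw [ae_iff]
        refine measure_mono_null ?_ h3
        intro ω hω hmem
        exact hω (by simpa using (hmem 0 le_rfl).2)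
      filter_upwards [ae_all_iff.2 h1] with ω hω _
      exact ENNReal.eq_top_of_forall_nnreal_le fun r => by
        obtain ⟨n, hn⟩ := exists_nat_ge r
        exact le_trans (by exact_mod_cast hn) (hω n).le
    · exact ae_of_all _ fun _ h => absurd h ha
  refine measure_congr ?_
  filter_upwards [hX, hjump, htop] with ω hω hj ht
  have hT : hitTime {0}ᶜ (fun u => X u ω) = H 0 ω := by
    by_cases ha : a = 0
    · rw [ht ha, hω.hitTime_eq]
      refine iInf₂_eq_top.2 fun n hn => ?_
      rcases n with _ | n
      · exact absurd hj.1 hn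
      · rw [Finset.sum_range_succ', ht ha, add_top]
    · rw [hω.hitTime_eq_jumpTime (n := 1)]
      · simp
      · simp [hj.2 ha]
      · intro j hj'
        rw [show j = 0 by omega]; simp [hj.1]
  refine propext ?_
  change (t : ℝ≥0∞) < hitTime {0}ᶜ (fun u => X u ω) ↔ ∀ k ≤ 0, Y k ω = 0 ∧ (t : ℝ≥0∞) < H k ω
  rw [hT]
  simp [hj.1]

end IsBirthDeath

end

noncomputable section

/-! ### Convergence of the continued fraction -/

/-- The approximants `μ_m / (λ_m + μ_m + s - λ_m (μ_{m+1} / ⋯))`. -/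
def ladder {K : Type*} [Field K] (lam mu : ℕ → K) (s : K) : ℕ → ℕ → K
  | 0, _ => 0
  | n + 1, m => mu m / (lam m + mu m + s - lam m * ladder lam mu s n (m + 1))

/-- An equivalence transformation: pulling out the factor `-λ_{m-1}` at each level turns the
continued fraction of the statement into approximants of ratios of successive passage transforms. -/
lemma contFrac_eq_ladder {lam mu : ℕ → ℂ} {s : ℂ} {a b : ℕ → ℂ}
    (ha : ∀ k, 1 ≤ k → a k = -(lam (k - 1) * mu k)) (hb : ∀ k, b k = lam k + mu k + s)
    (n : ℕ) {m : ℕ} (hm : 1 ≤ m) :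
    contFrac a b n m = -lam (m - 1) * ladder lam mu s n m := by
  induction n generalizing m with
  | zero => simp [contFrac, ladder]
  | succ n ih =>
    rw [contFrac, ladder, ih (by omega), ha m hm, hb]
    simp only [Nat.add_sub_cancel]
    ring

/-- `h` is positive and superharmonic for the process killed at rate `r`. -/
structure IsSupersolution (lam mu : ℕ → ℝ) (r : ℝ) (h : ℕ → ℝ) : Prop where
  lam_pos : ∀ k, 0 < lam k
  mu_pos : ∀ k, 1 ≤ k → 0 < mu k
  pos : ∀ k, 0 < h k
  le : ∀ k, lam (k + 1) * h (k + 2) + mu (k + 1) * h k ≤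
      (lam (k + 1) + mu (k + 1) + r) * h (k + 1)

namespace IsSupersolution

variable {lam mu : ℕ → ℝ} {s : ℂ} {h : ℕ → ℝ}

/-- The bound `h (m + 1) / h m` reproduces itself under the recursion: if the tail is at most `h (m
+ 2) / h (m + 1)`, superharmonicity keeps the denominator at least `μ h m / h (m + 1) > 0`, and
dividing gives the bound one level down. -/
lemma ladder_bounds {r : ℝ} (hs : IsSupersolution lam mu r h) (n m : ℕ) :
    0 ≤ ladder lam mu r n (m + 1) ∧ ladder lam mu r n (m + 1) ≤ h (m + 1) / h m ∧
      0 < lam (m + 1) + mu (m + 1) + r - lam (m + 1) * ladder lam mu r n (m + 2) := by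
  obtain ⟨hlam, hmu, hh, hsup⟩ := hs
  have hden : ∀ m, ∀ x, x ≤ h (m + 2) / h (m + 1) →
      mu (m + 1) * h m / h (m + 1) ≤ lam (m + 1) + mu (m + 1) + r - lam (m + 1) * x := by
    intro m x hx
    have h1 := hh (m + 1)
    have h2 : lam (m + 1) * x ≤ lam (m + 1) * (h (m + 2) / h (m + 1)) :=
      mul_le_mul_of_nonneg_left hx (hlam _).le
    have h3 : mu (m + 1) * h m / h (m + 1) + lam (m + 1) * (h (m + 2) / h (m + 1)) ≤
        lam (m + 1) + mu (m + 1) + r := by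
      rw [mul_div_assoc', ← add_div, div_le_iff₀ h1]
      linarith [hsup m]
    linarith
  have hpos : ∀ m, 0 < mu (m + 1) * h m / h (m + 1) := fun m =>
    div_pos (mul_pos (hmu _ (by omega)) (hh _)) (hh _)
  have key : ∀ n m, 0 ≤ ladder lam mu r n (m + 1) ∧
      ladder lam mu r n (m + 1) ≤ h (m + 1) / h m := by
    intro n
    induction n with
    | zero => intro m; exact ⟨le_rfl, (div_pos (hh _) (hh _)).le⟩
    | succ n ih =>
      intro m
      have h1 := hden m _ (ih (m + 1)).2
      have h2 := (hpos m).trans_le h1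
      rw [ladder]
      refine ⟨(div_pos (hmu _ (by omega)) h2).le, ?_⟩
      rw [div_le_div_iff₀ h2 (hh m)]
      rw [div_le_iff₀ (hh (m + 1))] at h1
      linarith
  exact ⟨(key n m).1, (key n m).2, (hpos m).trans_le (hden m _ (key n (m + 1)).2)⟩

/-- The complex approximants. -/
abbrev cladder (lam mu : ℕ → ℝ) (s : ℂ) (n m : ℕ) : ℂ :=
  ladder (fun k => (lam k : ℂ)) (fun k => (mu k : ℂ)) s n m

lemma norm_rate_ge (hs : IsSupersolution lam mu s.re h) (m : ℕ) (z : ℂ) :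
    lam (m + 1) + mu (m + 1) + s.re - lam (m + 1) * ‖z‖ ≤
      ‖(lam (m + 1) : ℂ) + mu (m + 1) + s - lam (m + 1) * z‖ := by
  have h1 : lam (m + 1) + mu (m + 1) + s.re ≤ ‖(lam (m + 1) : ℂ) + mu (m + 1) + s‖ := by
    have := Complex.re_le_norm ((lam (m + 1) : ℂ) + mu (m + 1) + s)
    simpa using this
  have h2 : ‖(lam (m + 1) : ℂ) * z‖ = lam (m + 1) * ‖z‖ := by
    rw [norm_mul, Complex.norm_real, Real.norm_of_nonneg (hs.lam_pos _).le]
  have h3 := norm_sub_norm_le ((lam (m + 1) : ℂ) + mu (m + 1) + s) (lam (m + 1) * z)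
  linarith

/-- The modulus of `λ + μ + s` is at least `λ + μ + Re s`. So, inductively, each complex denominator
is at least as large in modulus as the real one at `Re s`. -/
lemma norm_cladder_le (hs : IsSupersolution lam mu s.re h) (n m : ℕ) :
    ‖cladder lam mu s n (m + 1)‖ ≤ ladder lam mu s.re n (m + 1) := by
  induction n generalizing m with
  | zero => simp [cladder, ladder]
  | succ n ih =>
    have h1 := (hs.ladder_bounds n m).2.2
    have h2 := hs.norm_rate_ge m (cladder lam mu s n (m + 2))
    have h3 := mul_le_mul_of_nonneg_left (ih (m + 1)) (hs.lam_pos (m + 1)).le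
    simp only [cladder, ladder] at h2 ⊢
    rw [norm_div, Complex.norm_real, Real.norm_of_nonneg (hs.mu_pos _ (by omega)).le]
    exact div_le_div_of_nonneg_left (hs.mu_pos _ (by omega)).le h1 (by linarith!)

lemma le_norm_den (hs : IsSupersolution lam mu s.re h) (n m : ℕ) :
    lam (m + 1) + mu (m + 1) + s.re - lam (m + 1) * ladder lam mu s.re n (m + 2) ≤
      ‖(lam (m + 1) : ℂ) + mu (m + 1) + s - lam (m + 1) * cladder lam mu s n (m + 2)‖ := by
  have h2 := hs.norm_rate_ge m (cladder lam mu s n (m + 2))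
  have h3 := mul_le_mul_of_nonneg_left (hs.norm_cladder_le n (m + 1)) (hs.lam_pos (m + 1)).le
  linarith

lemma den_ne_zero (hs : IsSupersolution lam mu s.re h) (n m : ℕ) :
    (lam (m + 1) : ℂ) + mu (m + 1) + s - lam (m + 1) * cladder lam mu s n (m + 2) ≠ 0 :=
  norm_pos_iff.1 ((hs.ladder_bounds n m).2.2.trans_le (hs.le_norm_den n m))

/-- The difference of two approximants is `μ λ (x - y)` divided by the product of two denominators,
where `x` and `y` are the approximants one level up. The real analogue majorises it factor by
factor. -/
lemma norm_cladder_sub_le (hs : IsSupersolution lam mu s.re h) (n m : ℕ) :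
    ‖cladder lam mu s (n + 1) (m + 1) - cladder lam mu s n (m + 1)‖ ≤
      ladder lam mu s.re (n + 1) (m + 1) - ladder lam mu s.re n (m + 1) := by
  induction n generalizing m with
  | zero =>
    have := hs.norm_cladder_le 1 m
    simpa [cladder, ladder] using this
  | succ n ih =>
    have e : ∀ {K : Type} [Field K] (l u c x y : K), c - l * x ≠ 0 → c - l * y ≠ 0 →
        u / (c - l * x) - u / (c - l * y) = u * l * (x - y) / ((c - l * x) * (c - l * y)) := by
      intro K _ l u c x y hx hy
      rw [div_sub_div _ _ hx hy]; congr 1; ring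
    have h1 := (hs.ladder_bounds (n + 1) m).2.2
    have h2 := (hs.ladder_bounds n m).2.2
    have hl : ladder lam mu s.re (n + 1 + 1) (m + 1) - ladder lam mu s.re (n + 1) (m + 1) = _ :=
      e (lam (m + 1)) (mu (m + 1)) (lam (m + 1) + mu (m + 1) + s.re)
        (ladder lam mu s.re (n + 1) (m + 2)) (ladder lam mu s.re n (m + 2)) h1.ne' h2.ne'
    have hc : cladder lam mu s (n + 1 + 1) (m + 1) - cladder lam mu s (n + 1) (m + 1) = _ :=
      e (lam (m + 1) : ℂ) (mu (m + 1)) (lam (m + 1) + mu (m + 1) + s)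
        (cladder lam mu s (n + 1) (m + 2)) (cladder lam mu s n (m + 2))
        (hs.den_ne_zero (n + 1) m) (hs.den_ne_zero n m)
    rw [hl, hc, norm_div, norm_mul, norm_mul, norm_mul, Complex.norm_real, Complex.norm_real,
      Real.norm_of_nonneg (hs.mu_pos _ (by omega)).le, Real.norm_of_nonneg (hs.lam_pos _).le]
    have hp : 0 ≤ mu (m + 1) * lam (m + 1) :=
      mul_nonneg (hs.mu_pos _ (by omega)).le (hs.lam_pos _).le
    exact div_le_div₀ (mul_nonneg hp ((norm_nonneg _).trans (ih (m + 1))))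
      (mul_le_mul_of_nonneg_left (ih (m + 1)) hp) (mul_pos h1 h2)
      (mul_le_mul (hs.le_norm_den (n + 1) m) (hs.le_norm_den n m) h2.le (norm_nonneg _))

/-- The majorising real increments telescope to a bounded real approximant, hence are summable, and
the complex approximants form a Cauchy sequence. -/
lemma exists_tendsto_cladder (hs : IsSupersolution lam mu s.re h) (m : ℕ) :
    ∃ R : ℂ, Tendsto (fun n => cladder lam mu s n (m + 1)) atTop (𝓝 R) := by
  refine cauchySeq_tendsto_of_complete (cauchySeq_of_dist_le_of_summable
    (fun n => ladder lam mu s.re (n + 1) (m + 1) - ladder lam mu s.re n (m + 1)) (fun n => ?_) ?_)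
  · rw [dist_comm, dist_eq_norm]; exact hs.norm_cladder_sub_le n m
  · refine summable_of_sum_range_le (c := h (m + 1) / h m)
      (fun n => (norm_nonneg _).trans (hs.norm_cladder_sub_le n m)) fun n => ?_
    rw [Finset.sum_range_sub (fun n => ladder lam mu s.re n (m + 1))]
    simpa [ladder] using (hs.ladder_bounds n m).2.1

end IsSupersolution

/-- Transforms of the passage time in `n` jumps for the process killed at level `M`. -/
def killedTransform (lam mu : ℕ → ℝ) (s : ℂ) (M : ℕ) : ℕ → ℕ → ℂ
  | 0, k => if k = 0 then 1 else 0
  | n + 1, k => if 0 < k ∧ k < M then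
      (lam k * killedTransform lam mu s M n (k + 1) + mu k * killedTransform lam mu s M n (k - 1)) /
        (lam k + mu k + s)
      else 0

/-- `a n k` is the transform at `s` of the passage time from `k` to `0` in `n` jumps. -/
structure IsPassageTransform (lam mu : ℕ → ℝ) (s : ℂ) (a : ℕ → ℕ → ℂ) : Prop where
  zero : ∀ k, a 0 k = if k = 0 then 1 else 0
  succ_zero : ∀ n, a (n + 1) 0 = 0
  succ_succ : ∀ n k, a (n + 1) (k + 1) =
    (lam (k + 1) * a n (k + 2) + mu (k + 1) * a n k) / (lam (k + 1) + mu (k + 1) + s)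

/-! ### Passage transforms as products of continued fractions -/

section Passage

variable {lam mu : ℕ → ℝ} {s : ℂ} {a : ℕ → ℕ → ℂ} {β : ℕ → ℕ → ℝ}

/-- In `n` jumps from `k` the process cannot rise to `M > k + n`, so the killing is not felt. -/
lemma IsPassageTransform.killedTransform_eq (ha : IsPassageTransform lam mu s a) {M n k : ℕ}
    (h : k + n < M) : killedTransform lam mu s M n k = a n k := by
  induction n generalizing k with
  | zero => rw [killedTransform, ha.zero]
  | succ n ih =>
    rcases k with _ | k
    · simp [killedTransform, ha.succ_zero]
    · rw [killedTransform, if_pos ⟨by omega, by omega⟩, ha.succ_succ, Nat.add_sub_cancel,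
        ih (by omega), ih (by omega)]

/-- `β` is a bound for the transforms, in terms of the process killed at rate `r`. -/
structure IsPassageBound (lam mu : ℕ → ℝ) (r : ℝ) (β : ℕ → ℕ → ℝ) : Prop where
  nonneg : ∀ n k, 0 ≤ β n k
  zero : β 0 0 = 1
  succ_succ : ∀ n k, β (n + 1) (k + 1) * (lam (k + 1) + mu (k + 1) + r) =
    lam (k + 1) * β n (k + 2) + mu (k + 1) * β n k
  lam_nonneg : ∀ k, 0 ≤ lam k
  mu_nonneg : ∀ k, 0 ≤ mu k
  rate_pos : ∀ k, 0 < lam (k + 1) + mu (k + 1) + r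
  summable : ∀ k, Summable fun n => β n k

lemma IsPassageBound.norm_killedTransform_le (hβ : IsPassageBound lam mu s.re β) (M n k : ℕ) :
    ‖killedTransform lam mu s M n k‖ ≤ β n k := by
  induction n generalizing k with
  | zero =>
    rw [killedTransform]
    split_ifs with hk
    · subst hk; simp [hβ.zero]
    · simpa using hβ.nonneg 0 k
  | succ n ih =>
    rw [killedTransform]
    split_ifs with hk
    · obtain ⟨k, rfl⟩ := Nat.exists_eq_succ_of_ne_zero hk.1.ne'
      simp only [Nat.succ_eq_add_one, Nat.add_sub_cancel]
      have hc : lam (k + 1) + mu (k + 1) + s.re ≤ ‖(lam (k + 1) : ℂ) + mu (k + 1) + s‖ := by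
        have := Complex.re_le_norm ((lam (k + 1) : ℂ) + mu (k + 1) + s)
        simpa using this
      have hp := hβ.rate_pos k
      rw [norm_div, div_le_iff₀ (hp.trans_le hc)]
      refine le_trans (norm_add_le _ _) ?_
      rw [norm_mul, norm_mul, Complex.norm_real, Complex.norm_real,
        Real.norm_of_nonneg (hβ.lam_nonneg _), Real.norm_of_nonneg (hβ.mu_nonneg _)]
      calc _ ≤ lam (k + 1) * β n (k + 2) + mu (k + 1) * β n k :=
            add_le_add (mul_le_mul_of_nonneg_left (ih _) (hβ.lam_nonneg _))
              (mul_le_mul_of_nonneg_left (ih _) (hβ.mu_nonneg _))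
        _ = β (n + 1) (k + 1) * (lam (k + 1) + mu (k + 1) + s.re) := (hβ.succ_succ n k).symm
        _ ≤ _ := mul_le_mul_of_nonneg_left hc (hβ.nonneg _ _)
    · simpa using hβ.nonneg (n + 1) k

/-- Summing the recursion over `n` gives harmonicity up to the term `β 0 (k + 1)`, which is
nonnegative and accounts for the inequality. Positivity spreads upwards from `β 0 0 = 1` through the
death rates. -/
lemma IsPassageBound.isSupersolution (hβ : IsPassageBound lam mu s.re β)
    (hlam : ∀ k, 0 < lam k) (hmu : ∀ k, 1 ≤ k → 0 < mu k) :
    IsSupersolution lam mu s.re fun k => ∑' n, β n k := by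
  have heq : ∀ k, lam (k + 1) * (∑' n, β n (k + 2)) + mu (k + 1) * (∑' n, β n k) ≤
      (lam (k + 1) + mu (k + 1) + s.re) * (∑' n, β n (k + 1)) := by
    intro k
    rw [← tsum_mul_left, ← tsum_mul_left, ← ((hβ.summable (k + 2)).mul_left _).tsum_add
      ((hβ.summable k).mul_left _), mul_comm, ← tsum_mul_right]
    simp_rw [← hβ.succ_succ]
    rw [((hβ.summable (k + 1)).mul_right _).tsum_eq_zero_add]
    exact le_add_of_nonneg_left (mul_nonneg (hβ.nonneg _ _) (hβ.rate_pos k).le)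
  refine ⟨hlam, hmu, fun k => ?_, heq⟩
  induction k with
  | zero =>
    have := (hβ.summable 0).le_tsum 0 fun n _ => hβ.nonneg n 0
    rw [hβ.zero] at this
    linarith
  | succ k ih =>
    have h1 := heq k
    have h2 : 0 ≤ ∑' n, β n (k + 2) := tsum_nonneg fun n => hβ.nonneg _ _
    have h3 := mul_nonneg (hlam (k + 1)).le h2
    have h4 := mul_pos (hmu (k + 1) (by omega)) ih
    exact pos_of_mul_pos_right (a := lam (k + 1) + mu (k + 1) + s.re) (by linarith)
      (hβ.rate_pos k).le

/-- The sums over `n` solve a second-order recursion with value 1 at 0 and 0 at `M`. Read downwards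
from `M`, it says that the ratio of the values at `m + 1` and `m` is the approximant with `M - (m +
1)` levels: the value 0 at `M` is the approximant with no levels. The ratios then telescope. -/
lemma IsPassageBound.tsum_killedTransform (hβ : IsPassageBound lam mu s.re β)
    (hlam : ∀ k, 0 < lam k) (hmu : ∀ k, 1 ≤ k → 0 < mu k) {M k : ℕ} (hk : k < M) :
    ∑' n, killedTransform lam mu s M n k =
      ∏ m ∈ Finset.range k, IsSupersolution.cladder lam mu s (M - (m + 1)) (m + 1) := by
  have hS := hβ.isSupersolution hlam hmu
  have hsum : ∀ k, Summable fun n => killedTransform lam mu s M n k := fun k =>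
    Summable.of_norm_bounded (hβ.summable k) fun n => hβ.norm_killedTransform_le M n k
  set φ : ℕ → ℂ := fun k => ∑' n, killedTransform lam mu s M n k
  have hφM : ∀ k, M ≤ k → 0 < k → φ k = 0 := by
    intro k hk hk0
    refine (tsum_congr fun n => ?_).trans tsum_zero
    rcases n with _ | n
    · simp [killedTransform, hk0.ne']
    · simp [killedTransform, not_lt.2 hk]
  have hφrec : ∀ k, k + 1 < M → φ (k + 1) * (lam (k + 1) + mu (k + 1) + s) =
      lam (k + 1) * φ (k + 2) + mu (k + 1) * φ k := by
    intro k hk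
    have hne : (lam (k + 1) : ℂ) + mu (k + 1) + s ≠ 0 := by
      intro h0
      have h1 := hβ.rate_pos k
      have h2 := congrArg Complex.re h0
      simp at h2
      linarith
    simp only [φ]
    rw [(hsum (k + 1)).tsum_eq_zero_add, ← tsum_mul_left, ← tsum_mul_left,
      ← ((hsum (k + 2)).mul_left _).tsum_add ((hsum k).mul_left _), add_mul, ← tsum_mul_right]
    simp only [killedTransform, Nat.add_eq_zero_iff, one_ne_zero, and_false, if_false, zero_mul,
      zero_add, Nat.succ_pos, hk, and_self, if_true, Nat.add_sub_cancel]
    exact tsum_congr fun n => div_mul_cancel₀ _ hne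
  have hratio : ∀ n m, n + (m + 1) = M → φ (m + 1) =
      IsSupersolution.cladder lam mu s n (m + 1) * φ m := by
    intro n
    induction n with
    | zero =>
      intro m hm
      rw [hφM (m + 1) (by omega) (by omega)]
      simp [IsSupersolution.cladder, ladder]
    | succ n ih =>
      intro m hm
      have h1 := ih (m + 1) (by omega)
      have h2 := hφrec m (by omega)
      have h3 := hS.den_ne_zero n m
      have h4 : IsSupersolution.cladder lam mu s (n + 1) (m + 1) = (mu (m + 1) : ℂ) /
        ((lam (m + 1) : ℂ) + mu (m + 1) + s -
          lam (m + 1) * IsSupersolution.cladder lam mu s n (m + 2)) := rfl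
      rw [h4, div_mul_eq_mul_div, eq_div_iff h3, mul_sub, h2]
      rw [show m + 1 + 1 = m + 2 from rfl] at h1
      rw [h1]; ring
  have hφ0 : φ 0 = 1 := by
    simp only [φ]
    rw [(hsum 0).tsum_eq_zero_add]
    simp [killedTransform]
  change φ k = _
  induction k with
  | zero => simp [hφ0]
  | succ k ih =>
    rw [Finset.prod_range_succ, ← ih (by omega), hratio (M - (k + 1)) k (by omega), mul_comm]

/-- The transform of the passage time is the product of the continued fractions. -/
theorem IsPassageBound.exists_tendsto_cladder_tsum_eq (hβ : IsPassageBound lam mu s.re β)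
    (ha : IsPassageTransform lam mu s a) (hlam : ∀ k, 0 < lam k) (hmu : ∀ k, 1 ≤ k → 0 < mu k)
    (q : ℕ) : ∃ R : ℕ → ℂ,
      (∀ m, Tendsto (fun n => IsSupersolution.cladder lam mu s n (m + 1)) atTop (𝓝 (R m))) ∧
      ∑' n, a n q = ∏ m ∈ Finset.range q, R m := by
  choose R hR using fun m => (hβ.isSupersolution hlam hmu).exists_tendsto_cladder m
  refine ⟨R, hR, ?_⟩
  -- The level `M` is sent to infinity: each term is eventually independent of `M`, and `β`
  -- dominates.
  have h1 : Tendsto (fun M => ∑' n, killedTransform lam mu s M n q) atTop (𝓝 (∑' n, a n q)) := by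
    refine tendsto_tsum_of_dominated_convergence (hβ.summable q) (fun n => ?_)
      (Eventually.of_forall fun M n => hβ.norm_killedTransform_le M n q)
    refine tendsto_const_nhds.congr' ?_
    filter_upwards [eventually_gt_atTop (q + n)] with M hM
    exact (ha.killedTransform_eq hM).symm
  have h2 : Tendsto (fun M => ∑' n, killedTransform lam mu s M n q) atTop
      (𝓝 (∏ m ∈ Finset.range q, R m)) := by
    have h3 : Tendsto (fun M : ℕ => ∏ m ∈ Finset.range q,
        IsSupersolution.cladder lam mu s (M - (m + 1)) (m + 1)) atTop
        (𝓝 (∏ m ∈ Finset.range q, R m)) :=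
      tendsto_finsetProd _ fun m _ => (hR m).comp (tendsto_sub_atTop_nat (m + 1))
    refine h3.congr' ?_
    filter_upwards [eventually_gt_atTop q] with M hM
    exact (hβ.tsum_killedTransform hlam hmu hM).symm
  exact tendsto_nhds_unique h1 h2

end Passage

end

noncomputable section

/-! ### Transforms of the first-passage law -/

lemma norm_cexp_neg_mul (s : ℂ) (t : ℝ) : ‖Complex.exp (-s * t)‖ = Real.exp (-(s.re * t)) := by
  rw [Complex.norm_exp]; simp

lemma integrable_cexp_iff {μ : Measure ℝ} {s : ℂ} :
    Integrable (fun t : ℝ => Complex.exp (-s * t)) μ ↔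
      ∫⁻ t, ENNReal.ofReal (Real.exp (-(s.re * t))) ∂μ < ⊤ := by
  have hm : AEStronglyMeasurable (fun t : ℝ => Complex.exp (-s * t)) μ := by
    have : Continuous fun t : ℝ => Complex.exp (-s * t) := by fun_prop
    exact this.aestronglyMeasurable
  simp only [Integrable, hm, true_and, hasFiniteIntegral_iff_norm, norm_cexp_neg_mul]

lemma laplaceConverges_iff {f : ℝ → ℝ} (hf : Measurable f) (hf0 : ∀ x, 0 ≤ f x) {ρ : Measure ℝ}
    (hρ : (volume.restrict (Set.Ioi 0)).withDensity (fun x => ENNReal.ofReal (f x)) = ρ) {s : ℂ} :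
    LaplaceConverges f s ↔ Integrable (fun t : ℝ => Complex.exp (-s * t)) ρ := by
  rw [← hρ, integrable_withDensity_iff_integrable_smul' (by fun_prop) (by simp)]
  unfold LaplaceConverges IntegrableOn
  refine integrable_congr (ae_of_all _ fun t => ?_)
  simp [ENNReal.toReal_ofReal (hf0 t), mul_comm]

lemma laplace_eq {f : ℝ → ℝ} (hf : Measurable f) (hf0 : ∀ x, 0 ≤ f x) {ρ : Measure ℝ}
    (hρ : (volume.restrict (Set.Ioi 0)).withDensity (fun x => ENNReal.ofReal (f x)) = ρ) (s : ℂ) :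
    laplace f s = ∫ t, Complex.exp (-s * t) ∂ρ := by
  rw [← hρ, integral_withDensity_eq_integral_toReal_smul (by fun_prop) (by simp)]
  unfold laplace
  refine integral_congr_ae (ae_of_all _ fun t => ?_)
  simp [ENNReal.toReal_ofReal (hf0 t), mul_comm]

lemma lintegral_exp_expDens (c r : ℝ) :
    ∫⁻ x, ENNReal.ofReal (Real.exp (-(r * x))) ∂expDens c =
      ∫⁻ x in Set.Ioi 0, ENNReal.ofReal (Real.exp (-((c + r) * x))) := by
  rw [lintegral_expDens _ (by fun_prop)]
  refine lintegral_congr fun x => ?_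
  rw [← ENNReal.ofReal_mul (Real.exp_pos _).le, ← Real.exp_add]
  congr 2; ring

lemma lintegral_exp_expDens_of_pos {c r : ℝ} (h : 0 < c + r) :
    ∫⁻ x, ENNReal.ofReal (Real.exp (-(r * x))) ∂expDens c = ENNReal.ofReal (1 / (c + r)) := by
  rw [lintegral_exp_expDens, lintegral_exp_Ioi h]; simp

lemma lintegral_exp_expDens_of_nonpos {c r : ℝ} (h : c + r ≤ 0) :
    ∫⁻ x, ENNReal.ofReal (Real.exp (-(r * x))) ∂expDens c = ⊤ := by
  rw [lintegral_exp_expDens, eq_top_iff]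
  calc (⊤ : ℝ≥0∞) = ∫⁻ _ in Set.Ioi (0 : ℝ), 1 := by simp
    _ ≤ _ := by
      refine setLIntegral_mono' measurableSet_Ioi fun x hx => ?_
      rw [ENNReal.one_le_ofReal, Real.one_le_exp_iff]
      have : (c + r) * x ≤ 0 := mul_nonpos_of_nonpos_of_nonneg h (le_of_lt hx)
      linarith

lemma integral_cexp_expDens {c : ℝ} {s : ℂ} (h : 0 < c + s.re) :
    ∫ x, Complex.exp (-s * x) ∂expDens c = 1 / (c + s) := by
  unfold expDens
  rw [integral_withDensity_eq_integral_toReal_smul (by fun_prop) (by simp)]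
  have h1 : (-((c : ℂ) + s)).re < 0 := by simp; linarith
  have h2 := integral_exp_mul_complex_Ioi h1 0
  rw [show (1 : ℂ) / (c + s) = -Complex.exp (-((c : ℂ) + s) * (0 : ℝ)) / (-((c : ℂ) + s)) by
    rw [neg_div_neg_eq]; simp, ← h2]
  refine integral_congr_ae (ae_of_all _ fun t => ?_)
  simp only
  rw [ENNReal.toReal_ofReal (Real.exp_pos _).le, Complex.real_smul, Complex.ofReal_exp,
    ← Complex.exp_add]
  congr 1; push_cast; ring

/-- The real transform of the passage time in `n` jumps. -/
def passageMoment (birth death : ℕ → ℝ≥0) (r : ℝ) (n k : ℕ) : ℝ≥0∞ :=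
  ∫⁻ t, ENNReal.ofReal (Real.exp (-(r * t))) ∂passageLaw birth death n k

/-- The complex transform of the passage time in `n` jumps. -/
def passageTransform (birth death : ℕ → ℝ≥0) (s : ℂ) (n k : ℕ) : ℂ :=
  ∫ t, Complex.exp (-s * t) ∂passageLaw birth death n k

variable {birth death : ℕ → ℝ≥0}

lemma lintegral_exp_conv (μ : Measure ℝ) (r c : ℝ) :
    ∫⁻ x, ∫⁻ y, ENNReal.ofReal (Real.exp (-(r * (x + y)))) ∂expDens c ∂μ =
      (∫⁻ y, ENNReal.ofReal (Real.exp (-(r * y))) ∂expDens c) *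
        ∫⁻ x, ENNReal.ofReal (Real.exp (-(r * x))) ∂μ := by
  rw [← lintegral_const_mul _ (by fun_prop)]
  refine lintegral_congr fun x => ?_
  rw [mul_comm, ← lintegral_const_mul _ (by fun_prop)]
  refine lintegral_congr fun y => ?_
  rw [← ENNReal.ofReal_mul (Real.exp_pos _).le, ← Real.exp_add]
  congr 2; ring

lemma passageMoment_zero (r : ℝ) (k : ℕ) :
    passageMoment birth death r 0 k = if k = 0 then 1 else 0 := by
  unfold passageMoment passageLaw
  split_ifs
  · rw [lintegral_dirac' _ (by fun_prop)]; simp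
  · simp

lemma passageMoment_succ_zero (r : ℝ) (n : ℕ) : passageMoment birth death r (n + 1) 0 = 0 := by
  simp [passageMoment, passageLaw]

lemma passageMoment_succ (r : ℝ) (n : ℕ) {k : ℕ} (hk : k ≠ 0) :
    passageMoment birth death r (n + 1) k =
      (∫⁻ y, ENNReal.ofReal (Real.exp (-(r * y))) ∂expDens (bdRate birth death k)) *
        (birth k * passageMoment birth death r n (k + 1) +
          death k * passageMoment birth death r n (k - 1)) := by
  unfold passageMoment
  rw [lintegral_passageLaw_succ _ _ _ hk (by fun_prop), lintegral_exp_conv, lintegral_exp_conv]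
  ring

lemma integral_cexp_conv {μ : Measure ℝ} [SFinite μ] {s : ℂ} {c : ℝ} (hc : 0 < c + s.re)
    (hμ : ∫⁻ t, ENNReal.ofReal (Real.exp (-(s.re * t))) ∂μ < ⊤) :
    Integrable (fun t : ℝ => Complex.exp (-s * t)) (μ.conv (expDens c)) ∧
      ∫ t, Complex.exp (-s * t) ∂(μ.conv (expDens c)) =
        (∫ t, Complex.exp (-s * t) ∂μ) / (c + s) := by
  have hi : Integrable (fun t : ℝ => Complex.exp (-s * t)) (μ.conv (expDens c)) := by
    rw [integrable_cexp_iff, Measure.lintegral_conv (by fun_prop), lintegral_exp_conv,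
      lintegral_exp_expDens_of_pos hc]
    exact ENNReal.mul_lt_top ENNReal.ofReal_lt_top hμ
  refine ⟨hi, ?_⟩
  rw [integral_conv hi]
  have : ∀ x y : ℝ, Complex.exp (-s * ((x + y : ℝ) : ℂ)) =
      Complex.exp (-s * x) * Complex.exp (-s * y) := by
    intro x y
    rw [← Complex.exp_add]; congr 1; push_cast; ring
  simp_rw [this, integral_const_mul, integral_cexp_expDens hc, integral_mul_const]
  ring

lemma passageTransform_zero (s : ℂ) (k : ℕ) :
    passageTransform birth death s 0 k = if k = 0 then 1 else 0 := by
  unfold passageTransform passageLaw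
  split_ifs
  · rw [integral_dirac]; simp
  · simp

lemma passageTransform_succ_zero (s : ℂ) (n : ℕ) :
    passageTransform birth death s (n + 1) 0 = 0 := by
  simp [passageTransform, passageLaw]

/-- The alternative `b = 0` is needed for pure death, where nothing is assumed about the transform
from the state above. -/
lemma integral_cexp_smul_conv {μ : Measure ℝ} [SFinite μ] {s : ℂ} {c : ℝ} (hc : 0 < c + s.re)
    {b : ℝ≥0} (hμ : b = 0 ∨ ∫⁻ t, ENNReal.ofReal (Real.exp (-(s.re * t))) ∂μ < ⊤) :
    Integrable (fun t : ℝ => Complex.exp (-s * t)) ((b : ℝ≥0∞) • μ.conv (expDens c)) ∧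
      ∫ t, Complex.exp (-s * t) ∂((b : ℝ≥0∞) • μ.conv (expDens c)) =
        b * (∫ t, Complex.exp (-s * t) ∂μ) / (c + s) := by
  rcases hμ with rfl | hμ
  · simp
  · obtain ⟨h1, h2⟩ := integral_cexp_conv hc hμ
    refine ⟨h1.smul_measure ENNReal.coe_ne_top, ?_⟩
    rw [integral_smul_measure, h2, ENNReal.coe_toReal, Complex.real_smul, mul_div_assoc]

lemma passageTransform_succ (s : ℂ) (n : ℕ) {k : ℕ} (hk : k ≠ 0)
    (hc : 0 < bdRate birth death k + s.re)
    (hb : birth k = 0 ∨ passageMoment birth death s.re n (k + 1) < ⊤)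
    (hd : death k = 0 ∨ passageMoment birth death s.re n (k - 1) < ⊤) :
    passageTransform birth death s (n + 1) k =
      (birth k * passageTransform birth death s n (k + 1) +
        death k * passageTransform birth death s n (k - 1)) / (bdRate birth death k + s) := by
  obtain ⟨h1, h2⟩ := integral_cexp_smul_conv hc hb
  obtain ⟨h3, h4⟩ := integral_cexp_smul_conv hc hd
  rw [passageTransform, passageLaw, if_neg hk, integral_add_measure h1 h3, h2, h4, ← add_div]
  rfl

lemma lintegral_exp_firstPassageLaw (r : ℝ) (k : ℕ) :
    ∫⁻ t, ENNReal.ofReal (Real.exp (-(r * t))) ∂firstPassageLaw birth death k =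
      ∑' n, passageMoment birth death r n k := by
  rw [firstPassageLaw, lintegral_sum_measure]; rfl

lemma integral_cexp_firstPassageLaw {s : ℂ} {k : ℕ}
    (h : Integrable (fun t : ℝ => Complex.exp (-s * t)) (firstPassageLaw birth death k)) :
    ∫ t, Complex.exp (-s * t) ∂firstPassageLaw birth death k =
      ∑' n, passageTransform birth death s n k :=
  (hasSum_integral_measure h).tsum_eq.symm

/-! ### Pure death -/

/-- Each death lowers the state by one, so the passage from `k` takes exactly `k` jumps and a single
term survives in the sum over `n`. -/
lemma passageMoment_death_eq_zero (r : ℝ) {n k : ℕ} (h : n ≠ k) :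
    passageMoment (fun _ => 0) death r n k = 0 := by
  induction n generalizing k with
  | zero => rw [passageMoment_zero, if_neg (Ne.symm h)]
  | succ n ih =>
    rcases k with _ | k
    · exact passageMoment_succ_zero r n
    · rw [passageMoment_succ r n (by omega), Nat.add_sub_cancel, ih (k := k) (by omega)]
      simp

lemma passageMoment_death_lt_top {r : ℝ} {q : ℕ}
    (hr : ∀ k ∈ Finset.Icc 1 q, -(death k : ℝ) < r) (n : ℕ) {k : ℕ} (hk : k ≤ q) :
    passageMoment (fun _ => 0) death r n k < ⊤ := by
  induction n generalizing k with
  | zero => rw [passageMoment_zero]; split_ifs <;> simp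
  | succ n ih =>
    rcases k with _ | k
    · rw [passageMoment_succ_zero]; simp
    · have h1 := hr (k + 1) (Finset.mem_Icc.2 ⟨by omega, hk⟩)
      have hc : 0 < bdRate (fun _ => 0) death (k + 1) + r := by
        simp [bdRate]; linarith
      rw [passageMoment_succ r n (by omega), lintegral_exp_expDens_of_pos hc]
      simp only [ENNReal.coe_zero, zero_mul, zero_add, Nat.add_sub_cancel]
      exact ENNReal.mul_lt_top ENNReal.ofReal_lt_top
        (ENNReal.mul_lt_top ENNReal.coe_lt_top (ih (by omega)))

lemma passageTransform_death {s : ℂ} {q : ℕ}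
    (hr : ∀ k ∈ Finset.Icc 1 q, -(death k : ℝ) < s.re) (n : ℕ) {k : ℕ} (hk : k ≤ q) :
    passageTransform (fun _ => 0) death s n k = if n = k then deathTransform death k s else 0 := by
  induction n generalizing k with
  | zero =>
    rw [passageTransform_zero]
    by_cases h : k = 0
    · subst h; simp [deathTransform]
    · rw [if_neg h, if_neg (Ne.symm h)]
  | succ n ih =>
    rcases k with _ | k
    · rw [passageTransform_succ_zero]; simp
    · have h1 := hr (k + 1) (Finset.mem_Icc.2 ⟨by omega, hk⟩)
      have hc : 0 < bdRate (fun _ => 0) death (k + 1) + s.re := by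
        simp [bdRate]; linarith
      rw [passageTransform_succ s n (by omega) hc (Or.inl rfl)
        (Or.inr (passageMoment_death_lt_top hr n (by omega)))]
      simp only [NNReal.coe_zero, Complex.ofReal_zero, zero_mul, zero_add, Nat.add_sub_cancel]
      rw [ih (by omega)]
      by_cases h : n = k
      · subst h
        simp only [if_true, deathTransform]
        rw [Finset.prod_Icc_succ_top (by omega)]
        simp [bdRate]; ring
      · simp [h]

/-- The transform of the time in which a pure-death process reaches `0`. -/
lemma transform_death {s : ℂ} {q : ℕ} (hr : ∀ k ∈ Finset.Icc 1 q, -(death k : ℝ) < s.re) :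
    Integrable (fun t : ℝ => Complex.exp (-s * t)) (firstPassageLaw (fun _ => 0) death q) ∧
      ∫ t, Complex.exp (-s * t) ∂firstPassageLaw (fun _ => 0) death q =
        deathTransform death q s := by
  have hi : Integrable (fun t : ℝ => Complex.exp (-s * t))
      (firstPassageLaw (fun _ => 0) death q) := by
    rw [integrable_cexp_iff, lintegral_exp_firstPassageLaw, tsum_eq_single q fun n hn =>
      passageMoment_death_eq_zero s.re hn]
    exact passageMoment_death_lt_top hr q le_rfl
  refine ⟨hi, ?_⟩
  rw [integral_cexp_firstPassageLaw hi, tsum_eq_single q]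
  · rw [passageTransform_death hr q le_rfl, if_pos rfl]
  · intro n hn
    rw [passageTransform_death hr n le_rfl, if_neg hn]

/-! ### Birth and death -/

lemma lintegral_exp_expDens_ne_zero (c r : ℝ) :
    ∫⁻ x, ENNReal.ofReal (Real.exp (-(r * x))) ∂expDens c ≠ 0 := by
  by_cases h : 0 < c + r
  · rw [lintegral_exp_expDens_of_pos h]; simp [h]
  · rw [lintegral_exp_expDens_of_nonpos (not_lt.1 h)]; simp

lemma tsum_passageMoment_zero (r : ℝ) : ∑' n, passageMoment birth death r n 0 = 1 := by
  rw [tsum_eq_single 0]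
  · simp [passageMoment_zero]
  · intro n hn
    obtain ⟨n, rfl⟩ := Nat.exists_eq_succ_of_ne_zero hn
    exact passageMoment_succ_zero r n

lemma tsum_passageMoment (r : ℝ) (k : ℕ) :
    ∑' n, passageMoment birth death r n (k + 1) =
      (∫⁻ y, ENNReal.ofReal (Real.exp (-(r * y))) ∂expDens (bdRate birth death (k + 1))) *
        (birth (k + 1) * (∑' n, passageMoment birth death r n (k + 2)) +
          death (k + 1) * ∑' n, passageMoment birth death r n k) := by
  rw [tsum_eq_zero_add' ENNReal.summable, passageMoment_zero, if_neg (by omega), zero_add]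
  simp_rw [passageMoment_succ r _ (Nat.succ_ne_zero k)]
  rw [ENNReal.tsum_mul_left, ENNReal.tsum_add, ENNReal.tsum_mul_left, ENNReal.tsum_mul_left]
  rfl

/-- By `tsum_passageMoment`, the moment at a state is a combination with positive coefficients of
those at its two neighbours. Finiteness at `q` therefore spreads to both neighbours and on to all
states; positivity of all rates is used here. -/
lemma tsum_passageMoment_lt_top {r : ℝ} (hb : ∀ k, 0 < birth k) (hd : ∀ k, 1 ≤ k → 0 < death k)
    {q : ℕ} (hq : 1 ≤ q) (h : ∑' n, passageMoment birth death r n q < ⊤) (k : ℕ) :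
    ∑' n, passageMoment birth death r n k < ⊤ := by
  have hstep : ∀ k, ∑' n, passageMoment birth death r n (k + 1) < ⊤ →
      ∑' n, passageMoment birth death r n (k + 2) < ⊤ ∧
        ∑' n, passageMoment birth death r n k < ⊤ := by
    intro k hk
    rw [tsum_passageMoment] at hk
    have hL := lintegral_exp_expDens_ne_zero (bdRate birth death (k + 1)) r
    have h1 := ENNReal.lt_top_of_mul_ne_top_right hk.ne hL
    obtain ⟨h2, h3⟩ := ENNReal.add_lt_top.1 h1
    exact ⟨ENNReal.lt_top_of_mul_ne_top_right h2.ne (by simpa using (hb (k + 1)).ne'),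
      ENNReal.lt_top_of_mul_ne_top_right h3.ne (by simpa using (hd (k + 1) (by omega)).ne')⟩
  obtain ⟨q, rfl⟩ := Nat.exists_eq_succ_of_ne_zero (by omega : q ≠ 0)
  have hup : ∀ j, ∑' n, passageMoment birth death r n (q + 1 + j) < ⊤ := by
    intro j
    induction j with
    | zero => exact h
    | succ j ih =>
      have := (hstep (q + j) (by rwa [show q + j + 1 = q + 1 + j by omega])).1
      rwa [show q + j + 2 = q + 1 + (j + 1) by omega] at this
  have hdown : ∀ j, j ≤ q → ∑' n, passageMoment birth death r n (q + 1 - j) < ⊤ := by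
    intro j
    induction j with
    | zero => intro _; exact h
    | succ j ih =>
      intro hj
      have := (hstep (q - j) (by rw [show q - j + 1 = q + 1 - j by omega]; exact ih (by omega))).2
      rwa [show q - j = q + 1 - (j + 1) by omega] at this
  rcases Nat.eq_zero_or_pos k with rfl | hk
  · rw [tsum_passageMoment_zero]; exact ENNReal.one_lt_top
  rcases le_total k (q + 1) with hkq | hkq
  · have := hdown (q + 1 - k) (by omega)
    rwa [show q + 1 - (q + 1 - k) = k by omega] at this
  · have := hup (k - (q + 1))
    rwa [show q + 1 + (k - (q + 1)) = k by omega] at this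

lemma tsum_passageMoment_ne_zero {r : ℝ} (hd : ∀ k, 1 ≤ k → 0 < death k) (k : ℕ) :
    ∑' n, passageMoment birth death r n k ≠ 0 := by
  induction k with
  | zero => rw [tsum_passageMoment_zero]; exact one_ne_zero
  | succ k ih =>
    rw [tsum_passageMoment]
    refine mul_ne_zero (lintegral_exp_expDens_ne_zero _ _) ?_
    rw [Ne, add_eq_zero, not_and_or]
    exact Or.inr (mul_ne_zero (by simpa using (hd (k + 1) (by omega)).ne') ih)

/-- If the rate plus `r` were not positive, a single holding time in the state would already have an
infinite exponential moment. -/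
lemma rate_pos_of_moment_lt_top {r : ℝ} (hd : ∀ k, 1 ≤ k → 0 < death k)
    (h : ∀ k, ∑' n, passageMoment birth death r n k < ⊤) (k : ℕ) :
    0 < bdRate birth death (k + 1) + r := by
  by_contra hneg
  have h1 := h (k + 1)
  rw [tsum_passageMoment, lintegral_exp_expDens_of_nonpos (not_lt.1 hneg), ENNReal.top_mul] at h1
  · exact lt_irrefl _ h1
  · rw [Ne, add_eq_zero, not_and_or]
    exact Or.inr (mul_ne_zero (by simpa using (hd (k + 1) (by omega)).ne')
      (tsum_passageMoment_ne_zero hd k))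

lemma bdRate_succ (k : ℕ) :
    bdRate birth death (k + 1) = (birth (k + 1) : ℝ) + death (k + 1) := by
  simp [bdRate]

/-- The transform of the first-passage time of a birth-death process. -/
theorem transform_birthDeath (hb : ∀ k, 0 < birth k) (hd : ∀ k, 1 ≤ k → 0 < death k) {q : ℕ}
    (hq : 1 ≤ q) {s : ℂ}
    (hi : Integrable (fun t : ℝ => Complex.exp (-s * t)) (firstPassageLaw birth death q)) :
    ∃ R : ℕ → ℂ,
      (∀ m, Tendsto (fun n => IsSupersolution.cladder (fun k => birth k) (fun k => death k) s n
        (m + 1)) atTop (𝓝 (R m))) ∧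
      ∫ t, Complex.exp (-s * t) ∂firstPassageLaw birth death q = ∏ m ∈ Finset.range q, R m := by
  rw [integral_cexp_firstPassageLaw hi]
  rw [integrable_cexp_iff, lintegral_exp_firstPassageLaw] at hi
  have hfin := tsum_passageMoment_lt_top hb hd hq hi
  have hfin1 : ∀ n k, passageMoment birth death s.re n k < ⊤ := fun n k =>
    (ENNReal.le_tsum n).trans_lt (hfin k)
  have hrate := rate_pos_of_moment_lt_top hd hfin
  have hβ : IsPassageBound (fun k => birth k) (fun k => death k) s.re
      fun n k => (passageMoment birth death s.re n k).toReal := by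
    refine ⟨fun n k => ENNReal.toReal_nonneg, ?_, fun n k => ?_, fun k => (birth k).2,
      fun k => (death k).2, fun k => ?_, fun k => ENNReal.summable_toReal (hfin k).ne⟩
    · simp [passageMoment_zero]
    · have h0 := hrate k
      rw [passageMoment_succ _ _ (Nat.succ_ne_zero k), lintegral_exp_expDens_of_pos h0,
        ENNReal.toReal_mul, ENNReal.toReal_add, ENNReal.toReal_mul, ENNReal.toReal_mul,
        ENNReal.toReal_ofReal (by positivity)]
      · simp only [ENNReal.coe_toReal, ← bdRate_succ]
        field_simp
        rfl
      · exact ENNReal.mul_ne_top ENNReal.coe_ne_top (hfin1 _ _).ne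
      · exact ENNReal.mul_ne_top ENNReal.coe_ne_top (hfin1 _ _).ne
    · rw [← bdRate_succ]; exact hrate k
  have ha : IsPassageTransform (fun k => birth k) (fun k => death k) s
      (passageTransform birth death s) := by
    refine ⟨passageTransform_zero s, passageTransform_succ_zero s, fun n k => ?_⟩
    rw [passageTransform_succ s n (Nat.succ_ne_zero k) (hrate k) (Or.inr (hfin1 _ _))
      (Or.inr (hfin1 _ _)), bdRate_succ]
    push_cast
    rfl
  exact hβ.exists_tendsto_cladder_tsum_eq ha (fun k => hb k) (fun k hk => hd k hk) q

end

noncomputable section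

/-! ### The best quotes of a book -/

section Quotes

variable {N : ℕ} {q : ℕ → ℤ} {p : Side → ℕ}

lemma bestAsk_le {l : ℕ} (h1 : 1 ≤ l) (h2 : l ≤ N) (h : 0 < q l) : bestAsk N q ≤ l :=
  Nat.sInf_le (Or.inl ⟨h1, h2, h⟩)

lemma bestAsk_mem (N : ℕ) (q : ℕ → ℤ) :
    (1 ≤ bestAsk N q ∧ bestAsk N q ≤ N ∧ 0 < q (bestAsk N q)) ∨ bestAsk N q = N + 1 :=
  Nat.sInf_mem (s := {l | 1 ≤ l ∧ l ≤ N ∧ 0 < q l} ∪ {N + 1}) ⟨N + 1, Or.inr rfl⟩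

lemma bddAbove_bid (N : ℕ) (q : ℕ → ℤ) : BddAbove ({l | 1 ≤ l ∧ l ≤ N ∧ q l < 0} ∪ {0}) := by
  refine ⟨N, ?_⟩
  rintro l (⟨-, h, -⟩ | h)
  · exact h
  · rw [Set.mem_singleton_iff.1 h]; exact Nat.zero_le _

lemma le_bestBid {l : ℕ} (h1 : 1 ≤ l) (h2 : l ≤ N) (h : q l < 0) : l ≤ bestBid N q :=
  le_csSup (bddAbove_bid N q) (Or.inl ⟨h1, h2, h⟩)

lemma bestBid_mem (N : ℕ) (q : ℕ → ℤ) :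
    (1 ≤ bestBid N q ∧ bestBid N q ≤ N ∧ q (bestBid N q) < 0) ∨ bestBid N q = 0 :=
  Nat.sSup_mem (s := {l | 1 ≤ l ∧ l ≤ N ∧ q l < 0} ∪ {0}) ⟨0, Or.inr rfl⟩ (bddAbove_bid N q)

lemma midPrice_congr {q' : ℕ → ℤ} (h : ∀ l ≤ N, q l = q' l) : midPrice N q = midPrice N q' := by
  have h1 : {l | 1 ≤ l ∧ l ≤ N ∧ 0 < q l} = {l | 1 ≤ l ∧ l ≤ N ∧ 0 < q' l} := by
    ext l
    simp only [Set.mem_ofPred_eq]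
    constructor
    · rintro ⟨a, b, c⟩; exact ⟨a, b, h l b ▸ c⟩
    · rintro ⟨a, b, c⟩; exact ⟨a, b, (h l b).symm ▸ c⟩
  have h2 : {l | 1 ≤ l ∧ l ≤ N ∧ q l < 0} = {l | 1 ≤ l ∧ l ≤ N ∧ q' l < 0} := by
    ext l
    simp only [Set.mem_ofPred_eq]
    constructor
    · rintro ⟨a, b, c⟩; exact ⟨a, b, h l b ▸ c⟩
    · rintro ⟨a, b, c⟩; exact ⟨a, b, (h l b).symm ▸ c⟩
  simp only [midPrice, bestAsk, bestBid, h1, h2]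

/-- The mid-price between the quotes `p`. -/
def quoteMid (p : Side → ℕ) : ℝ := ((p .bid : ℝ) + p .ask) / 2

lemma midPrice_eq_of_no_event (hb : 1 ≤ p .bid) (ha : p .ask ≤ N) (hpp : p .bid < p .ask)
    (hu : bestBid N q < bestAsk N q) (hA : 0 < q (p .ask)) (hB : q (p .bid) < 0)
    (hin : ∀ l, p .bid < l → l < p .ask → q l = 0) : midPrice N q = quoteMid p := by
  have h1 := bestAsk_le (N := N) (q := q) (by omega) ha hA
  have h2 := le_bestBid (N := N) (q := q) hb (by omega) hB
  have h3 : bestAsk N q = p .ask := by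
    rcases bestAsk_mem N q with ⟨-, -, h⟩ | h
    · by_contra hne
      rw [hin _ (by omega) (by omega)] at h
      exact lt_irrefl _ h
    · omega
  have h4 : bestBid N q = p .bid := by
    rcases bestBid_mem N q with ⟨-, -, h⟩ | h
    · by_contra hne
      rw [hin _ (by omega) (by omega)] at h
      exact lt_irrefl _ h
    · omega
  rw [midPrice, h3, h4, quoteMid]

/-- The new sell order lowers the best ask strictly, and the bid cannot rise since the other levels
inside are empty. So the sum of the quotes drops; the companion lemmas compare this sum in the same
way. -/
lemma midPrice_ne_of_ask_inside (hb : 1 ≤ p .bid) (ha : p .ask ≤ N)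
    (hu : bestBid N q < bestAsk N q) {l : ℕ} (hl1 : p .bid < l) (hl2 : l < p .ask)
    (hl : 0 < q l) (hin : ∀ l', p .bid < l' → l' < p .ask → l' ≠ l → q l' = 0) :
    midPrice N q ≠ quoteMid p := by
  have h1 := bestAsk_le (N := N) (q := q) (by omega) (by omega) hl
  have h4 : bestBid N q ≤ p .bid := by
    rcases bestBid_mem N q with ⟨-, -, h⟩ | h
    · by_contra hne
      rw [hin _ (by omega) (by omega) (by omega)] at h
      exact lt_irrefl _ h
    · omega
  have h5 : bestBid N q + bestAsk N q < p .bid + p .ask := by omega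
  have h6 : (bestBid N q : ℝ) + bestAsk N q < p .bid + p .ask := by exact_mod_cast h5
  unfold midPrice quoteMid
  intro h; linarith

lemma midPrice_ne_of_bid_inside (hb : 1 ≤ p .bid) (ha : p .ask ≤ N)
    (hu : bestBid N q < bestAsk N q) {l : ℕ} (hl1 : p .bid < l) (hl2 : l < p .ask)
    (hl : q l < 0) (hin : ∀ l', p .bid < l' → l' < p .ask → l' ≠ l → q l' = 0) :
    midPrice N q ≠ quoteMid p := by
  have h1 := le_bestBid (N := N) (q := q) (by omega) (by omega) hl
  have h4 : p .ask ≤ bestAsk N q := by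
    rcases bestAsk_mem N q with ⟨-, -, h⟩ | h
    · by_contra hne
      rw [hin _ (by omega) (by omega) (by omega)] at h
      exact lt_irrefl _ h
    · omega
  have h5 : p .bid + p .ask < bestBid N q + bestAsk N q := by omega
  have h6 : (p .bid : ℝ) + p .ask < bestBid N q + bestAsk N q := by exact_mod_cast h5
  unfold midPrice quoteMid
  intro h; linarith

/-- The bid falls strictly, and the surviving queue at the old ask keeps the ask from rising, so the
two effects cannot cancel. -/
lemma midPrice_ne_of_bid_depleted (hb : 1 ≤ p .bid) (ha : p .ask ≤ N) (hpp : p .bid < p .ask)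
    (hu : bestBid N q < bestAsk N q) (hA : 0 < q (p .ask)) (hB : q (p .bid) = 0)
    (hin : ∀ l, p .bid < l → l < p .ask → q l = 0) : midPrice N q ≠ quoteMid p := by
  have h1 := bestAsk_le (N := N) (q := q) (by omega) ha hA
  have h4 : bestBid N q < p .bid := by
    rcases bestBid_mem N q with ⟨-, -, h⟩ | h
    · by_contra hne
      rcases eq_or_ne (bestBid N q) (p .bid) with heq | hne'
      · rw [heq, hB] at h; exact lt_irrefl _ h
      · rw [hin _ (by omega) (by omega)] at h
        exact lt_irrefl _ h
    · omega
  have h5 : bestBid N q + bestAsk N q < p .bid + p .ask := by omega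
  have h6 : (bestBid N q : ℝ) + bestAsk N q < p .bid + p .ask := by exact_mod_cast h5
  unfold midPrice quoteMid
  intro h; linarith

lemma midPrice_ne_of_ask_depleted (hb : 1 ≤ p .bid) (ha : p .ask ≤ N) (hpp : p .bid < p .ask)
    (hu : bestBid N q < bestAsk N q) (hA : q (p .ask) = 0) (hB : q (p .bid) < 0)
    (hin : ∀ l, p .bid < l → l < p .ask → q l = 0) : midPrice N q ≠ quoteMid p := by
  have h1 := le_bestBid (N := N) (q := q) hb (by omega) hB
  have h4 : p .ask < bestAsk N q := by
    rcases bestAsk_mem N q with ⟨-, -, h⟩ | h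
    · by_contra hne
      rcases eq_or_ne (bestAsk N q) (p .ask) with heq | hne'
      · rw [heq, hA] at h; exact lt_irrefl _ h
      · rw [hin _ (by omega) (by omega)] at h
        exact lt_irrefl _ h
    · omega
  have h5 : p .bid + p .ask < bestBid N q + bestAsk N q := by omega
  have h6 : (p .bid : ℝ) + p .ask < bestBid N q + bestAsk N q := by exact_mod_cast h5
  unfold midPrice quoteMid
  intro h; linarith

end Quotes

/-! ### The first mid-price move along a path -/

/-- The values of the process `Z s l` that move the mid-price: the best queues have to be depleted,
and inside the spread an order has to arrive. -/
def eventSet (p : Side → ℕ) (x : Side × ℕ) : Set ℕ := if x.2 = p x.1 then {0} else {0}ᶜ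

lemma Side.opp_ne (i : Side) : i.opp ≠ i := by cases i <;> simp [Side.opp]

/-- The realization `q` of a book follows `z` up to the first move of the mid-price. -/
structure BookPath (N : ℕ) (p : Side → ℕ) (i : Side) (z : Side → ℕ → ℝ≥0 → ℕ)
    (q : ℝ≥0 → ℕ → ℤ) : Prop where
  one_le : 1 ≤ p .bid
  le_N : p .ask ≤ N
  lt : p .bid < p .ask
  init : midPrice N (q 0) = quoteMid p
  rightCont : ∀ l t, ∀ᶠ u in 𝓝[>] t, q u l = q t l
  uncrossed : ∀ t, bestBid N (q t) < bestAsk N (q t)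
  follow : ∀ t, (∀ u < t, midPrice N (q u) = midPrice N (q 0)) →
    (z i (p i) t : ℤ) ≤ i.sgn * q t (p i) ∧
    q t (p i.opp) = i.opp.sgn * z i.opp (p i.opp) t ∧
    ∀ l, p .bid < l → l < p .ask → q t l = (z .ask l t : ℤ) - z .bid l t
  rightConst : ∀ x ∈ activeQueues p, RightConst (z x.1 x.2)
  noTie : ∀ x ∈ activeQueues p, ∀ y ∈ activeQueues p, x ≠ (i, p i) → y ≠ (i, p i) → x ≠ y →
    hitTime (eventSet p x) (z x.1 x.2) = hitTime (eventSet p y) (z y.1 y.2) →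
    hitTime (eventSet p x) (z x.1 x.2) = ⊤

/-- The first event on a path. -/
def pathMoveTime (N : ℕ) (q : ℝ≥0 → ℕ → ℤ) : ℝ≥0∞ :=
  ⨅ (t : ℝ≥0) (_ : midPrice N (q t) ≠ midPrice N (q 0)), (t : ℝ≥0∞)

namespace BookPath

variable {N : ℕ} {p : Side → ℕ} {i : Side} {z : Side → ℕ → ℝ≥0 → ℕ} {q : ℝ≥0 → ℕ → ℤ}

lemma mem_best (hp : p .bid < p .ask) (s : Side) : (s, p s) ∈ activeQueues p := by
  cases s <;> simp [activeQueues] <;> omega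

lemma mem_inside (s : Side) {l : ℕ} (h1 : p .bid < l) (h2 : l < p .ask) :
    (s, l) ∈ activeQueues p := by
  simp [activeQueues]; omega

lemma ne_of_inside {s : Side} {l : ℕ} (h1 : p .bid < l) (h2 : l < p .ask) : l ≠ p s := by
  cases s <;> omega

lemma eq_of_lt_moveTime {t : ℝ≥0} (h : (t : ℝ≥0∞) < pathMoveTime N q) :
    midPrice N (q t) = midPrice N (q 0) := by
  by_contra hne
  exact absurd (iInf₂_le t hne) (not_le.2 h)

lemma notMem_best {t : ℝ≥0} {s : Side}
    (h : (t : ℝ≥0∞) < hitTime (eventSet p (s, p s)) (z s (p s))) : 0 < z s (p s) t := by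
  have := notMem_of_lt_hitTime h
  simp [eventSet] at this
  omega

lemma notMem_inside {t : ℝ≥0} {s : Side} {l : ℕ} (h1 : p .bid < l) (h2 : l < p .ask)
    (h : (t : ℝ≥0∞) < hitTime (eventSet p (s, l)) (z s l)) : z s l t = 0 := by
  have := notMem_of_lt_hitTime h
  simp [eventSet, ne_of_inside (p := p) (s := s) h1 h2] at this
  exact this

lemma eventually_midPrice_eq (hP : BookPath N p i z q) (t : ℝ≥0) :
    ∀ᶠ u in 𝓝[>] t, midPrice N (q u) = midPrice N (q t) := by
  have : ∀ᶠ u in 𝓝[>] t, ∀ l ∈ Finset.range (N + 1), q u l = q t l :=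
    (Finset.eventually_all _).2 fun l _ => hP.rightCont l t
  filter_upwards [this] with u hu
  exact midPrice_congr fun l hl => hu l (Finset.mem_range.2 (by omega))

/-- The mid-price does not move before the first event. -/
lemma le_moveTime (hP : BookPath N p i z q) {c : ℝ≥0∞}
    (hc : ∀ x ∈ activeQueues p, c ≤ hitTime (eventSet p x) (z x.1 x.2)) :
    c ≤ pathMoveTime N q := by
  by_contra hlt
  push Not at hlt
  obtain ⟨t, ht⟩ : ∃ t : ℝ≥0, (t : ℝ≥0∞) = pathMoveTime N q :=
    ⟨_, ENNReal.coe_toNNReal hlt.ne_top⟩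
  rw [← ht] at hlt
  have hbefore : ∀ u < t, midPrice N (q u) = midPrice N (q 0) := fun u hu =>
    eq_of_lt_moveTime (by rw [← ht]; exact_mod_cast hu)
  obtain ⟨h1, h2, h3⟩ := hP.follow t hbefore
  have hbest : ∀ s, 0 < z s (p s) t := fun s =>
    notMem_best (hlt.trans_le (hc _ (mem_best hP.lt s)))
  have hins : ∀ s l, p .bid < l → l < p .ask → z s l t = 0 := fun s l hl1 hl2 =>
    notMem_inside hl1 hl2 (hlt.trans_le (hc (s, l) (mem_inside s hl1 hl2)))
  have hmid : midPrice N (q t) = midPrice N (q 0) := by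
    rw [hP.init]
    have hb1 := hbest i
    have hb2 := hbest i.opp
    refine midPrice_eq_of_no_event hP.one_le hP.le_N hP.lt (hP.uncrossed t) ?_ ?_ ?_
    · cases i <;> simp [Side.sgn, Side.opp] at h1 h2 hb1 hb2 <;> omega
    · cases i <;> simp [Side.sgn, Side.opp] at h1 h2 hb1 hb2 <;> omega
    · intro l hl1 hl2
      rw [h3 l hl1 hl2, hins _ l hl1 hl2, hins _ l hl1 hl2]; simp
  -- By right-continuity the mid-price keeps its initial value for a while after `t`, so the first
  -- change cannot have infimum `t`.
  have hev := hP.eventually_midPrice_eq t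
  rw [hmid] at hev
  obtain ⟨δ, hδ, hδ'⟩ := (mem_nhdsGT_iff_exists_Ioo_subset).1 hev
  have : (δ : ℝ≥0∞) ≤ pathMoveTime N q := by
    refine le_iInf₂ fun u hu => ?_
    rw [ENNReal.coe_le_coe]
    by_contra hlt'
    push Not at hlt'
    rcases lt_trichotomy u t with h | h | h
    · exact hu (hbefore u h)
    · exact hu (h ▸ hmid)
    · exact hu (hδ' ⟨h, hlt'⟩)
  rw [← ht, ENNReal.coe_le_coe] at this
  exact absurd hδ (not_lt.2 this)

/-- The first event moves the mid-price. -/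
lemma moveTime_le (hP : BookPath N p i z q) {x : Side × ℕ} (hx : x ∈ activeQueues p)
    (hxi : x ≠ (i, p i)) {t : ℝ≥0} (ht : hitTime (eventSet p x) (z x.1 x.2) = t)
    (hmin : ∀ y ∈ activeQueues p, y ≠ (i, p i) → (t : ℝ≥0∞) ≤ hitTime (eventSet p y) (z y.1 y.2))
    (hi : (t : ℝ≥0∞) < hitTime (eventSet p (i, p i)) (z i (p i))) :
    pathMoveTime N q ≤ t := by
  by_contra hlt
  push Not at hlt
  have hbefore : ∀ u < t, midPrice N (q u) = midPrice N (q 0) := fun u hu =>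
    eq_of_lt_moveTime (lt_trans (by exact_mod_cast hu) hlt)
  have hmid := eq_of_lt_moveTime hlt
  rw [hP.init] at hmid
  obtain ⟨h1, h2, h3⟩ := hP.follow t hbefore
  have hmem := (hP.rightConst x hx).hitTime_mem ht
  -- Only the event `x` has occurred by time `t`. Absence of ties matters: simultaneous arrivals
  -- placed symmetrically on both sides would leave the mid-price in place.
  have hother : ∀ y ∈ activeQueues p, y ≠ x →
      (t : ℝ≥0∞) < hitTime (eventSet p y) (z y.1 y.2) := by
    intro y hy hyx
    by_cases hyi : y = (i, p i)
    · subst hyi; exact hi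
    · refine lt_of_le_of_ne (hmin y hy hyi) fun heq => ?_
      have := hP.noTie x hx y hy hxi hyi (Ne.symm hyx) (by rw [ht, heq])
      rw [ht] at this
      exact ENNReal.coe_ne_top this
  have hbi := notMem_best hi
  have hu := hP.uncrossed t
  obtain ⟨s, l⟩ := x
  by_cases hl : l = p s
  · have hs : s = i.opp := by
      subst hl
      cases s <;> cases i <;> first | rfl | exact absurd rfl hxi
    subst hl
    have hz : z s (p s) t = 0 := by simpa [eventSet] using hmem
    have hin : ∀ l, p .bid < l → l < p .ask → q t l = 0 := by
      intro l hl1 hl2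
      have hne : ∀ s', (s', l) ≠ (s, p s) := fun s' he =>
        ne_of_inside (s := s) hl1 hl2 (congrArg Prod.snd he)
      rw [h3 l hl1 hl2, notMem_inside hl1 hl2 (hother (.ask, l) (mem_inside _ hl1 hl2) (hne _)),
        notMem_inside hl1 hl2 (hother (.bid, l) (mem_inside _ hl1 hl2) (hne _))]
      simp
    rw [← hs, hz] at h2
    cases i
    · have hs' : s = .bid := hs
      subst hs'
      simp [Side.sgn] at h1 h2
      exact midPrice_ne_of_bid_depleted hP.one_le hP.le_N hP.lt hu (by omega) h2 hin hmid
    · have hs' : s = .ask := hs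
      subst hs'
      simp [Side.sgn] at h1 h2
      exact midPrice_ne_of_ask_depleted hP.one_le hP.le_N hP.lt hu h2 (by omega) hin hmid
  · have hl1 : p .bid < l := by
      cases s <;> simp [activeQueues] at hx hl <;> omega
    have hl2 : l < p .ask := by
      cases s <;> simp [activeQueues] at hx hl <;> omega
    have hz : z s l t ≠ 0 := by simpa [eventSet, hl] using hmem
    have hin : ∀ l', p .bid < l' → l' < p .ask → l' ≠ l → q t l' = 0 := by
      intro l' hl1' hl2' hne
      have hne' : ∀ s', (s', l') ≠ (s, l) := fun s' he => hne (congrArg Prod.snd he)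
      rw [h3 l' hl1' hl2',
        notMem_inside hl1' hl2' (hother (.ask, l') (mem_inside _ hl1' hl2') (hne' _)),
        notMem_inside hl1' hl2' (hother (.bid, l') (mem_inside _ hl1' hl2') (hne' _))]
      simp
    have h3l := h3 l hl1 hl2
    cases s
    · rw [notMem_inside hl1 hl2 (hother (.bid, l) (mem_inside _ hl1 hl2) (by simp))] at h3l
      exact midPrice_ne_of_ask_inside hP.one_le hP.le_N hu hl1 hl2 (by omega) hin hmid
    · rw [notMem_inside hl1 hl2 (hother (.ask, l) (mem_inside _ hl1 hl2) (by simp))] at h3l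
      exact midPrice_ne_of_bid_inside hP.one_le hP.le_N hu hl1 hl2 (by omega) hin hmid

end BookPath

instance : Finite Side :=
  Finite.of_injective (fun s : Side => match s with | .ask => true | .bid => false)
    (by intro a b; cases a <;> cases b <;> simp)

lemma finite_activeQueues (p : Side → ℕ) : (activeQueues p).Finite :=
  ((Set.finite_univ (α := Side)).prod (Set.finite_Icc (p .bid) (p .ask))).subset
    fun _ hx => ⟨trivial, hx.1, hx.2.1⟩

instance (p : Side → ℕ) : Finite (activeQueues p) := finite_activeQueues p

/-- The order is filled before the mid-price moves iff it is filled before every other event. -/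
lemma BookPath.fill_iff {N : ℕ} {p : Side → ℕ} {i : Side} {z : Side → ℕ → ℝ≥0 → ℕ}
    {q : ℝ≥0 → ℕ → ℤ} (hP : BookPath N p i z q) :
    hitTime (eventSet p (i, p i)) (z i (p i)) ≤ pathMoveTime N q ↔
      ∀ x ∈ activeQueues p, x ≠ (i, p i) →
        hitTime (eventSet p (i, p i)) (z i (p i)) ≤ hitTime (eventSet p x) (z x.1 x.2) := by
  constructor
  · intro h
    by_contra hne
    push Not at hne
    set S := {x | x ∈ activeQueues p ∧ x ≠ (i, p i)}
    have hS : S.Finite := (finite_activeQueues p).subset fun x hx => hx.1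
    obtain ⟨x₁, hx₁, hx₁i, hlt⟩ := hne
    -- Some rival event precedes the execution; the earliest of these finitely many events moves the
    -- mid-price too soon.
    obtain ⟨x, hxS, hx⟩ := Set.exists_min_image S
      (fun x => hitTime (eventSet p x) (z x.1 x.2)) hS ⟨x₁, hx₁, hx₁i⟩
    have hxlt := (hx x₁ ⟨hx₁, hx₁i⟩).trans_lt hlt
    obtain ⟨t, ht⟩ : ∃ t : ℝ≥0, (t : ℝ≥0∞) = hitTime (eventSet p x) (z x.1 x.2) :=
      ⟨_, ENNReal.coe_toNNReal hxlt.ne_top⟩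
    have := hP.moveTime_le hxS.1 hxS.2 ht.symm
      (fun y hy hyi => by rw [ht]; exact hx y ⟨hy, hyi⟩) (by rw [ht]; exact hxlt)
    exact absurd (h.trans this) (not_le.2 (by rw [ht]; exact hxlt))
  · intro h
    refine hP.le_moveTime fun x hx => ?_
    by_cases hxi : x = (i, p i)
    · subst hxi; exact le_rfl
    · exact h x hx hxi

end

noncomputable section

/-! ### The clocks of the book -/

lemma map_eq_expLaw {Ω : Type*} [MeasurableSpace Ω] {P : Measure Ω} [IsProbabilityMeasure P]
    {T : Ω → ℝ≥0∞} (hT : Measurable T) {a : ℝ≥0}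
    (h : ∀ t : ℝ≥0, P {ω | (t : ℝ≥0∞) < T ω} = ENNReal.ofReal (Real.exp (-(a * t)))) :
    P.map T = expLaw a := by
  have := Measure.isProbabilityMeasure_map (μ := P) hT.aemeasurable
  have := isProbabilityMeasure_expLaw a.coe_nonneg
  refine ext_of_generate_finite _ generateFrom_Ioi_coe_union_univ.symm
    isPiSystem_Ioi_coe_union_univ ?_ (by simp)
  rintro s (⟨t, rfl⟩ | rfl)
  · rw [Measure.map_apply hT measurableSet_Ioi, expLaw_Ioi a.coe_nonneg]
    exact h t
  · simp

lemma expLaw_singleton (r : ℝ) {c : ℝ≥0∞} (hc : c ≠ ⊤) : expLaw r {c} = 0 := by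
  by_cases hr : r = 0
  · subst hr; simp [expLaw_zero, Ne.symm hc]
  · rw [expLaw_of_ne hr, Measure.smul_apply,
      Measure.map_apply ENNReal.measurable_ofReal (measurableSet_singleton _), smul_eq_mul]
    have hac : expDens r ≪ volume :=
      (withDensity_absolutelyContinuous _ _).trans Measure.restrict_le_self.absolutelyContinuous
    have h1 : expDens r {c.toReal} = 0 := hac (by simp)
    have h2 : ∀ᵐ x ∂expDens r, x ∉ ENNReal.ofReal ⁻¹' {c} := by
      filter_upwards [ae_expDens_pos r, measure_eq_zero_iff_ae_notMem.1 h1] with x hx hx1 hx2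
      apply hx1
      rw [← (hx2 : ENNReal.ofReal x = c), ENNReal.toReal_ofReal hx.le]
      rfl
    rw [measure_eq_zero_iff_ae_notMem.2 h2, mul_zero]

/-- Independent times, one of which is exponential, are almost surely different. -/
lemma ae_ne_of_indepFun {Ω : Type*} [MeasurableSpace Ω] {P : Measure Ω} [IsProbabilityMeasure P]
    {S T : Ω → ℝ≥0∞} (hS : Measurable S) (hT : Measurable T) (hind : IndepFun S T P)
    {r : ℝ} (hlaw : P.map T = expLaw r) : ∀ᵐ ω ∂P, S ω = T ω → T ω = ⊤ := by
  have hprod := (indepFun_iff_map_prod_eq_prod_map_map hS.aemeasurable hT.aemeasurable).1 hind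
  set D : Set (ℝ≥0∞ × ℝ≥0∞) := {z | z.1 = z.2 ∧ z.2 ≠ ⊤}
  have hD : MeasurableSet D := (measurableSet_eq_fun measurable_fst measurable_snd).inter
    (measurable_snd (measurableSet_singleton ⊤).compl)
  have hsf : IsProbabilityMeasure (P.map T) := Measure.isProbabilityMeasure_map hT.aemeasurable
  have h0 : P.map (fun ω => (S ω, T ω)) D = 0 := by
    rw [hprod, Measure.prod_apply hD, lintegral_eq_zero_of_ae_eq_zero]
    refine ae_of_all _ fun c => ?_
    simp only [Pi.zero_apply]
    by_cases hc : c = ⊤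
    · have : Prod.mk c ⁻¹' D = ∅ := by
        ext x; simp [D, hc]; intro h; exact h.symm
      rw [this]; simp
    · rw [hlaw]
      refine measure_mono_null ?_ (expLaw_singleton r hc)
      intro x hx
      exact hx.1.symm
  rw [Measure.map_apply (hS.prodMk hT) hD] at h0
  rw [ae_iff]
  refine measure_mono_null ?_ h0
  intro ω hω
  simp only [Set.mem_ofPred_eq, Classical.not_imp] at hω
  exact ⟨hω.1, hω.2⟩

lemma activeQueues_cases {p : Side → ℕ} (hp : p .bid < p .ask) (i : Side) {x : Side × ℕ}
    (hx : x ∈ activeQueues p) : x = (i, p i) ∨ x = (i.opp, p i.opp) ∨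
      (p .bid < x.2 ∧ x.2 < p .ask) := by
  obtain ⟨s, l⟩ := x
  by_cases hl : l = p s
  · subst hl
    cases s <;> cases i <;> simp [Side.opp]
  · right; right
    cases s <;> simp [activeQueues] at hx hl ⊢ <;> omega

/-- The rational version of the time of the event `x`. -/
def clock {Ω : Type*} (p : Side → ℕ) (Z : Side → ℕ → ℝ≥0 → Ω → ℕ) (x : Side × ℕ) (ω : Ω) :
    ℝ≥0∞ := hitTimeRat (eventSet p x) (fun t => Z x.1 x.2 t ω)

/-- The time of the first event other than the execution of the order. -/
def rivalTime {Ω : Type*} (p : Side → ℕ) (i : Side) (Z : Side → ℕ → ℝ≥0 → Ω → ℕ) (ω : Ω) :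
    ℝ≥0∞ := ⨅ (x : activeQueues p) (_ : x.1 ≠ (i, p i)), clock p Z x.1 ω

section Book

variable {Ω 𝒳 : Type*} [MeasurableSpace Ω] {P : Measure Ω} {X : ℕ → 𝒳}
    {lam : Side → ℕ → 𝒳 → ℝ≥0} {mu phi : ℕ → 𝒳 → ℝ≥0}
    {N : ℕ} {p q₀ : Side → ℕ} {i : Side} {Z : Side → ℕ → ℝ≥0 → Ω → ℕ} {Q : ℝ≥0 → Ω → ℕ → ℤ}

namespace IsTaggedBook

lemma measurable_queue (hbook : IsTaggedBook P X lam mu phi N p q₀ i Z Q) (hp : p .bid < p .ask)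
    {x : Side × ℕ} (hx : x ∈ activeQueues p) (t : ℝ≥0) : Measurable (Z x.1 x.2 t) := by
  rcases activeQueues_cases hp i hx with rfl | rfl | ⟨h1, h2⟩
  · exact hbook.position.measurable t
  · exact hbook.opposite.measurable t
  · exact (hbook.inside x.1 x.2 h1 h2).measurable t

lemma measurable_clock (hbook : IsTaggedBook P X lam mu phi N p q₀ i Z Q) (hp : p .bid < p .ask)
    {x : Side × ℕ} (hx : x ∈ activeQueues p) : Measurable (clock p Z x) :=
  (measurable_hitTimeRat _).comp (measurable_pi_iff.2 fun t => hbook.measurable_queue hp hx t)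

lemma ae_rightConst [IsProbabilityMeasure P] (hbook : IsTaggedBook P X lam mu phi N p q₀ i Z Q)
    (hp : p .bid < p .ask) :
    ∀ᵐ ω ∂P, ∀ x ∈ activeQueues p, RightConst (fun t => Z x.1 x.2 t ω) := by
  have : ∀ᵐ ω ∂P, ∀ x : activeQueues p, RightConst (fun t => Z x.1.1 x.1.2 t ω) := by
    refine ae_all_iff.2 fun x => ?_
    rcases activeQueues_cases hp i x.2 with h | h | ⟨h1, h2⟩
    · rw [h]; exact hbook.position.ae_rightConst
    · rw [h]; exact hbook.opposite.ae_rightConst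
    · exact (hbook.inside x.1.1 x.1.2 h1 h2).ae_rightConst
  filter_upwards [this] with ω hω x hx using hω ⟨x, hx⟩

/-- Each clock is a measurable function of the whole path of its process, thanks to the rational
hitting times. -/
lemma iIndepFun_clock (hbook : IsTaggedBook P X lam mu phi N p q₀ i Z Q) :
    iIndepFun (fun (x : activeQueues p) => clock p Z x.1) P :=
  hbook.indep.comp (fun x => hitTimeRat (eventSet p x.1)) fun _ => measurable_hitTimeRat _

lemma measure_lt_clock [IsProbabilityMeasure P] (hbook : IsTaggedBook P X lam mu phi N p q₀ i Z Q)
    (s : Side) {l : ℕ} (h1 : p .bid < l) (h2 : l < p .ask) (t : ℝ≥0) :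
    P {ω | (t : ℝ≥0∞) < clock p Z (s, l) ω} =
      ENNReal.ofReal (Real.exp (-(lam s 0 (X l) * t))) := by
  have h := hbook.inside s l h1 h2
  rw [← h.measure_lt_hitTime t]
  refine measure_congr ?_
  filter_upwards [h.ae_rightConst] with ω hω
  have : clock p Z (s, l) ω = hitTime {0}ᶜ (fun u => Z s l u ω) := by
    rw [← hω.hitTimeRat_eq]
    simp [clock, eventSet, BookPath.ne_of_inside (p := p) (s := s) h1 h2]
  refine propext ?_
  change (t : ℝ≥0∞) < clock p Z (s, l) ω ↔ (t : ℝ≥0∞) < hitTime {0}ᶜ (fun u => Z s l u ω)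
  rw [this]

/-- Among the rivals only the opposite best queue lies outside the spread, so of two distinct rivals
at least one is a first Poisson arrival. Its law has no finite atom, and independence excludes a
finite tie. -/
lemma ae_noTie [IsProbabilityMeasure P] (hbook : IsTaggedBook P X lam mu phi N p q₀ i Z Q)
    (hp : p .bid < p .ask) :
    ∀ᵐ ω ∂P, ∀ x ∈ activeQueues p, ∀ y ∈ activeQueues p, x ≠ (i, p i) → y ≠ (i, p i) → x ≠ y →
      clock p Z x ω = clock p Z y ω → clock p Z x ω = ⊤ := by
  have key : ∀ x y : activeQueues p, x ≠ y → (p .bid < y.1.2 ∧ y.1.2 < p .ask) →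
      ∀ᵐ ω ∂P, clock p Z x.1 ω = clock p Z y.1 ω → clock p Z y.1 ω = ⊤ := by
    intro x y hxy hy
    have hind := hbook.iIndepFun_clock.indepFun hxy
    exact ae_ne_of_indepFun (hbook.measurable_clock hp x.2) (hbook.measurable_clock hp y.2) hind
      (map_eq_expLaw (hbook.measurable_clock hp y.2)
        fun t => hbook.measure_lt_clock y.1.1 hy.1 hy.2 t)
  have key' : ∀ᵐ ω ∂P, ∀ x y : activeQueues p, x ≠ y → (p .bid < y.1.2 ∧ y.1.2 < p .ask) →
      clock p Z x.1 ω = clock p Z y.1 ω → clock p Z y.1 ω = ⊤ := by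
    refine ae_all_iff.2 fun x => ae_all_iff.2 fun y => ?_
    by_cases h : x ≠ y ∧ (p .bid < y.1.2 ∧ y.1.2 < p .ask)
    · filter_upwards [key x y h.1 h.2] with ω hω _ _ using hω
    · exact ae_of_all _ fun ω h1 h2 => absurd ⟨h1, h2⟩ h
  filter_upwards [key'] with ω hω x hx y hy hxi hyi hxy heq
  rcases activeQueues_cases hp i hy with h | h | h
  · exact absurd h hyi
  · rcases activeQueues_cases hp i hx with h' | h' | h'
    · exact absurd h' hxi
    · exact absurd (h'.trans h.symm) hxy
    · exact hω ⟨y, hy⟩ ⟨x, hx⟩ (fun he => hxy (congrArg Subtype.val he).symm) h' heq.symm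
  · rw [heq]
    exact hω ⟨x, hx⟩ ⟨y, hy⟩ (fun he => hxy (congrArg Subtype.val he)) h heq

lemma ae_firstPassage_eq [IsProbabilityMeasure P] (hbook : IsTaggedBook P X lam mu phi N p q₀ i Z Q)
    (hp : p .bid < p .ask) (s : Side) :
    ∀ᵐ ω ∂P, firstPassage (Z s (p s)) ω = clock p Z (s, p s) ω := by
  filter_upwards [hbook.ae_rightConst hp] with ω hω
  rw [clock, (hω _ (BookPath.mem_best hp s)).hitTimeRat_eq, firstPassage_eq_hitTime]
  simp [eventSet]

lemma fillEvent_ae_eq [IsProbabilityMeasure P] (hbook : IsTaggedBook P X lam mu phi N p q₀ i Z Q)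
    (hb : 1 ≤ p .bid) (ha : p .ask ≤ N) (hp : p .bid < p .ask) :
    fillEvent N p i Z Q =ᵐ[P]
      {ω | clock p Z (i, p i) ω ≠ ⊤ ∧ clock p Z (i, p i) ω ≤ rivalTime p i Z ω} := by
  filter_upwards [hbook.ae_rightConst hp, hbook.ae_noTie hp, hbook.ae_firstPassage_eq hp i,
    hbook.init, hbook.rightCont, hbook.uncrossed, hbook.follow] with ω hrc hnt hfp hin hr hu hf
  have hclock : ∀ x ∈ activeQueues p,
      clock p Z x ω = hitTime (eventSet p x) (fun t => Z x.1 x.2 t ω) := fun x hx =>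
    (hrc x hx).hitTimeRat_eq _
  have hB : BookPath N p i (fun s l t => Z s l t ω) (fun t => Q t ω) := by
    refine ⟨hb, ha, hp, ?_, hr, hu, hf, hrc, ?_⟩
    · rw [midPrice, hin.1, hin.2.1, quoteMid]
    · intro x hx y hy hxi hyi hxy heq
      rw [← hclock x hx, ← hclock y hy] at heq
      rw [← hclock x hx]
      exact hnt x hx y hy hxi hyi hxy heq
  refine propext ?_
  change (firstPassage (Z i (p i)) ω ≠ ⊤ ∧ firstPassage (Z i (p i)) ω ≤ midMoveTime N Q ω) ↔
    (clock p Z (i, p i) ω ≠ ⊤ ∧ clock p Z (i, p i) ω ≤ rivalTime p i Z ω)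
  rw [hfp]
  refine and_congr_right fun _ => ?_
  have hiff := hB.fill_iff
  rw [← hclock _ (BookPath.mem_best hp i)] at hiff
  change clock p Z (i, p i) ω ≤ pathMoveTime N (fun t => Q t ω) ↔ _
  rw [hiff, rivalTime, le_iInf₂_iff]
  constructor
  · intro h x hx
    rw [hclock x.1 x.2]; exact h x.1 x.2 hx
  · intro h x hx hxi
    have := h ⟨x, hx⟩ hxi
    rwa [hclock x hx] at this

lemma measurable_rivalTime (hbook : IsTaggedBook P X lam mu phi N p q₀ i Z Q)
    (hp : p .bid < p .ask) : Measurable (rivalTime p i Z) :=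
  Measurable.iInf fun x => Measurable.iInf fun _ => hbook.measurable_clock hp x.2

lemma indepFun_rivalTime (hbook : IsTaggedBook P X lam mu phi N p q₀ i Z Q)
    (hp : p .bid < p .ask) : IndepFun (clock p Z (i, p i)) (rivalTime p i Z) P := by
  classical
  have := Fintype.ofFinite (activeQueues p)
  set xi : activeQueues p := ⟨(i, p i), BookPath.mem_best hp i⟩
  have h := hbook.iIndepFun_clock.indepFun_finset {xi} (Finset.univ.erase xi) (by simp)
    fun x => hbook.measurable_clock hp x.2
  have hφ : Measurable fun v : ({xi} : Finset (activeQueues p)) → ℝ≥0∞ =>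
      v ⟨xi, Finset.mem_singleton_self xi⟩ := measurable_pi_apply _
  have hψ : Measurable fun v : (Finset.univ.erase xi) → ℝ≥0∞ => ⨅ x, v x :=
    Measurable.iInf fun x => measurable_pi_apply x
  have h2 := h.comp hφ hψ
  have e : rivalTime p i Z = (fun v : (Finset.univ.erase xi) → ℝ≥0∞ => ⨅ x, v x) ∘
      fun ω x => clock p Z x.1.1 ω := by
    ext ω
    simp only [rivalTime, Function.comp]
    apply le_antisymm
    · refine le_iInf fun x => ?_
      exact iInf₂_le x.1 fun he => (Finset.mem_erase.1 x.2).1 (Subtype.ext he)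
    · refine le_iInf₂ fun x hx => ?_
      exact iInf_le (fun y : (Finset.univ.erase xi) => clock p Z y.1.1 ω)
        ⟨x, Finset.mem_erase.2 ⟨fun he => hx (congrArg Subtype.val he), Finset.mem_univ _⟩⟩
  rw [e]
  exact h2

lemma measure_lt_rivalTime [IsProbabilityMeasure P]
    (hbook : IsTaggedBook P X lam mu phi N p q₀ i Z Q)
    (hp : p .bid < p .ask) (t : ℝ≥0) :
    P {ω | (t : ℝ≥0∞) < rivalTime p i Z ω} =
      P {ω | (t : ℝ≥0∞) < clock p Z (i.opp, p i.opp) ω} * ENNReal.ofReal (Real.exp (-((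
        ∑ l ∈ Finset.Ioo (p .bid) (p .ask), (lam .ask 0 (X l) : ℝ) +
        ∑ l ∈ Finset.Ioo (p .bid) (p .ask), (lam .bid 0 (X l) : ℝ)) * t))) := by
  classical
  have := Fintype.ofFinite (activeQueues p)
  set xi : activeQueues p := ⟨(i, p i), BookPath.mem_best hp i⟩
  have e1 : {ω | (t : ℝ≥0∞) < rivalTime p i Z ω} =
      ⋂ x ∈ Finset.univ.erase xi, clock p Z x.1 ⁻¹' Set.Ioi (t : ℝ≥0∞) := by
    ext ω
    simp only [Set.mem_iInter, Set.mem_ofPred_eq, Set.mem_preimage, Set.mem_Ioi]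
    constructor
    · intro h x hx
      exact h.trans_le (iInf₂_le x fun he => (Finset.mem_erase.1 hx).1 (Subtype.ext he))
    · intro h
      -- The infimum over a nonempty finite set is attained, so the strict inequality survives it.
      -- The opposite best queue is always a rival.
      have hne : (Finset.univ.erase xi).Nonempty := by
        refine ⟨⟨(i.opp, p i.opp), BookPath.mem_best hp _⟩, Finset.mem_erase.2 ⟨fun he => ?_,
          Finset.mem_univ _⟩⟩
        exact i.opp_ne (congrArg (fun x : activeQueues p => x.1.1) he)
      obtain ⟨x, hx, hmin⟩ := Finset.exists_min_image _ (fun x => clock p Z x.1 ω) hne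
      refine (h x hx).trans_le (le_iInf₂ fun y hy => hmin y ?_)
      exact Finset.mem_erase.2 ⟨fun he => hy (congrArg Subtype.val he), Finset.mem_univ _⟩
  rw [e1, hbook.iIndepFun_clock.measure_inter_preimage_eq_mul (Finset.univ.erase xi)
    (sets := fun _ => Set.Ioi (t : ℝ≥0∞)) fun x _ => measurableSet_Ioi]
  -- The rivals are the opposite best queue and the sell and buy queues inside the spread. The
  -- product of their tails splits accordingly, and the exponential rates add up.
  have e2 : (Finset.univ.erase xi).map (Function.Embedding.subtype _) =
      insert (i.opp, p i.opp)
        ((Finset.Ioo (p .bid) (p .ask)).image (fun l => (Side.ask, l)) ∪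
          (Finset.Ioo (p .bid) (p .ask)).image (fun l => (Side.bid, l))) := by
    ext x
    simp only [Finset.mem_map, Finset.mem_erase, Finset.mem_univ, and_true,
      Function.Embedding.coe_subtype, Finset.mem_insert, Finset.mem_union, Finset.mem_image,
      Finset.mem_Ioo]
    constructor
    · rintro ⟨y, hy, rfl⟩
      rcases activeQueues_cases hp i y.2 with h | h | h
      · exact absurd (Subtype.ext h) hy
      · exact Or.inl h
      · right
        obtain ⟨⟨s, l⟩, hyy⟩ := y
        cases s
        · exact Or.inl ⟨l, h, rfl⟩
        · exact Or.inr ⟨l, h, rfl⟩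
    · rintro (rfl | ⟨l, hl, rfl⟩ | ⟨l, hl, rfl⟩)
      · exact ⟨⟨_, BookPath.mem_best hp i.opp⟩, fun he =>
          i.opp_ne (congrArg (fun x : activeQueues p => x.1.1) he), rfl⟩
      · exact ⟨⟨_, BookPath.mem_inside _ hl.1 hl.2⟩, fun he =>
          BookPath.ne_of_inside (s := i) hl.1 hl.2
            (congrArg (fun x : activeQueues p => x.1.2) he), rfl⟩
      · exact ⟨⟨_, BookPath.mem_inside _ hl.1 hl.2⟩, fun he =>
          BookPath.ne_of_inside (s := i) hl.1 hl.2
            (congrArg (fun x : activeQueues p => x.1.2) he), rfl⟩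
  have e3 : ∏ x ∈ Finset.univ.erase xi, P (clock p Z x.1 ⁻¹' Set.Ioi (t : ℝ≥0∞)) =
      ∏ x ∈ (Finset.univ.erase xi).map (Function.Embedding.subtype _),
        P {ω | (t : ℝ≥0∞) < clock p Z x ω} := by
    rw [Finset.prod_map]; rfl
  have hside : ∀ s, ∏ x ∈ (Finset.Ioo (p .bid) (p .ask)).image (fun l => (s, l)),
      P {ω | (t : ℝ≥0∞) < clock p Z x ω} =
      ENNReal.ofReal (Real.exp (-((∑ l ∈ Finset.Ioo (p .bid) (p .ask),
        (lam s 0 (X l) : ℝ)) * t))) := by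
    intro s
    rw [Finset.prod_image (by intro a _ b _ h; exact congrArg Prod.snd h), Finset.sum_mul,
      ← Finset.sum_neg_distrib, Real.exp_sum,
      ENNReal.ofReal_prod_of_nonneg fun _ _ => (Real.exp_pos _).le]
    refine Finset.prod_congr rfl fun l hl => ?_
    obtain ⟨h1, h2⟩ := Finset.mem_Ioo.1 hl
    exact hbook.measure_lt_clock s h1 h2 t
  rw [e3, e2, Finset.prod_insert, Finset.prod_union, hside, hside,
    ← ENNReal.ofReal_mul (Real.exp_pos _).le, ← Real.exp_add]
  · congr 3; ring
  · rw [Finset.disjoint_left]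
    intro x hx hx'
    obtain ⟨l, -, rfl⟩ := Finset.mem_image.1 hx
    obtain ⟨l', -, h⟩ := Finset.mem_image.1 hx'
    exact absurd (congrArg Prod.fst h) (by simp)
  · intro h
    rcases Finset.mem_union.1 h with h | h
    · obtain ⟨l, hl, h⟩ := Finset.mem_image.1 h
      obtain ⟨h1, h2⟩ := Finset.mem_Ioo.1 hl
      exact BookPath.ne_of_inside (s := i.opp) h1 h2 (congrArg Prod.snd h)
    · obtain ⟨l, hl, h⟩ := Finset.mem_image.1 h
      obtain ⟨h1, h2⟩ := Finset.mem_Ioo.1 hl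
      exact BookPath.ne_of_inside (s := i.opp) h1 h2 (congrArg Prod.snd h)

end IsTaggedBook

end Book

lemma sum_Ioo_eq_ask (f : ℕ → ℝ) (b s₀ : ℕ) :
    ∑ l ∈ Finset.Ioo b (b + s₀), f l = ∑ m ∈ Finset.Icc 1 (s₀ - 1), f (b + s₀ - m) := by
  refine Finset.sum_nbij' (fun l => b + s₀ - l) (fun m => b + s₀ - m) ?_ ?_ ?_ ?_ ?_
  · intro l hl; simp only [Finset.mem_Ioo, Finset.mem_Icc] at *; omega
  · intro l hl; simp only [Finset.mem_Ioo, Finset.mem_Icc] at *; omega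
  · intro l hl; simp only [Finset.mem_Ioo] at *; omega
  · intro l hl; simp only [Finset.mem_Icc] at *; omega
  · intro l hl
    simp only [Finset.mem_Ioo] at hl
    congr 1; omega

lemma sum_Ioo_eq_bid (f : ℕ → ℝ) (b s₀ : ℕ) :
    ∑ l ∈ Finset.Ioo b (b + s₀), f l = ∑ m ∈ Finset.Icc 1 (s₀ - 1), f (b + m) := by
  refine Finset.sum_nbij' (fun l => l - b) (fun m => b + m) ?_ ?_ ?_ ?_ ?_
  · intro l hl; simp only [Finset.mem_Ioo, Finset.mem_Icc] at *; omega
  · intro l hl; simp only [Finset.mem_Ioo, Finset.mem_Icc] at *; omega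
  · intro l hl; simp only [Finset.mem_Ioo] at *; omega
  · intro l hl; simp only [Finset.mem_Icc] at *; omega
  · intro l hl
    simp only [Finset.mem_Ioo] at hl
    congr 1; omega

end

noncomputable section

/-! ### Inversion of the transform of a distribution function -/

open FourierTransform in
/-- The Bromwich integral of the transform of a function supported on a half-line. -/
lemma bromwich_inversion {G : ℝ → ℝ} {γ : ℝ} {L : ℂ → ℂ} (hG : Continuous G)
    (hint : Integrable fun t : ℝ => Complex.exp (-(γ : ℂ) * t) * (G t : ℂ))
    (hL : ∀ u : ℝ, ∫ t : ℝ, Complex.exp (-(γ + u * Complex.I) * t) * (G t : ℂ) =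
      L (γ + u * Complex.I))
    (hLint : Integrable fun u : ℝ => L (γ + u * Complex.I)) (t : ℝ) :
    (G t : ℂ) = (2 * Real.pi : ℂ)⁻¹ *
      ∫ u : ℝ, Complex.exp ((γ + u * Complex.I) * t) * L (γ + u * Complex.I) := by
  set f : ℝ → ℂ := fun t => Complex.exp (-(γ : ℂ) * t) * (G t : ℂ)
  have hπ : (2 * Real.pi) ≠ 0 := by positivity
  -- The Fourier kernel is `exp (-2πi v w)`, so frequency `w` corresponds to the point `γ + 2πw i`
  -- of the contour; substituting `u = 2πw` later produces the prefactor `(2π)⁻¹`.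
  have hF : 𝓕 f = fun w => L (γ + ((2 * Real.pi * w : ℝ) : ℂ) * Complex.I) := by
    ext w
    rw [Real.fourier_real_eq_integral_exp_smul, ← hL]
    refine integral_congr_ae (ae_of_all _ fun v => ?_)
    simp only [f, smul_eq_mul]
    rw [← mul_assoc, ← Complex.exp_add]
    congr 2; push_cast; ring
  have hFint : Integrable (𝓕 f) := by
    rw [hF]
    exact (integrable_comp_mul_left_iff (fun u : ℝ => L (γ + u * Complex.I)) hπ).2 hLint
  have hfc : Continuous f := by fun_prop
  have h := congrFun (hfc.fourierInv_fourier_eq hint hFint) t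
  rw [Real.fourierInv_eq', hF] at h
  have h2 := Measure.integral_comp_mul_left
    (fun u : ℝ => Complex.exp (u * Complex.I * t) * L (γ + u * Complex.I)) (2 * Real.pi)
  have h3 : ∫ v : ℝ, Complex.exp (((2 * Real.pi * inner ℝ v t : ℝ) : ℂ) * Complex.I) •
      L (γ + ((2 * Real.pi * v : ℝ) : ℂ) * Complex.I) =
      ∫ v : ℝ, Complex.exp (((2 * Real.pi * v : ℝ) : ℂ) * Complex.I * t) *
        L (γ + ((2 * Real.pi * v : ℝ) : ℂ) * Complex.I) := by
    refine integral_congr_ae (ae_of_all _ fun v => ?_)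
    simp only [smul_eq_mul, RCLike.inner_apply, conj_trivial]
    congr 2
    simp
    ring
  rw [h3, h2, abs_of_pos (by positivity), Complex.real_smul] at h
  have h4 : (G t : ℂ) = Complex.exp ((γ : ℂ) * t) * f t := by
    simp only [f]
    rw [← mul_assoc, ← Complex.exp_add]; simp
  rw [h4, ← h, mul_left_comm, ← integral_const_mul]
  push_cast
  congr 1
  refine integral_congr_ae (ae_of_all _ fun u => ?_)
  simp only
  rw [← mul_assoc, ← Complex.exp_add]
  congr 2; ring

lemma ae_pos_of_absolutelyContinuous {ρ : Measure ℝ} (hρ : ρ ≪ volume.restrict (Set.Ioi 0)) :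
    ∀ᵐ x ∂ρ, 0 < x := hρ.ae_le (ae_restrict_mem measurableSet_Ioi)

/-- Absolute continuity excludes atoms. Continuity is what makes Fourier inversion hold at every
point and not only almost everywhere. -/
lemma continuous_real_Iic {ρ : Measure ℝ} [IsFiniteMeasure ρ]
    (hρ : ρ ≪ volume.restrict (Set.Ioi 0)) : Continuous fun t => ρ.real (Set.Iic t) := by
  have : NullSingletonClass ρ := ⟨fun x => hρ (by simp)⟩
  have h := intervalIntegral.continuous_primitive (μ := ρ) (f := fun _ => (1 : ℝ))
    (fun a b => intervalIntegrable_const) 0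
  have e : (fun t => ρ.real (Set.Iic t)) =
      fun t => ρ.real (Set.Iic 0) + ∫ _ in (0 : ℝ)..t, 1 ∂ρ := by
    ext t
    rw [← intervalIntegral.integral_Iic_sub_Iic (integrable_const _) (integrable_const _)]
    simp
  rw [e]
  exact continuous_const.add h

/-- The transform of the distribution function. -/
lemma laplace_real_Iic {ρ : Measure ℝ} [IsFiniteMeasure ρ]
    (hρ : ρ ≪ volume.restrict (Set.Ioi 0)) {s : ℂ} (hs : 0 < s.re) :
    Integrable (fun t : ℝ => Complex.exp (-s * t) * (ρ.real (Set.Iic t) : ℂ)) ∧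
      ∫ t : ℝ, Complex.exp (-s * t) * (ρ.real (Set.Iic t) : ℂ) =
        1 / s * ∫ x, Complex.exp (-s * x) ∂ρ := by
  -- Fubini on the region `x ≤ t`: the integral over `x` gives the distribution function, that over
  -- `t` gives `exp (-s x) / s`.
  set F : ℝ → ℝ → ℂ := fun x t => (Set.Ici x).indicator (fun t : ℝ => Complex.exp (-s * t)) t
  have hre : (-s).re < 0 := by simpa using hs
  have hmeas : Measurable (Function.uncurry F) := by
    have : Function.uncurry F =
        Set.indicator {z : ℝ × ℝ | z.1 ≤ z.2} (fun z => Complex.exp (-s * z.2)) := by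
      ext z; simp [F, Set.indicator_apply, Function.uncurry]
    rw [this]
    exact Measurable.indicator (by fun_prop) (measurableSet_le measurable_fst measurable_snd)
  have hsec : ∀ x, Integrable (F x) := by
    intro x
    rw [integrable_indicator_iff measurableSet_Ici, integrableOn_Ici_iff_integrableOn_Ioi]
    exact integrableOn_exp_mul_complex_Ioi hre x
  have hnorm : ∀ x, ∫ t, ‖F x t‖ = Real.exp (-(s.re * x)) / s.re := by
    intro x
    have h1 : ∀ t, ‖F x t‖ = (Set.Ici x).indicator (fun t : ℝ => Real.exp (-s.re * t)) t := by
      intro t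
      simp only [F, norm_indicator_eq_indicator_norm, norm_cexp_neg_mul]
      simp only [neg_mul]
    simp_rw [h1]
    rw [integral_indicator measurableSet_Ici, integral_Ici_eq_integral_Ioi,
      integral_exp_mul_Ioi (by linarith), neg_div_neg_eq, neg_mul]
  have hmemρ := ae_pos_of_absolutelyContinuous hρ
  have hexp : Integrable (fun x => Real.exp (-(s.re * x)) / s.re) ρ := by
    refine Integrable.div_const ?_ _
    refine Integrable.of_bound (by fun_prop) 1 ?_
    filter_upwards [hmemρ] with x hx
    rw [Real.norm_of_nonneg (Real.exp_pos _).le, Real.exp_le_one_iff]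
    have := mul_pos hs hx
    linarith
  have hF : Integrable (Function.uncurry F) (ρ.prod volume) := by
    rw [integrable_prod_iff hmeas.aestronglyMeasurable]
    refine ⟨ae_of_all _ hsec, ?_⟩
    simp only [Function.uncurry_apply_pair, hnorm]
    exact hexp
  have hin : ∀ t : ℝ, ∫ x, F x t ∂ρ = Complex.exp (-s * t) * (ρ.real (Set.Iic t) : ℂ) := by
    intro t
    have h1 : ∀ x, F x t = (Set.Iic t).indicator (fun _ => Complex.exp (-s * t)) x := by
      intro x; simp [F, Set.indicator_apply]
    simp_rw [h1]
    rw [integral_indicator_const _ measurableSet_Iic, Complex.real_smul, mul_comm]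
  have hout : ∀ x, ∫ t, F x t = 1 / s * Complex.exp (-s * x) := by
    intro x
    simp only [F]
    rw [integral_indicator measurableSet_Ici, integral_Ici_eq_integral_Ioi,
      integral_exp_mul_complex_Ioi hre, neg_div_neg_eq]
    ring
  constructor
  · have := hF.integral_prod_right
    simpa [hin] using this
  · simp_rw [← hin]
    rw [← integral_integral_swap hF]
    simp_rw [hout]
    rw [integral_const_mul]

/-- The transform of the tail of a law with exponential moments. -/
lemma laplace_real_Ioi {ν : Measure ℝ} [IsFiniteMeasure ν] (hν : ∀ᵐ x ∂ν, 0 ≤ x) {s : ℂ}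
    (hs : s.re ≠ 0) (hi : Integrable (fun x : ℝ => Complex.exp (-s * x)) ν) :
    ∫ t in Set.Ioi (0 : ℝ), Complex.exp (-s * t) * (ν.real (Set.Ioi t) : ℂ) =
      1 / s * (ν.real Set.univ - ∫ x, Complex.exp (-s * x) ∂ν) := by
  have hs0 : s ≠ 0 := fun h => hs (by simp [h])
  -- Fubini on `0 < t < x`. The sections in `t` are bounded intervals, so either sign of `Re s` is
  -- allowed; integrability in `x` is the exponential moment `hi`.
  set F : ℝ → ℝ → ℂ := fun x t => (Set.Ioo 0 x).indicator (fun t : ℝ => Complex.exp (-s * t)) t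
  have hmeas : Measurable (Function.uncurry F) := by
    have : Function.uncurry F =
        Set.indicator {z : ℝ × ℝ | 0 < z.2 ∧ z.2 < z.1} (fun z => Complex.exp (-s * z.2)) := by
      ext z; simp [F, Set.indicator_apply, Function.uncurry]
    rw [this]
    exact Measurable.indicator (by fun_prop)
      ((measurableSet_lt measurable_const measurable_snd).inter (measurableSet_lt measurable_snd measurable_fst))
  have hsec : ∀ x, Integrable (F x) := by
    intro x
    rw [integrable_indicator_iff measurableSet_Ioo]
    have hc : Continuous fun t : ℝ => Complex.exp (-s * t) := by fun_prop
    exact (hc.integrableOn_Icc (a := 0) (b := x)).mono_set Set.Ioo_subset_Icc_self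
  have hnorm : ∀ x, 0 ≤ x → ∫ t, ‖F x t‖ = (Real.exp (-(s.re * x)) - 1) / (-s.re) := by
    intro x hx
    have h1 : ∀ t, ‖F x t‖ = (Set.Ioo 0 x).indicator (fun t : ℝ => Real.exp (-s.re * t)) t := by
      intro t
      simp only [F, norm_indicator_eq_indicator_norm, norm_cexp_neg_mul]
      simp only [neg_mul]
    simp_rw [h1]
    have h2 : (-s.re) ≠ 0 := neg_ne_zero.2 hs
    rw [integral_indicator measurableSet_Ioo, ← integral_Ioc_eq_integral_Ioo,
      ← intervalIntegral.integral_of_le hx,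
      intervalIntegral.integral_comp_mul_left (fun t => Real.exp t) h2, integral_exp]
    simp [div_eq_inv_mul]
  have hexp : Integrable (fun x => (Real.exp (-(s.re * x)) - 1) / (-s.re)) ν := by
    refine Integrable.div_const (Integrable.sub ?_ (integrable_const _)) _
    refine hi.norm.congr (ae_of_all _ fun x => ?_)
    exact norm_cexp_neg_mul s x
  have hF : Integrable (Function.uncurry F) (ν.prod volume) := by
    rw [integrable_prod_iff hmeas.aestronglyMeasurable]
    refine ⟨ae_of_all _ hsec, hexp.congr ?_⟩
    filter_upwards [hν] with x hx
    exact (hnorm x hx).symm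
  have hin : ∀ t : ℝ, ∫ x, F x t ∂ν =
      (Set.Ioi 0).indicator (fun t : ℝ => Complex.exp (-s * t) * (ν.real (Set.Ioi t) : ℂ)) t := by
    intro t
    by_cases ht : 0 < t
    · have h1 : ∀ x, F x t = (Set.Ioi t).indicator (fun _ => Complex.exp (-s * t)) x := by
        intro x; simp [F, Set.indicator_apply, ht]
      simp_rw [h1]
      rw [integral_indicator_const _ measurableSet_Ioi, Complex.real_smul, mul_comm,
        Set.indicator_of_mem (Set.mem_Ioi.2 ht)]
    · simp [F, Set.indicator_apply, ht]
  have hout : ∀ x, 0 ≤ x → ∫ t, F x t = 1 / s * (1 - Complex.exp (-s * x)) := by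
    intro x hx
    simp only [F]
    rw [integral_indicator measurableSet_Ioo, ← integral_Ioc_eq_integral_Ioo,
      ← intervalIntegral.integral_of_le hx, integral_exp_mul_complex (neg_ne_zero.2 hs0)]
    field_simp
    simp
  rw [← integral_indicator measurableSet_Ioi]
  simp_rw [← hin]
  rw [← integral_integral_swap hF]
  have : ∫ x, ∫ t, F x t ∂volume ∂ν = ∫ x, 1 / s * (1 - Complex.exp (-s * x)) ∂ν := by
    refine integral_congr_ae ?_
    filter_upwards [hν] with x hx using hout x hx
  rw [this, integral_const_mul, integral_sub (integrable_const _) hi]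
  simp

/-- Exponential moments in terms of the tail. -/
lemma lintegral_exp_sub_one {ν : Measure ℝ} (hν : ∀ᵐ x ∂ν, 0 ≤ x) {γ : ℝ} (hγ : 0 < γ) :
    ∫⁻ x, ENNReal.ofReal (Real.exp (γ * x) - 1) ∂ν =
      ∫⁻ t in Set.Ioi 0, ν (Set.Ioi t) * ENNReal.ofReal (γ * Real.exp (γ * t)) := by
  have h := lintegral_comp_eq_lintegral_meas_lt_mul (f := fun x : ℝ => x)
    (g := fun t => γ * Real.exp (γ * t)) ν hν (by fun_prop)
    (fun t _ => (by fun_prop : Continuous fun t => γ * Real.exp (γ * t)).intervalIntegrable _ _)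
    (ae_of_all _ fun t => by positivity)
  have hi : ∀ x : ℝ, ∫ t in (0 : ℝ)..x, γ * Real.exp (γ * t) = Real.exp (γ * x) - 1 := by
    intro x
    rw [intervalIntegral.integral_const_mul,
      intervalIntegral.integral_comp_mul_left (fun t => Real.exp t) hγ.ne', integral_exp]
    simp [hγ.ne']
  simp_rw [hi] at h
  exact h

/-- A law on `[0, ∞)` has exponential moments iff its tail does. -/
lemma integrable_exp_of_tail {ν : Measure ℝ} [IsFiniteMeasure ν] (hν : ∀ᵐ x ∂ν, 0 ≤ x) {γ : ℝ}
    (hγ : 0 < γ)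
    (h : ∫⁻ t in Set.Ioi 0, ν (Set.Ioi t) * ENNReal.ofReal (γ * Real.exp (γ * t)) ≠ ⊤) :
    Integrable (fun x => Real.exp (γ * x)) ν := by
  rw [← lintegral_exp_sub_one hν hγ] at h
  have h1 : Integrable (fun x => Real.exp (γ * x) - 1) ν := by
    refine ⟨by fun_prop, ?_⟩
    rw [hasFiniteIntegral_iff_norm]
    refine lt_of_eq_of_lt (lintegral_congr_ae ?_) (lt_top_iff_ne_top.2 h)
    filter_upwards [hν] with x hx
    rw [Real.norm_of_nonneg]
    rw [sub_nonneg, Real.one_le_exp_iff]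
    positivity
  refine (h1.add (integrable_const 1)).congr (ae_of_all _ fun x => ?_)
  simp

/-- The probability that a random time with law `ρ` does not exceed an independent one with law `ν`,
as a Bromwich integral. -/
theorem integral_real_Iic_eq {ρ ν : Measure ℝ} [IsFiniteMeasure ρ] [IsFiniteMeasure ν]
    (hρ : ρ ≪ volume.restrict (Set.Ioi 0)) {γ : ℝ} (hγ : 0 < γ)
    (hν : Integrable (fun x => Real.exp (γ * x)) ν) {gHat : ℂ → ℂ}
    (hg : ∀ u : ℝ, ∫ x, Complex.exp (-(γ + u * Complex.I) * x) ∂ρ = gHat (γ + u * Complex.I))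
    (hgint : Integrable fun u : ℝ => 1 / ((γ : ℂ) + u * Complex.I) * gHat (γ + u * Complex.I)) :
    Integrable (fun u : ℝ => 1 / ((γ : ℂ) + u * Complex.I) * gHat (γ + u * Complex.I) *
        ∫ x : ℝ, Complex.exp ((γ + u * Complex.I) * x) ∂ν) ∧
      ((∫ x, ρ.real (Set.Iic x) ∂ν : ℝ) : ℂ) = (2 * Real.pi : ℂ)⁻¹ *
        ∫ u : ℝ, 1 / ((γ : ℂ) + u * Complex.I) * gHat (γ + u * Complex.I) *
          ∫ x : ℝ, Complex.exp ((γ + u * Complex.I) * x) ∂ν := by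
  have hre : ∀ u : ℝ, ((γ : ℂ) + u * Complex.I).re = γ := by intro u; simp
  have hinv : ∀ t, (ρ.real (Set.Iic t) : ℂ) = (2 * Real.pi : ℂ)⁻¹ *
      ∫ u : ℝ, Complex.exp ((γ + u * Complex.I) * t) *
        (1 / ((γ : ℂ) + u * Complex.I) * gHat (γ + u * Complex.I)) := by
    intro t
    refine bromwich_inversion (L := fun s => 1 / s * gHat s) (continuous_real_Iic hρ) ?_ ?_ hgint t
    · exact (laplace_real_Iic hρ (s := γ) (by simpa using hγ)).1
    · intro u
      rw [(laplace_real_Iic hρ (by rw [hre]; exact hγ)).2, hg]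
  set φ : ℝ → ℝ → ℂ := fun u x => 1 / ((γ : ℂ) + u * Complex.I) * gHat (γ + u * Complex.I) *
    Complex.exp ((γ + u * Complex.I) * x)
  have hφ : Integrable (Function.uncurry φ) (volume.prod ν) := by
    have h1 : Integrable (fun z : ℝ × ℝ => 1 / ((γ : ℂ) + z.1 * Complex.I) *
        gHat (γ + z.1 * Complex.I) * ((Real.exp (γ * z.2) : ℝ) : ℂ)) (volume.prod ν) :=
      hgint.mul_prod hν.ofReal
    -- On the contour, `exp (s x)` is `exp (γ x)` times a factor of modulus 1, so joint
    -- integrability follows from that of a product of two one-variable functions.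
    have h2 : Integrable (fun z : ℝ × ℝ => (1 / ((γ : ℂ) + z.1 * Complex.I) *
        gHat (γ + z.1 * Complex.I) * ((Real.exp (γ * z.2) : ℝ) : ℂ)) *
          Complex.exp (z.1 * z.2 * Complex.I)) (volume.prod ν) := by
      refine h1.mul_bdd (c := 1) (Continuous.aestronglyMeasurable (by fun_prop))
        (ae_of_all _ fun z => ?_)
      rw [← Complex.ofReal_mul, Complex.norm_exp_ofReal_mul_I]
    refine h2.congr (ae_of_all _ fun z => ?_)
    simp only [φ, Function.uncurry]
    rw [mul_assoc, Complex.ofReal_exp, ← Complex.exp_add]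
    congr 2; push_cast; ring
  have hin : ∀ u, ∫ x, φ u x ∂ν = 1 / ((γ : ℂ) + u * Complex.I) * gHat (γ + u * Complex.I) *
      ∫ x : ℝ, Complex.exp ((γ + u * Complex.I) * x) ∂ν := fun u => integral_const_mul _ _
  constructor
  · have := hφ.integral_prod_left
    simpa only [Function.uncurry, hin] using this
  · rw [← integral_complex_ofReal]
    simp_rw [hinv, ← hin]
    rw [integral_integral_swap hφ, integral_const_mul]
    congr 1
    refine integral_congr_ae (ae_of_all _ fun x => integral_congr_ae (ae_of_all _ fun u => ?_))
    simp only [φ]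
    ring

/-- One death factor is at most `ν 1 / |s|` and the others are at most 1 in modulus; together with
`1 / s` this gives decay `|s|⁻²`. A queue of size at least 1 provides that factor. -/
lemma integrable_deathTransform {ν : ℕ → ℝ≥0} {q : ℕ} (hq : 1 ≤ q) {γ : ℝ} (hγ : 0 < γ) :
    Integrable fun u : ℝ => 1 / ((γ : ℂ) + u * Complex.I) *
      deathTransform ν q (γ + u * Complex.I) := by
  -- The constant makes `1 + u ^ 2 ≤ max 1 (γ ^ 2)⁻¹ * (γ ^ 2 + u ^ 2)`, where `γ ^ 2 + u ^ 2 =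
  -- |s|²`.
  have hbase : Integrable fun u : ℝ => (ν 1 : ℝ) * (max 1 (γ ^ 2)⁻¹ * (1 + u ^ 2)⁻¹) :=
    (integrable_inv_one_add_sq.const_mul _).const_mul _
  refine hbase.mono' ?_ (ae_of_all _ fun u => ?_)
  · refine Measurable.aestronglyMeasurable ?_
    unfold deathTransform
    refine Measurable.mul (by fun_prop) ?_
    exact Finset.measurable_fun_prod _ fun k _ => by fun_prop
  · set s : ℂ := γ + u * Complex.I
    have hre : s.re = γ := by simp [s]
    have him : s.im = u := by simp [s]
    have hspos : 0 < ‖s‖ := by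
      rw [norm_pos_iff]; intro h; rw [h] at hre; simp at hre; linarith
    have hle : ∀ k, ‖s‖ ≤ ‖((ν k : ℝ) : ℂ) + s‖ := by
      intro k
      rw [← sq_le_sq₀ (norm_nonneg _) (norm_nonneg _), ← Complex.normSq_eq_norm_sq,
        ← Complex.normSq_eq_norm_sq]
      simp only [Complex.normSq_apply, Complex.add_re, Complex.add_im, Complex.ofReal_re,
        Complex.ofReal_im, hre, him]
      have := (ν k).coe_nonneg
      nlinarith
    have hfac : ∀ k, ‖((ν k : ℝ) : ℂ) / (((ν k : ℝ) : ℂ) + s)‖ ≤ 1 := by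
      intro k
      rw [norm_div, div_le_one (hspos.trans_le (hle k)), Complex.norm_real,
        Real.norm_of_nonneg (ν k).coe_nonneg]
      have := Complex.re_le_norm (((ν k : ℝ) : ℂ) + s)
      simp [hre] at this
      linarith
    have hprod : ‖deathTransform ν q s‖ ≤ (ν 1 : ℝ) / ‖s‖ := by
      have h1 : 1 ∈ Finset.Icc 1 q := Finset.mem_Icc.2 ⟨le_rfl, hq⟩
      rw [deathTransform, ← Finset.mul_prod_erase _ _ h1, norm_mul, norm_prod]
      have h2 : ‖((ν 1 : ℝ) : ℂ) / (((ν 1 : ℝ) : ℂ) + s)‖ ≤ (ν 1 : ℝ) / ‖s‖ := by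
        rw [norm_div, Complex.norm_real, Real.norm_of_nonneg (ν 1).coe_nonneg]
        exact div_le_div_of_nonneg_left (ν 1).coe_nonneg hspos (hle 1)
      have h3 : ∏ k ∈ (Finset.Icc 1 q).erase 1, ‖((ν k : ℝ) : ℂ) / (((ν k : ℝ) : ℂ) + s)‖ ≤ 1 :=
        Finset.prod_le_one (fun _ _ => norm_nonneg _) fun k _ => hfac k
      calc _ ≤ (ν 1 : ℝ) / ‖s‖ * 1 := mul_le_mul h2 h3
            (Finset.prod_nonneg fun _ _ => norm_nonneg _) (by positivity)
        _ = _ := mul_one _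
    have hsq : ‖s‖ ^ 2 = γ ^ 2 + u ^ 2 := by
      rw [← Complex.normSq_eq_norm_sq, Complex.normSq_apply, hre, him]; ring
    rw [norm_mul, norm_div, norm_one]
    calc 1 / ‖s‖ * ‖deathTransform ν q s‖ ≤ 1 / ‖s‖ * ((ν 1 : ℝ) / ‖s‖) := by gcongr
      _ = (ν 1 : ℝ) * (γ ^ 2 + u ^ 2)⁻¹ := by rw [← hsq]; field_simp
      _ ≤ _ := by
        refine mul_le_mul_of_nonneg_left ?_ (ν 1).coe_nonneg
        rw [inv_le_iff_one_le_mul₀ (by positivity)]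
        rw [show max 1 (γ ^ 2)⁻¹ * (1 + u ^ 2)⁻¹ * (γ ^ 2 + u ^ 2) =
          (max 1 (γ ^ 2)⁻¹ * (γ ^ 2 + u ^ 2)) / (1 + u ^ 2) by ring, le_div_iff₀ (by positivity)]
        have h1 : 1 ≤ max 1 (γ ^ 2)⁻¹ * γ ^ 2 := by
          calc 1 = (γ ^ 2)⁻¹ * γ ^ 2 := by field_simp
            _ ≤ _ := by gcongr; exact le_max_right _ _
        have h2 : u ^ 2 ≤ max 1 (γ ^ 2)⁻¹ * u ^ 2 :=
          le_mul_of_one_le_left (sq_nonneg _) (le_max_left _ _)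
        linarith

end

noncomputable section

/-! ### The minimum of a random time and an exponential time -/

/-- The transform of the tail `1 - ρ (-∞, t]` of a possibly defective law. -/
lemma laplace_one_sub_real_Iic {ρ : Measure ℝ} [IsFiniteMeasure ρ]
    (hρ : ρ ≪ volume.restrict (Set.Ioi 0)) {z : ℂ}
    (hz : 0 < z.re ∨ z.re < 0 ∧ ρ.real Set.univ = 1 ∧
      Integrable (fun x : ℝ => Complex.exp (-z * x)) ρ) :
    ∫ t in Set.Ioi (0 : ℝ), Complex.exp (-z * t) * ((1 - ρ.real (Set.Iic t) : ℝ) : ℂ) =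
      1 / z * (1 - ∫ x, Complex.exp (-z * x) ∂ρ) := by
  -- For `Re z > 0` the constant 1 and the distribution function can be transformed separately, even
  -- if the law is defective. For `Re z < 0` neither converges; full mass is needed to rewrite the
  -- integrand as a tail with exponential moments.
  rcases hz with hz | ⟨hz, h1, hi⟩
  · obtain ⟨hI, hE⟩ := laplace_real_Iic hρ hz
    have hre : (-z).re < 0 := by simpa using hz
    have h0 : ∫ t in Set.Ioi (0 : ℝ), Complex.exp (-z * t) * (ρ.real (Set.Iic t) : ℂ) =
        ∫ t : ℝ, Complex.exp (-z * t) * (ρ.real (Set.Iic t) : ℂ) := by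
      refine setIntegral_eq_integral_of_forall_compl_eq_zero fun t ht => ?_
      have : ρ (Set.Iic t) = 0 := by
        rw [measure_eq_zero_iff_ae_notMem]
        filter_upwards [ae_pos_of_absolutelyContinuous hρ] with x hx hxt
        exact ht (hx.trans_le hxt)
      simp [measureReal_def, this]
    have h2 := integral_exp_mul_complex_Ioi hre 0
    push_cast
    simp_rw [mul_sub, mul_one]
    rw [integral_sub (integrableOn_exp_mul_complex_Ioi hre 0) hI.integrableOn, h0, hE, h2]
    simp [neg_div_neg_eq]
  · have h := laplace_real_Ioi (ν := ρ)
      ((ae_pos_of_absolutelyContinuous hρ).mono fun _ h => h.le) hz.ne hi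
    rw [h1, Complex.ofReal_one] at h
    rw [← h]
    refine integral_congr_ae (ae_of_all _ fun t => ?_)
    have h2 : ρ.real (Set.Ioi t) = 1 - ρ.real (Set.Iic t) := by
      rw [← h1, ← Set.compl_Iic, measureReal_compl measurableSet_Iic]
    simp only [h2]

/-- Exponential moments and transform of the minimum, with law `ν`, of a random time with the
possibly defective law `ρ` and an independent exponential time of rate `c`. -/
theorem transform_of_tail {ρ ν : Measure ℝ} [IsFiniteMeasure ρ] [IsProbabilityMeasure ν]
    (hρ : ρ ≪ volume.restrict (Set.Ioi 0)) (hν : ∀ᵐ x ∂ν, 0 ≤ x) {c γ : ℝ} (hγ : 0 < γ)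
    (htail : ∀ t, 0 < t → ν.real (Set.Ioi t) = (1 - ρ.real (Set.Iic t)) * Real.exp (-(c * t)))
    (hc : γ < c ∨ c < γ ∧ ρ.real Set.univ = 1 ∧
      Integrable (fun x : ℝ => Complex.exp (-((c - γ : ℝ) : ℂ) * x)) ρ) :
    Integrable (fun x => Real.exp (γ * x)) ν ∧ ∀ s : ℂ, s.re = γ →
      ∫ x : ℝ, Complex.exp (s * x) ∂ν = (∫ x : ℝ, Complex.exp (-(c - s) * x) ∂ρ) +
        c / (c - s) * (1 - ∫ x : ℝ, Complex.exp (-(c - s) * x) ∂ρ) := by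
  have hint : Integrable (fun x => Real.exp (γ * x)) ν := by
    refine integrable_exp_of_tail hν hγ ?_
    rcases hc with hc | ⟨hc, h1, hi⟩
    -- Below the rate `c` the exponential factor of the tail suffices. Beyond it, the remaining
    -- growth `exp ((γ - c) t)` has to be absorbed by the tail of `ρ`, as in the other case.
    · have hle : ∫⁻ t in Set.Ioi 0, ν (Set.Ioi t) * ENNReal.ofReal (γ * Real.exp (γ * t)) ≤
          ∫⁻ t in Set.Ioi (0 : ℝ),
            ENNReal.ofReal γ * ENNReal.ofReal (Real.exp (-((c - γ) * t))) := by
        refine setLIntegral_mono' measurableSet_Ioi fun t ht => ?_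
        rw [← ofReal_measureReal, ← ENNReal.ofReal_mul measureReal_nonneg,
          ← ENNReal.ofReal_mul hγ.le]
        refine ENNReal.ofReal_le_ofReal ?_
        rw [htail t ht]
        have : (1 - ρ.real (Set.Iic t)) * Real.exp (-(c * t)) * (γ * Real.exp (γ * t)) =
            (1 - ρ.real (Set.Iic t)) * (γ * Real.exp (-((c - γ) * t))) := by
          rw [show -((c - γ) * t) = -(c * t) + γ * t by ring, Real.exp_add]; ring
        rw [this]
        refine mul_le_of_le_one_left (by positivity) ?_
        linarith [measureReal_nonneg (μ := ρ) (s := Set.Iic t)]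
      refine ne_top_of_le_ne_top ?_ hle
      rw [lintegral_const_mul _ (by fun_prop), lintegral_exp_Ioi (by linarith)]
      exact ENNReal.mul_ne_top ENNReal.ofReal_ne_top ENNReal.ofReal_ne_top
    · have hδ : 0 < γ - c := by linarith
      have hfin : ∫⁻ x, ENNReal.ofReal (Real.exp ((γ - c) * x) - 1) ∂ρ ≠ ⊤ := by
        have h := integrable_cexp_iff.1 hi
        refine ne_top_of_le_ne_top h.ne (lintegral_mono fun x => ENNReal.ofReal_le_ofReal ?_)
        rw [Complex.ofReal_re, show -((c - γ) * x) = (γ - c) * x by ring]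
        linarith
      rw [lintegral_exp_sub_one ((ae_pos_of_absolutelyContinuous hρ).mono fun _ h => h.le) hδ]
        at hfin
      have hle : ∫⁻ t in Set.Ioi 0, ν (Set.Ioi t) * ENNReal.ofReal (γ * Real.exp (γ * t)) ≤
          ∫⁻ t in Set.Ioi (0 : ℝ), ENNReal.ofReal (γ / (γ - c)) *
            (ρ (Set.Ioi t) * ENNReal.ofReal ((γ - c) * Real.exp ((γ - c) * t))) := by
        refine setLIntegral_mono' measurableSet_Ioi fun t ht => ?_
        rw [← ofReal_measureReal, ← ofReal_measureReal (μ := ρ),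
          ← ENNReal.ofReal_mul measureReal_nonneg, ← ENNReal.ofReal_mul measureReal_nonneg,
          ← ENNReal.ofReal_mul (by positivity)]
        refine ENNReal.ofReal_le_ofReal (le_of_eq ?_)
        rw [htail t ht, ← h1, ← measureReal_compl measurableSet_Iic, Set.compl_Iic,
          show (γ - c) * t = -(c * t) + γ * t by ring, Real.exp_add]
        field_simp
      refine ne_top_of_le_ne_top ?_ hle
      rw [lintegral_const_mul' _ _ ENNReal.ofReal_ne_top]
      exact ENNReal.mul_ne_top ENNReal.ofReal_ne_top hfin
  refine ⟨hint, fun s hs => ?_⟩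
  have hzre : ((c : ℂ) - s).re = c - γ := by simp [hs]
  have hz0 : (c : ℂ) - s ≠ 0 := by
    intro h; rw [h] at hzre
    rcases hc with hc | hc
    · simp at hzre; linarith
    · have := hc.1; simp at hzre; linarith
  have hs0 : s ≠ 0 := by intro h; rw [h] at hs; simp at hs; linarith
  have hz : 0 < ((c : ℂ) - s).re ∨ ((c : ℂ) - s).re < 0 ∧ ρ.real Set.univ = 1 ∧
      Integrable (fun x : ℝ => Complex.exp (-((c : ℂ) - s) * x)) ρ := by
    rcases hc with hc | ⟨hc, h1, hi⟩
    · left; linarith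
    · right
      refine ⟨by linarith, h1, ?_⟩
      rw [integrable_cexp_iff] at hi ⊢
      simpa only [hzre, Complex.ofReal_re] using hi
  have hνi : Integrable (fun x : ℝ => Complex.exp (-(-s) * x)) ν := by
    rw [integrable_cexp_iff]
    have := hint.lintegral_lt_top
    simpa [hs] using this
  have h1 := laplace_real_Ioi hν (s := -s) (by simp [hs, hγ.ne']) hνi
  have h2 := laplace_one_sub_real_Iic hρ hz
  have h3 : ∫ t in Set.Ioi (0 : ℝ), Complex.exp (-(-s) * t) * (ν.real (Set.Ioi t) : ℂ) =
      ∫ t in Set.Ioi (0 : ℝ), Complex.exp (-((c : ℂ) - s) * t) *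
        ((1 - ρ.real (Set.Iic t) : ℝ) : ℂ) := by
    refine setIntegral_congr_fun measurableSet_Ioi fun t ht => ?_
    simp only [htail t ht]
    rw [Complex.ofReal_mul, Complex.ofReal_exp, mul_left_comm, ← Complex.exp_add, mul_comm]
    congr 2
    push_cast; ring
  -- Both sides are now the transform of the tail of the minimum: `(1 - A) / (c - s) = (B - 1) / s`,
  -- which is solved for `B`.
  rw [h3, h2] at h1
  simp only [probReal_univ, neg_neg, Complex.ofReal_one] at h1
  set A := ∫ x : ℝ, Complex.exp (-((c : ℂ) - s) * x) ∂ρ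
  set B := ∫ x : ℝ, Complex.exp (s * x) ∂ν
  field_simp at h1 ⊢
  linear_combination -h1

namespace IsBirthDeath

variable {Ω : Type*} [MeasurableSpace Ω] {P : Measure Ω} [IsProbabilityMeasure P]
  {X : ℝ≥0 → Ω → ℕ} {x₀ : ℕ} {birth death : ℕ → ℝ≥0}

lemma firstPassageLaw_Iic (h : IsBirthDeath P X x₀ birth death) (t : ℝ≥0) :
    firstPassageLaw birth death x₀ (Set.Iic t) = P {ω | firstPassage X ω ≤ t} := by
  rw [← h.measure_firstPassage measurableSet_Iic]
  congr 1
  ext ω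
  constructor
  · rintro ⟨h1, h2⟩
    rw [Set.mem_ofPred_eq, ← ENNReal.ofReal_toReal h1, ← ENNReal.ofReal_coe_nnreal]
    exact ENNReal.ofReal_le_ofReal h2
  · intro h1
    have h1 : firstPassage X ω ≤ t := h1
    exact ⟨ne_top_of_le_ne_top ENNReal.coe_ne_top h1, ENNReal.toReal_mono ENNReal.coe_ne_top h1⟩

lemma firstPassageLaw_real_univ (h : IsBirthDeath P X x₀ birth death)
    (hfin : ∀ᵐ ω ∂P, firstPassage X ω ≠ ⊤) :
    (firstPassageLaw birth death x₀).real Set.univ = 1 := by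
  rw [measureReal_def, ← h.measure_firstPassage MeasurableSet.univ]
  have : {ω | firstPassage X ω ≠ ⊤ ∧ (firstPassage X ω).toReal ∈ Set.univ} =ᵐ[P] Set.univ := by
    filter_upwards [hfin] with ω hω
    exact propext ⟨fun _ => trivial, fun _ => ⟨hω, trivial⟩⟩
  rw [measure_congr this]
  simp

end IsBirthDeath

namespace IsTaggedBook

variable {Ω 𝒳 : Type*} [MeasurableSpace Ω] {P : Measure Ω} [IsProbabilityMeasure P] {X : ℕ → 𝒳}
  {lam : Side → ℕ → 𝒳 → ℝ≥0} {mu phi : ℕ → 𝒳 → ℝ≥0} {N : ℕ} {p q₀ : Side → ℕ} {i : Side}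
  {Z : Side → ℕ → ℝ≥0 → Ω → ℕ} {Q : ℝ≥0 → Ω → ℕ → ℤ}

/-- The law of the first event other than the execution of the order. -/
lemma rivalTime_tail (hbook : IsTaggedBook P X lam mu phi N p q₀ i Z Q) (hp : p .bid < p .ask)
    {c : ℝ} (hc : c = ∑ l ∈ Finset.Ioo (p .bid) (p .ask), (lam .ask 0 (X l) : ℝ) +
      ∑ l ∈ Finset.Ioo (p .bid) (p .ask), (lam .bid 0 (X l) : ℝ)) (t : ℝ≥0) :
    P.real {ω | (t : ℝ≥0∞) < rivalTime p i Z ω} =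
      (1 - (firstPassageLaw (fun k => lam i.opp k (X (p i.opp)))
        (fun k => mu k (X (p i.opp)) + phi k (X (p i.opp))) (q₀ i.opp)).real (Set.Iic t)) *
        Real.exp (-(c * t)) := by
  have hm := hbook.measurable_clock hp (BookPath.mem_best hp i.opp)
  rw [measureReal_def, hbook.measure_lt_rivalTime hp, ENNReal.toReal_mul,
    ENNReal.toReal_ofReal (Real.exp_pos _).le, ← hc, measureReal_def,
    hbook.opposite.firstPassageLaw_Iic]
  congr 1
  have h1 : P {ω | firstPassage (Z i.opp (p i.opp)) ω ≤ t} =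
      P {ω | clock p Z (i.opp, p i.opp) ω ≤ t} := by
    refine measure_congr ?_
    filter_upwards [hbook.ae_firstPassage_eq hp i.opp] with ω hω
    change (firstPassage (Z i.opp (p i.opp)) ω ≤ t) = (clock p Z (i.opp, p i.opp) ω ≤ t)
    rw [hω]
  have h2 : {ω | (t : ℝ≥0∞) < clock p Z (i.opp, p i.opp) ω} =
      {ω | clock p Z (i.opp, p i.opp) ω ≤ t}ᶜ := by
    ext ω; simp
  rw [h1, h2, ← measureReal_def, ← measureReal_def,
    probReal_compl_eq_one_sub (measurableSet_le hm measurable_const)]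

/-- With arrivals inside the spread the tail is at most `exp (-(c n))` for every `n`; otherwise
finiteness comes from the opposite queue. -/
lemma ae_rivalTime_ne_top (hbook : IsTaggedBook P X lam mu phi N p q₀ i Z Q)
    (hp : p .bid < p .ask)
    {c : ℝ} (hc : c = ∑ l ∈ Finset.Ioo (p .bid) (p .ask), (lam .ask 0 (X l) : ℝ) +
      ∑ l ∈ Finset.Ioo (p .bid) (p .ask), (lam .bid 0 (X l) : ℝ))
    (h : 0 < c ∨ ∀ᵐ ω ∂P, firstPassage (Z i.opp (p i.opp)) ω ≠ ⊤) :
    ∀ᵐ ω ∂P, rivalTime p i Z ω ≠ ⊤ := by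
  rcases h with h | h
  · have hle : ∀ n : ℕ, P.real {ω | rivalTime p i Z ω = ⊤} ≤ Real.exp (-(c * n)) := by
      intro n
      calc P.real {ω | rivalTime p i Z ω = ⊤}
          ≤ P.real {ω | ((n : ℝ≥0) : ℝ≥0∞) < rivalTime p i Z ω} := by
            refine measureReal_mono fun ω hω => ?_
            rw [Set.mem_ofPred_eq] at hω ⊢
            rw [hω]; exact ENNReal.coe_lt_top
        _ ≤ _ := by
            rw [hbook.rivalTime_tail hp hc]
            refine mul_le_of_le_one_left (Real.exp_pos _).le ?_
            linarith [measureReal_nonneg (s := Set.Iic (((n : ℝ≥0) : ℝ)))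
              (μ := firstPassageLaw (fun k => lam i.opp k (X (p i.opp)))
                (fun k => mu k (X (p i.opp)) + phi k (X (p i.opp))) (q₀ i.opp))]
    have hlim : Tendsto (fun n : ℕ => Real.exp (-(c * n))) atTop (𝓝 0) :=
      Real.tendsto_exp_neg_atTop_nhds_zero.comp
        (tendsto_natCast_atTop_atTop.const_mul_atTop h)
    have h0 : P.real {ω | rivalTime p i Z ω = ⊤} = 0 :=
      le_antisymm (ge_of_tendsto' hlim hle) measureReal_nonneg
    rw [ae_iff]
    simpa [measureReal_eq_zero_iff] using h0
  · filter_upwards [h, hbook.ae_firstPassage_eq hp i.opp] with ω hω he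
    rw [he] at hω
    refine ne_top_of_le_ne_top hω ?_
    exact iInf₂_le (⟨_, BookPath.mem_best hp i.opp⟩ : activeQueues p)
      fun he => i.opp_ne (congrArg Prod.fst he)

/-- The fill probability in terms of the law of the first other event. -/
lemma fill_probability (hbook : IsTaggedBook P X lam mu phi N p q₀ i Z Q) (hb : 1 ≤ p .bid)
    (ha : p .ask ≤ N) (hp : p .bid < p .ask) (hfin : ∀ᵐ ω ∂P, rivalTime p i Z ω ≠ ⊤) :
    P.real (fillEvent N p i Z Q) =
      ∫ x, (firstPassageLaw (fun _ => 0) (fun k => mu k (X (p i)) + phi k (X (p i)))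
        (q₀ i)).real (Set.Iic x) ∂P.map fun ω => (rivalTime p i Z ω).toReal := by
  set ρ := firstPassageLaw (fun _ => 0) (fun k => mu k (X (p i)) + phi k (X (p i))) (q₀ i)
  have : IsFiniteMeasure ρ := hbook.position.isFiniteMeasure_firstPassageLaw
  have hS := hbook.measurable_clock hp (BookPath.mem_best hp i)
  have hT := hbook.measurable_rivalTime hp
  have hprod := (indepFun_iff_map_prod_eq_prod_map_map hS.aemeasurable hT.aemeasurable).1
    (hbook.indepFun_rivalTime hp)
  set D : Set (ℝ≥0∞ × ℝ≥0∞) := {z | z.1 ≠ ⊤ ∧ z.1 ≤ z.2}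
  have hD : MeasurableSet D := (measurable_fst (measurableSet_singleton ⊤).compl).inter
    (measurableSet_le measurable_fst measurable_snd)
  have := Measure.isProbabilityMeasure_map (μ := P) hS.aemeasurable
  have := Measure.isProbabilityMeasure_map (μ := P) hT.aemeasurable
  have hmono : Measurable fun x => ρ (Set.Iic x) :=
    Monotone.measurable fun x y hxy => measure_mono (Set.Iic_subset_Iic.2 hxy)
  have h1 : P (fillEvent N p i Z Q) = ∫⁻ ω, ρ (Set.Iic (rivalTime p i Z ω).toReal) ∂P := by
    rw [measure_congr (hbook.fillEvent_ae_eq hb ha hp)]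
    change P ((fun ω => (clock p Z (i, p i) ω, rivalTime p i Z ω)) ⁻¹' D) = _
    -- By independence the rival time can be fixed first; the section of `D` at a finite time `t` is
    -- the event that the execution occurs by `t`.
    rw [← Measure.map_apply (hS.prodMk hT) hD, hprod, Measure.prod_apply_symm hD,
      lintegral_map (measurable_measure_prodMk_right hD) hT]
    refine lintegral_congr_ae ?_
    filter_upwards [hfin] with ω hω
    rw [Measure.map_apply hS (measurable_prodMk_right hD)]
    lift rivalTime p i Z ω to ℝ≥0 using hω with t
    rw [ENNReal.coe_toReal, hbook.position.firstPassageLaw_Iic]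
    refine measure_congr ?_
    filter_upwards [hbook.ae_firstPassage_eq hp i] with ω' hω'
    change (clock p Z (i, p i) ω' ≠ ⊤ ∧ clock p Z (i, p i) ω' ≤ t) =
      (firstPassage (Z i (p i)) ω' ≤ t)
    rw [hω']
    exact propext ⟨fun h => h.2, fun h => ⟨ne_top_of_le_ne_top ENNReal.coe_ne_top h, h⟩⟩
  rw [measureReal_def, h1]
  simp only [measureReal_def]
  rw [integral_toReal hmono.aemeasurable (ae_of_all _ fun _ => measure_lt_top _ _),
    lintegral_map hmono hT.ennreal_toReal]

end IsTaggedBook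

end

/-! ### Assembly of the proposition -/

theorem mainTheorem2 {Ω 𝒳 : Type*} [MeasurableSpace Ω] (P : Measure Ω) [IsProbabilityMeasure P]
    (X : ℕ → 𝒳) (lam : Side → ℕ → 𝒳 → ℝ≥0) (mu phi : ℕ → 𝒳 → ℝ≥0)
    (N : ℕ) (p q₀ : Side → ℕ) (s₀ : ℕ) (hs₀ : 1 ≤ s₀) (hspread : p .ask = p .bid + s₀)
    (hbid : 1 ≤ p .bid) (hask : p .ask ≤ N) (hq₀ : ∀ s, 1 ≤ q₀ s)
    (i : Side) (hpos : ∀ k ∈ Finset.Icc 1 (q₀ i), 0 < mu k (X (p i)) + phi k (X (p i)))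
    (Λ : ℝ) (hΛask : Λ = ∑ m ∈ Finset.Icc 1 (s₀ - 1), (lam .ask 0 (X (p .ask - m)) : ℝ))
    (hΛbid : Λ = ∑ m ∈ Finset.Icc 1 (s₀ - 1), (lam .bid 0 (X (p .bid + m)) : ℝ))
    (Z : Side → ℕ → ℝ≥0 → Ω → ℕ) (Q : ℝ≥0 → Ω → ℕ → ℤ)
    (hbook : IsTaggedBook P X lam mu phi N p q₀ i Z Q) :
    let j := i.opp
    let ε := firstPassage (Z i (p i))
    let σ := firstPassage (Z j (p j))
    let gHat := deathTransform (fun k => mu k (X (p i)) + phi k (X (p i))) (q₀ i)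
    ∃ g f : ℝ → ℝ, IsDensity P ε g ∧ IsDensity P σ f ∧
      -- the transform of the time to fill
      (∀ s : ℂ,
        (∀ k ∈ Finset.Icc 1 (q₀ i), -((mu k (X (p i)) + phi k (X (p i)) : ℝ≥0) : ℝ) < s.re) →
        LaplaceConverges g s ∧ laplace g s = gHat s) ∧
      -- the transform of the depletion time of the opposite queue, as a product of continued fractions
      ((∀ k, 0 < lam j k (X (p j))) → (∀ k, 1 ≤ k → 0 < mu k (X (p j)) + phi k (X (p j))) →
        ∀ s : ℂ, LaplaceConverges f s →
          ∃ K : ℕ → ℂ,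
            (∀ m ∈ Finset.Icc 1 (q₀ j),
              Tendsto (fun n => contFrac
                (fun k => -(((lam j (k - 1) (X (p j)) *
                  (mu k (X (p j)) + phi k (X (p j))) : ℝ≥0) : ℝ) : ℂ))
                (fun k => (((lam j k (X (p j)) + mu k (X (p j)) + phi k (X (p j)) : ℝ≥0) : ℝ) : ℂ)
                  + s) n m) atTop (𝓝 (K m))) ∧
            laplace f s =
              ∏ m ∈ Finset.Icc 1 (q₀ j), (-(1 / ((lam j (m - 1) (X (p j)) : ℝ) : ℂ)) * K m)) ∧
      -- the fill probability, for every contour in the strip of convergence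
      (∀ γ : ℝ, 0 < γ →
        (γ < 2 * Λ ∨
          (2 * Λ < γ ∧ (∀ᵐ ω ∂P, σ ω ≠ ⊤) ∧ LaplaceConverges f ((2 * Λ - γ : ℝ) : ℂ))) →
        Integrable (fun u : ℝ => fillTransform gHat (laplace f) Λ (γ + u * Complex.I)) ∧
        ((P.real (fillEvent N p i Z Q) : ℝ) : ℂ) =
          inverseLaplace (fillTransform gHat (laplace f) Λ) γ 0) ∧
      -- the case in which no orders can be posted inside the spread
      (s₀ = 1 → ∀ s : ℂ,
        fillTransform gHat (laplace f) Λ s = 1 / s * gHat s * laplace f (-s)) := by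
  intro j ε σ gHat
  have hp : p .bid < p .ask := by omega
  set death : ℕ → ℝ≥0 := fun k => mu k (X (p i)) + phi k (X (p i))
  set birth' : ℕ → ℝ≥0 := fun k => lam j k (X (p j))
  set death' : ℕ → ℝ≥0 := fun k => mu k (X (p j)) + phi k (X (p j))
  have hε : IsBirthDeath P (Z i (p i)) (q₀ i) (fun _ => 0) death := hbook.position
  have hσ : IsBirthDeath P (Z j (p j)) (q₀ j) birth' death' := hbook.opposite
  have hqi : q₀ i ≠ 0 := by have := hq₀ i; omega
  have hqj : q₀ j ≠ 0 := by have := hq₀ j; omega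
  obtain ⟨g, hg⟩ := hε.exists_isDensity hqi
  obtain ⟨f, hf⟩ := hσ.exists_isDensity hqj
  have hgL := hε.withDensity_eq hg
  have hfL := hσ.withDensity_eq hf
  have hfinε := hε.isFiniteMeasure_firstPassageLaw
  have hfinσ := hσ.isFiniteMeasure_firstPassageLaw
  refine ⟨g, f, hg, hf, ?_, ?_, ?_, ?_⟩
  · intro s hs
    obtain ⟨h1, h2⟩ := transform_death (death := death) hs
    exact ⟨(laplaceConverges_iff hg.measurable hg.nonneg hgL).2 h1,
      (laplace_eq hg.measurable hg.nonneg hgL s).trans h2⟩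
  · intro hb hd s hs
    obtain ⟨R, hR, hprod⟩ := transform_birthDeath (birth := birth') (death := death') hb hd (hq₀ j)
      ((laplaceConverges_iff hf.measurable hf.nonneg hfL).1 hs)
    -- `R` is indexed from 0, its entry `m - 1` being the limit of the approximants starting at
    -- level `m`; the factor is that of `contFrac_eq_ladder`, and it cancels against the one in the
    -- product.
    refine ⟨fun m => -((birth' (m - 1) : ℝ) : ℂ) * R (m - 1), fun m hm => ?_, ?_⟩
    · have hm1 := (Finset.mem_Icc.1 hm).1
      have hlim := (hR (m - 1)).const_mul (-((birth' (m - 1) : ℝ) : ℂ))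
      refine hlim.congr fun n => ?_
      rw [Nat.sub_add_cancel hm1]
      refine (contFrac_eq_ladder (lam := fun k => ((birth' k : ℝ) : ℂ))
        (mu := fun k => ((death' k : ℝ) : ℂ)) (s := s) ?_ ?_ n hm1).symm
      · intro k _
        simp [birth', death']
      · intro k
        simp [birth', death']
        ring
    · rw [laplace_eq hf.measurable hf.nonneg hfL, hprod, Finset.range_eq_Ico,
        ← Finset.prod_Ico_add_right_sub_eq 0 (q₀ j) 1]
      refine Finset.prod_congr (by ext; simp) fun m _ => ?_
      have : ((lam j (m - 1) (X (p j)) : ℝ) : ℂ) ≠ 0 := by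
        exact_mod_cast (hb (m - 1)).ne'
      simp only [birth']
      field_simp
  · intro γ hγ hcase
    have hΛ : 2 * Λ = ∑ l ∈ Finset.Ioo (p .bid) (p .ask), (lam .ask 0 (X l) : ℝ) +
        ∑ l ∈ Finset.Ioo (p .bid) (p .ask), (lam .bid 0 (X l) : ℝ) := by
      rw [hspread] at hΛask ⊢
      rw [sum_Ioo_eq_ask (fun l => (lam .ask 0 (X l) : ℝ)),
        sum_Ioo_eq_bid (fun l => (lam .bid 0 (X l) : ℝ)), ← hΛask, ← hΛbid]
      ring
    have hMfin : ∀ᵐ ω ∂P, rivalTime p i Z ω ≠ ⊤ := by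
      -- In the first case `0 < γ < 2Λ` forces a positive arrival rate inside the spread.
      refine hbook.ae_rivalTime_ne_top hp hΛ ?_
      rcases hcase with h | h
      · left; linarith
      · exact Or.inr h.2.1
    have hMm := hbook.measurable_rivalTime hp
    -- Infinite times would be sent to 0 by `toReal`, but `hMfin` shows that they have probability
    -- 0.
    set ν : Measure ℝ := P.map fun ω => (rivalTime p i Z ω).toReal
    have hνprob : IsProbabilityMeasure ν :=
      Measure.isProbabilityMeasure_map hMm.ennreal_toReal.aemeasurable
    have hν0 : ∀ᵐ x ∂ν, 0 ≤ x :=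
      (ae_map_iff hMm.ennreal_toReal.aemeasurable measurableSet_Ici).2
        (ae_of_all _ fun _ => ENNReal.toReal_nonneg)
    have htail : ∀ t, 0 < t → ν.real (Set.Ioi t) =
        (1 - (firstPassageLaw birth' death' (q₀ j)).real (Set.Iic t)) *
          Real.exp (-(2 * Λ * t)) := by
      intro t ht
      lift t to ℝ≥0 using ht.le
      rw [← hbook.rivalTime_tail hp hΛ t, measureReal_def, measureReal_def,
        Measure.map_apply hMm.ennreal_toReal measurableSet_Ioi]
      congr 1
      refine measure_congr ?_
      filter_upwards [hMfin] with ω hω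
      refine propext ?_
      change (t : ℝ) < (rivalTime p i Z ω).toReal ↔ (t : ℝ≥0∞) < rivalTime p i Z ω
      rw [← ENNReal.coe_toReal, ENNReal.toReal_lt_toReal ENNReal.coe_ne_top hω]
    obtain ⟨hexp, htr⟩ := transform_of_tail
      (firstPassageLaw_absolutelyContinuous birth' death' hqj) hν0 hγ htail (by
        rcases hcase with h | ⟨h1, h2, h3⟩
        · exact Or.inl h
        · exact Or.inr ⟨h1, hσ.firstPassageLaw_real_univ h2,
            (laplaceConverges_iff hf.measurable hf.nonneg hfL).1 h3⟩)
    have hgtr : ∀ u : ℝ, ∫ x : ℝ, Complex.exp (-(γ + u * Complex.I) * x)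
        ∂firstPassageLaw (fun _ => 0) death (q₀ i) = gHat (γ + u * Complex.I) := fun u =>
      (transform_death (death := death) fun k _ => by
        have := (death k).coe_nonneg
        simp; linarith).2
    obtain ⟨hI, hE⟩ := integral_real_Iic_eq
      (firstPassageLaw_absolutelyContinuous (fun _ => 0) death hqi) hγ hexp hgtr
      (integrable_deathTransform (hq₀ i) hγ)
    have hF : ∀ u : ℝ, 1 / ((γ : ℂ) + u * Complex.I) * gHat (γ + u * Complex.I) *
        ∫ x : ℝ, Complex.exp ((γ + u * Complex.I) * x) ∂ν =
        fillTransform gHat (laplace f) Λ (γ + u * Complex.I) := by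
      intro u
      rw [htr _ (by simp), fillTransform, laplace_eq hf.measurable hf.nonneg hfL]
      push_cast
      rfl
    simp_rw [hF] at hI hE
    refine ⟨hI, ?_⟩
    rw [hbook.fill_probability hbid hask hp hMfin, hE, inverseLaplace]
    simp only [Complex.ofReal_zero, mul_zero, Complex.exp_zero, one_mul]
    -- The factor `i` from `ds = i du` cancels the one in `(2πi)⁻¹`.
    rw [integral_mul_const]
    generalize ∫ u : ℝ, fillTransform gHat (laplace f) Λ (γ + u * Complex.I) = J
    field_simp
  · rintro rfl s
    -- For unit spread the sum defining `Λ` is empty. The second summand of the bracket then has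
    -- numerator 0, so it vanishes also at `s = 0`, where the division is by 0.
    have : Λ = 0 := by simpa using hΛask
    simp [fillTransform, this]
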